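/- Let $\Omega\subset\mathbb R^n$ be a bounded connected strongly Lipschitz open set. For $q\in\mathbb R$ let $H^q=H^q(\Omega)$ be the space of restrictions to $\Omega$ of elements of $H^q(\mathbb R^n)$, with the quotient norm, and let $H^q_0=H^q_{\overline\Omega}(\mathbb R^n)$ be the subspace of $H^q(\mathbb R^n)$ of distributions supported in $\overline\Omega$, with the norm of $H^q(\mathbb R^n)$. Let $X_1,\dots,X_4$ be finite-dimensional real inner product spaces, and let $D^i$ ($i=1,2,3$) be a linear differential operator with constant coefficients of order at most $\alpha_i$, from $X_i$-valued to $X_{i+1}$-valued distributions. For an operator $D$ of this kind from $X$-valued to $Y$-valued distributions put $$H^{s,t}(D)=\{u\in H^{s}\otimes X:\ Du\in H^{t}\otimes Y\},\qquad H^{s,t}_0(D)=\{u\in H^{s}_0\otimes X:\ Du\in H^{t}_0\otimes Y\},$$ with the graph norm $\|u\|_s+\|Du\|_t$ (in $H_0^{s,t}(D)$, $Du$ is taken in the sense of distributions on $\mathbb R^n$). Let $(D^1)^*$ be the formal adjoint of $D^1$. Say that the scale $(H^q)_{q\in\mathbb R}$ has uniform cohomology for $D^1,D^2,D^3$ if there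 are finite-dimensional spaces $\mathscr H^2,\mathscr H^3$, independent of $q$, such that for every $q\in\mathbb R$ $$\ker(D^2,H^{q-\alpha_1}\otimes X_2)=D^1(H^q\otimes X_1)\oplus\mathscr H^2,\qquad \ker(D^3,H^{q-\alpha_1-\alpha_2}\otimes X_3)=D^2(H^{q-\alpha_1}\otimes X_2)\oplus\mathscr H^3 ,$$ and define uniform cohomology of the scale $(H^q_0)_{q\in\mathbb R}$ in the same way, with $H_0$ in place of $H$ (and possibly other finite-dimensional spaces). **Theorem.** Let $s_1,s_2\in\mathbb R$ with $s_1\le s_2+\alpha_2$. 1. If the scale $(H^q)$ has uniform cohomology, then $$H^{s_1,s_2}(D^2)=H^{s_2+\alpha_2}\otimes X_2+D^1\big(H^{s_1+\alpha_1}\otimes X_1\big),\qquad H^{s_1,s_2}(D^2)^*=H_0^{-s_2-\alpha_2,\,-s_1-\alpha_1}\big((D^1)^*\big).$$ 2. If the scale $(H^q_0)$ has uniform cohomology, then $$H_0^{s_1,s_2}(D^2)=H_0^{s_2+\alpha_2}\otimes X_2+D^1\big(H_0^{s_1+\alpha_1}\otimes X_1\big),\qquad H_0^{s_1,s_2}(D^2)^*=H^{-s_2-\alpha_2,\,-s_1-\alpha_1}\big((D^1)^*\big).$$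 Here a duality $V^*=W$ means that there is a linear isomorphism from the topological dual of $V$ onto $W$, with norms equivalent up to positive constants, which sends a functional $\ell$ to the distribution $w\in W$ with $\ell(\varphi)=\langle w,\varphi\rangle$ for all smooth fields $\varphi$, where $\varphi\in C_c^\infty(\mathbb R^n;X_2)$ (restricted to $\Omega$ on the left-hand side) in part 1 and $\varphi\in C_c^\infty(\Omega;X_2)$ in part 2. -/

import Mathlib

open TopologicalSpace MeasureTheory
open scoped Distributions SchwartzMap LineDeriv

noncomputable section

namespace SobolevComplex

/-- Euclidean space `ℝⁿ`. -/
abbrev Euc (n : ℕ) : Type := EuclideanSpace ℝ (Fin n)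

/-- `Ω ⊆ ℝⁿ` is a bounded (strongly) Lipschitz domain: a bounded connected open set which, near
each boundary point and in suitable orthonormal coordinates, is the region lying on one side of the
graph of a Lipschitz function. The unit vector `e` is the vertical direction, `⟪e, x⟫` the height of
`x`, and `x - ⟪e, x⟫ e` the horizontal part of `x`. -/
structure IsLipschitzDomain {n : ℕ} (Ω : Opens (Euc n)) : Prop where
  connected : IsConnected (Ω : Set (Euc n))
  bounded : Bornology.IsBounded (Ω : Set (Euc n))
  locally_graph : ∀ x₀ ∈ frontier (Ω : Set (Euc n)),
    ∃ (e : Euc n) (r : ℝ) (K : NNReal) (g : Euc n → ℝ),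
      ‖e‖ = 1 ∧ 0 < r ∧ LipschitzWith K g ∧
      ∀ x ∈ Metric.ball x₀ r, x ∈ Ω ↔ g (x - (inner ℝ e x : ℝ) • e) < inner ℝ e x

section Spaces

variable {n : ℕ}

/-- A real test function on `U ⊆ ℝⁿ`, extended by zero, as a complex Schwartz function on `ℝⁿ`. -/
def toSchwartz {U : Opens (Euc n)} (φ : 𝓓(U, ℝ)) : 𝓢(Euc n, ℂ) :=
  HasCompactSupport.toSchwartzMap (f := fun x => (φ x : ℂ))
    (φ.hasCompactSupport.comp_left (g := fun t : ℝ => (t : ℂ)) Complex.ofReal_zero)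
    (Complex.ofRealCLM.contDiff.comp φ.contDiff)

theorem toSchwartz_apply {U : Opens (Euc n)} (φ : 𝓓(U, ℝ)) (x : Euc n) :
    toSchwartz φ x = (φ x : ℂ) := rfl

/-- The tempered distribution `T` on `ℝⁿ` restricts to the real distribution `u` on `U`. -/
def Extends {U : Opens (Euc n)} (T : 𝓢'(Euc n, ℂ)) (u : 𝓓'(U, ℝ)) : Prop :=
  ∀ φ : 𝓓(U, ℝ), T (toSchwartz φ) = ((u φ : ℝ) : ℂ)

/-- The scalar Sobolev space `H^s(U)`, `s ∈ ℝ`: the distributions on `U` that are restrictions to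
`U` of elements of `H^s(ℝⁿ)`. For `U = ⊤` this is `H^s(ℝⁿ)` itself. -/
def scalarSobolev (U : Opens (Euc n)) (s : ℝ) : Submodule ℝ 𝓓'(U, ℝ) where
  carrier := {u | ∃ T : 𝓢'(Euc n, ℂ), TemperedDistribution.MemSobolev s 2 T ∧ Extends T u}
  zero_mem' := ⟨0, TemperedDistribution.memSobolev_fun_zero _ _ s 2, fun φ => by simp⟩
  add_mem' := by
    rintro u v ⟨T, hT, hu⟩ ⟨S, hS, hv⟩
    refine ⟨T + S, hT.add hS, fun φ => ?_⟩
    have h1 := hu φ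
    have h2 := hv φ
    simp [h1, h2]
  smul_mem' := by
    rintro c u ⟨T, hT, hu⟩
    refine ⟨(c : ℂ) • T, hT.smul (c : ℂ), fun φ => ?_⟩
    have h1 := hu φ
    simp [h1]

/-- The (quotient) norm of `H^s(U)`: the infimum of the `H^s(ℝⁿ)`-norms of all extensions. The
`H^s(ℝⁿ)`-norm of `T` is the `L²`-norm of its Bessel potential `f`. -/
def scalarSobolevNorm (U : Opens (Euc n)) (s : ℝ) (u : 𝓓'(U, ℝ)) : ℝ :=
  sInf {r : ℝ | ∃ (T : 𝓢'(Euc n, ℂ)) (f : Lp ℂ 2 (volume : Measure (Euc n))),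
    TemperedDistribution.besselPotential (Euc n) ℂ s T = (f : 𝓢'(Euc n, ℂ)) ∧
      Extends T u ∧ r = ‖f‖}

variable (X : Type*) [NormedAddCommGroup X] [InnerProductSpace ℝ X] [FiniteDimensional ℝ X]

/-- The component `⟨u, x⟩` of an `X`-valued distribution `u` along `x ∈ X`. -/
def component {X : Type*} [NormedAddCommGroup X] [InnerProductSpace ℝ X] {U : Opens (Euc n)}
    (x : X) : 𝓓'(U, X) →ₗ[ℝ] 𝓓'(U, ℝ) :=
  (Distribution.mapCLM (innerSL ℝ x)).toLinearMap

/-- `H^s(U) ⊗ X`: the `X`-valued distributions on `U` all of whose components are in `H^s(U)`. -/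
def sobolev (U : Opens (Euc n)) (s : ℝ) : Submodule ℝ 𝓓'(U, X) :=
  ⨅ x : X, (scalarSobolev U s).comap (component x)

variable {X} in
/-- The norm of `H^s(U) ⊗ X`, computed in an orthonormal basis of `X`. -/
def sobolevNorm (U : Opens (Euc n)) (s : ℝ) (u : 𝓓'(U, X)) : ℝ :=
  Real.sqrt (∑ i, scalarSobolevNorm U s (component (stdOrthonormalBasis ℝ X i) u) ^ 2)

/-- The `X`-valued distributions on `ℝⁿ` with support in the closure of `Ω`, i.e. which vanish on
every test function supported in the complement of that closure. -/
def supportedIn (Ω : Opens (Euc n)) : Submodule ℝ 𝓓'((⊤ : Opens (Euc n)), X) where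
  carrier := {u | Distribution.IsVanishingOn u (closure (Ω : Set (Euc n)))ᶜ}
  zero_mem' := fun φ _ => by simp
  add_mem' := by
    intro u v hu hv φ hφ
    have h1 := hu φ hφ
    have h2 := hv φ hφ
    simp [h1, h2]
  smul_mem' := by
    intro c u hu φ hφ
    have h1 := hu φ hφ
    simp [h1]

/-- `H^s_{Ω̄}(ℝⁿ) ⊗ X`: the elements of `H^s(ℝⁿ) ⊗ X` with support in the closure of `Ω`. Its norm
is that of `H^s(ℝⁿ) ⊗ X`. -/
def sobolevZero (Ω : Opens (Euc n)) (s : ℝ) : Submodule ℝ 𝓓'((⊤ : Opens (Euc n)), X) :=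
  sobolev X ⊤ s ⊓ supportedIn X Ω

end Spaces

/-- A linear differential operator of order (at most) `α` on `ℝⁿ` with constant coefficients, from
`X`-valued to `Y`-valued fields:
`D = ∑_{k ≤ α} ∑_{I ∈ {1,…,n}^k} A_{k,I} ∂_{I 1} ⋯ ∂_{I k}` with linear maps `A_{k,I} : X → Y`. -/
structure DiffOp (n α : ℕ) (X Y : Type*) [NormedAddCommGroup X] [InnerProductSpace ℝ X]
    [NormedAddCommGroup Y] [InnerProductSpace ℝ Y] where
  coeff : (k : Fin (α + 1)) → (Fin k → Fin n) → (X →ₗ[ℝ] Y)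

namespace DiffOp

variable {n α : ℕ} {X Y : Type*} [NormedAddCommGroup X] [InnerProductSpace ℝ X]
  [FiniteDimensional ℝ X] [NormedAddCommGroup Y] [InnerProductSpace ℝ Y] [FiniteDimensional ℝ Y]

/-- The action of a differential operator on distributions on an open set `U`. -/
def onDist (D : DiffOp n α X Y) (U : Opens (Euc n)) : 𝓓'(U, X) →ₗ[ℝ] 𝓓'(U, Y) :=
  ∑ k : Fin (α + 1), ∑ I : Fin k → Fin n,
    (Distribution.mapCLM (LinearMap.toContinuousLinearMap (D.coeff k I))).toLinearMap ∘ₗ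
      (LineDeriv.iteratedLineDerivOpCLM ℝ 𝓓'(U, X)
        (fun i => EuclideanSpace.single (I i) (1 : ℝ) : Fin k → Euc n)).toLinearMap

/-- The formal adjoint `D^* = ∑_{k,I} (-1)^k A_{k,I}^* ∂_{I 1} ⋯ ∂_{I k}`. -/
def adjoint (D : DiffOp n α X Y) : DiffOp n α Y X where
  coeff k I := (-1 : ℝ) ^ (k : ℕ) • LinearMap.adjoint (D.coeff k I)

/-- `H^{s₁,s₂}(D; X) = {u ∈ H^{s₁}(Ω) ⊗ X : D u ∈ H^{s₂}(Ω) ⊗ Y}`. -/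
def space (D : DiffOp n α X Y) (Ω : Opens (Euc n)) (s₁ s₂ : ℝ) : Submodule ℝ 𝓓'(Ω, X) :=
  sobolev X Ω s₁ ⊓ (sobolev Y Ω s₂).comap (D.onDist Ω)

/-- `H_0^{s₁,s₂}(D; X) = {u ∈ H^{s₁}_{Ω̄} ⊗ X : D u ∈ H^{s₂}_{Ω̄} ⊗ Y}`, where `D u` is taken in the
sense of distributions on `ℝⁿ`. -/
def spaceZero (D : DiffOp n α X Y) (Ω : Opens (Euc n)) (s₁ s₂ : ℝ) :
    Submodule ℝ 𝓓'((⊤ : Opens (Euc n)), X) :=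
  sobolevZero X Ω s₁ ⊓ (sobolevZero Y Ω s₂).comap (D.onDist ⊤)

/-- The graph norm `‖u‖_{s₁} + ‖D u‖_{s₂}`. It is used on `H^{s₁,s₂}(D; X)` with `U = Ω` and on
`H_0^{s₁,s₂}(D; X)` with `U = ⊤`. -/
def graphNorm (D : DiffOp n α X Y) (U : Opens (Euc n)) (s₁ s₂ : ℝ) (u : 𝓓'(U, X)) : ℝ :=
  sobolevNorm U s₁ u + sobolevNorm U s₂ (D.onDist U u)

end DiffOp

/-- The sequence `S₁ q → S₂ (q - α₁) → S₃ (q - α₁ - α₂) → ⋯` with operators `D₁, D₂, D₃` is a Hilbert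
scale, i.e. has uniform cohomology: for finite dimensional spaces `H₂`, `H₃` independent of `q`, and
all real `q`, the kernel of `D₂` in `S₂ (q - α₁)` is the direct sum of `D₁ (S₁ q)` and `H₂`, and the
kernel of `D₃` in `S₃ (q - α₁ - α₂)` is the direct sum of `D₂ (S₂ (q - α₁))` and `H₃`. -/
def IsHilbertScale {V₁ V₂ V₃ V₄ : Type*} [AddCommGroup V₁] [Module ℝ V₁] [AddCommGroup V₂]
    [Module ℝ V₂] [AddCommGroup V₃] [Module ℝ V₃] [AddCommGroup V₄] [Module ℝ V₄]
    (α₁ α₂ : ℕ) (D₁ : V₁ →ₗ[ℝ] V₂) (D₂ : V₂ →ₗ[ℝ] V₃) (D₃ : V₃ →ₗ[ℝ] V₄)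
    (S₁ : ℝ → Submodule ℝ V₁) (S₂ : ℝ → Submodule ℝ V₂) (S₃ : ℝ → Submodule ℝ V₃) : Prop :=
  ∃ (H₂ : Submodule ℝ V₂) (H₃ : Submodule ℝ V₃),
    FiniteDimensional ℝ H₂ ∧ FiniteDimensional ℝ H₃ ∧
    ∀ q : ℝ,
      (S₂ (q - α₁) ⊓ LinearMap.ker D₂ = (S₁ q).map D₁ ⊔ H₂ ∧ Disjoint ((S₁ q).map D₁) H₂) ∧
      (S₃ (q - α₁ - α₂) ⊓ LinearMap.ker D₃ = (S₂ (q - α₁)).map D₂ ⊔ H₃ ∧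
        Disjoint ((S₂ (q - α₁)).map D₂) H₃)

section Duality

/-- The topological dual of the space `V` normed by `N`: the bounded linear functionals on `V`. -/
def boundedDual {E : Type*} [AddCommGroup E] [Module ℝ E] (V : Submodule ℝ E) (N : E → ℝ) :
    Submodule ℝ (Module.Dual ℝ V) where
  carrier := {l | ∃ C : ℝ, ∀ v : V, |l v| ≤ C * N v}
  zero_mem' := ⟨0, fun v => by simp⟩
  add_mem' := by
    rintro l m ⟨C, hl⟩ ⟨C', hm⟩
    refine ⟨C + C', fun v => ?_⟩
    have h1 := hl v
    have h2 := hm v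
    have h3 := abs_add_le (l v) (m v)
    simp only [LinearMap.add_apply]
    linarith
  smul_mem' := by
    rintro c l ⟨C, hl⟩
    refine ⟨|c| * C, fun v => ?_⟩
    have h1 := mul_le_mul_of_nonneg_left (hl v) (abs_nonneg c)
    simp only [LinearMap.smul_apply, smul_eq_mul, abs_mul]
    linarith

/-- The dual (operator) norm of a functional on the space `V` normed by `N`. -/
def dualNorm {E : Type*} [AddCommGroup E] [Module ℝ E] (V : Submodule ℝ E) (N : E → ℝ)
    (l : Module.Dual ℝ V) : ℝ :=
  sInf {C : ℝ | 0 ≤ C ∧ ∀ v : V, |l v| ≤ C * N v}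

variable {n : ℕ} {X : Type*} [NormedAddCommGroup X] [InnerProductSpace ℝ X]
  [FiniteDimensional ℝ X]

/-- The smooth field `y ↦ φ y • x` (with `φ` a test function on `U'` and `x ∈ X`), restricted to `U`
and regarded as a distribution on `U`. -/
def smoothDist (U : Opens (Euc n)) {U' : Opens (Euc n)} (φ : 𝓓(U', ℝ)) (x : X) : 𝓓'(U, X) :=
  ContinuousLinearMap.toUniformConvergenceCLM _ _ _
  (TestFunction.integralAgainstBilinCLM (ContinuousLinearMap.lsmul ℝ ℝ) volume
    (fun y => φ y • x))

theorem smoothDist_apply (U : Opens (Euc n)) {U' : Opens (Euc n)} (φ : 𝓓(U', ℝ)) (x : X)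
    (ψ : 𝓓(U, ℝ)) : smoothDist U φ x ψ = ∫ y, ψ y • φ y • x := by
  have h : LocallyIntegrableOn (fun y => φ y • x) (U : Set (Euc n)) volume :=
    ((φ.continuous.smul continuous_const).locallyIntegrable).locallyIntegrableOn _
  exact TestFunction.integralAgainstBilinCLM_eq_integral h

/-- `V^* = W`, where `V` is a space of `X`-valued distributions on `U` with norm `N` and `W` is a
space of `X`-valued distributions on `U'` with norm `M`: smooth fields `φ x` with `φ ∈ C_c^∞(U')`,
`x ∈ X`, belong to `V`, and there is a linear isomorphism from the topological dual of `V` onto `W`,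
bounded in both directions, which sends a functional `l` to the distribution
`φ x ↦ l (φ x)`. -/
def IsDual {U U' : Opens (Euc n)} (V : Submodule ℝ 𝓓'(U, X)) (N : 𝓓'(U, X) → ℝ)
    (W : Submodule ℝ 𝓓'(U', X)) (M : 𝓓'(U', X) → ℝ) : Prop :=
  ∃ T : boundedDual V N ≃ₗ[ℝ] W,
    (∀ (l : boundedDual V N) (φ : 𝓓(U', ℝ)) (x : X),
      ∃ h : smoothDist U φ x ∈ V,
        (l : Module.Dual ℝ V) ⟨smoothDist U φ x, h⟩ = inner ℝ ((T l : 𝓓'(U', X)) φ) x) ∧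
    ∃ c C : ℝ, 0 < c ∧ 0 < C ∧ ∀ l : boundedDual V N,
      c * dualNorm V N (l : Module.Dual ℝ V) ≤ M (T l : 𝓓'(U', X)) ∧
      M (T l : 𝓓'(U', X)) ≤ C * dualNorm V N (l : Module.Dual ℝ V)

end Duality

end SobolevComplex

end

open SobolevComplex

/-! Both parts are proved at once for scales `F₁`, `F₂`, `F₃`, of which `F₁` and `F₂` are in duality
with `G₁` and `G₂`.

Decomposition. If `u` and `D₂ u` have orders `s₁` and `s₂`, then `D₂ u` is closed for `D₃`, so `D₂ u
= D₂ a + k` with `a` of order `s₂ + α₂` and `k` in `H₃`. Since `H₃` does not depend on the order, `k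
= D₂ (u - a)` lies in `H₃` and in the image of `D₂` at the lower order, and so vanishes. Then `u -
a` is closed and is `D₁ b` plus an element of `H₂`, which belongs to every order and joins `a`. This
is `IsHilbertScale.space_eq`; the open mapping theorem makes it bounded
(`IsHilbertScale.exists_bounded_decomposition`).

Duality. A functional on the graph space, tested on smooth fields `Φ` and on `D₁ Φ`, gives `w` of
order `-(s₂ + α₂)` with `D₁* w` of order `-(s₁ + α₁)`. Conversely such a `w` must be bounded on
smooth `Φ` in the graph norm (`exists_abs_pair_le`). Write `Φ = a + D₁ b`; the term with `a` is
harmless, and one wants `⟨w, D₁ b⟩ = ⟨D₁* w, b⟩`, although `b` has only order `s₁ + α₁`. As `D₁ b =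
Φ - a` has order `t = s₂ + α₂`, there is `b'` of order `t + α₁` with `D₁ b' = D₁ b`. The difference
`b - b'` is in the kernel of `D₁`, and it suffices to approximate it by kernel elements `c` of order
`t + α₁`: then `b' + c` is close to `b`, has the same image, and can be approximated by smooth
fields at the higher order.

Density of regular elements in the kernel (`exists_kernel_approx`) gains one order at a time. On a
Lipschitz domain, localise by a partition of unity and mollify each piece with a slightly translated
kernel. A constant-coefficient operator commutes with mollification, and its commutator with a
cutoff has order `α - 1`. Hence the approximations `Φ` of a kernel element satisfy `D₁ Φ → 0` in a
norm one order better than expected (`exists_test_approx`). A bounded potential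
(`IsHilbertScale.exists_bounded_potential`) then corrects `Φ` to a kernel element of order one
higher. -/

noncomputable section
namespace SobolevComplex

/-! ### Open mapping, Hahn–Banach and Riesz arguments. -/

section FunctionalAnalysis

/-- A relation version of the open mapping theorem. -/
theorem exists_lift_norm_le {E G Y : Type*} [NormedAddCommGroup E] [NormedSpace ℝ E]
    [CompleteSpace E] [NormedAddCommGroup G] [NormedSpace ℝ G] [CompleteSpace G]
    [AddCommGroup Y] [Module ℝ Y] [TopologicalSpace Y] [T2Space Y]
    (L : E →ₗ[ℝ] Y) (M : G →ₗ[ℝ] Y) (hL : Continuous L) (hM : Continuous M)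
    (h : ∀ y, ∃ x, L x = M y) : ∃ C : ℝ, 0 ≤ C ∧ ∀ y, ∃ x, L x = M y ∧ ‖x‖ ≤ C * ‖y‖ := by
  -- The fibre product of `L` and `M` is a Banach space whose projection to `G` is onto. Of `Y` only
  -- the Hausdorff property is used, so pointwise convergence on test functions is a sufficient
  -- topology in the applications.
  let Z : Submodule ℝ (E × G) :=
    LinearMap.eqLocus (L ∘ₗ LinearMap.fst ℝ E G) (M ∘ₗ LinearMap.snd ℝ E G)
  have hZ : IsClosed (Z : Set (E × G)) :=
    isClosed_eq (hL.comp continuous_fst) (hM.comp continuous_snd)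
  have : CompleteSpace Z := hZ.completeSpace_coe
  let p : Z →L[ℝ] G := (ContinuousLinearMap.snd ℝ E G).comp Z.subtypeL
  have hp : Function.Surjective p := by
    intro y
    obtain ⟨x, hx⟩ := h y
    exact ⟨⟨(x, y), hx⟩, rfl⟩
  obtain ⟨C, hC, H⟩ := p.exists_preimage_norm_le hp
  refine ⟨C, hC.le, fun y => ?_⟩
  obtain ⟨⟨⟨x, y'⟩, hz⟩, rfl, hn⟩ := H y
  exact ⟨x, hz, (le_trans (le_max_left _ _) hn)⟩

/-- Hahn–Banach for a functional dominated along a linear map by a sublinear function. -/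
theorem exists_extension_of_le_comp {V E : Type*} [AddCommGroup V] [Module ℝ V] [AddCommGroup E]
    [Module ℝ E] (N : E → ℝ) (N_hom : ∀ c : ℝ, 0 < c → ∀ x, N (c • x) = c * N x)
    (N_add : ∀ x y, N (x + y) ≤ N x + N y) (N_zero : N 0 = 0)
    (B : V →ₗ[ℝ] E) (L : V →ₗ[ℝ] ℝ) (h : ∀ v, L v ≤ N (B v)) :
    ∃ l : E →ₗ[ℝ] ℝ, (∀ v, l (B v) = L v) ∧ ∀ x, l x ≤ N x := by
  -- `L` descends to the range of `B`, because the bound for `v` and for `-v` forces it to vanish on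
  -- the kernel.
  have hk : ∀ v, B v = 0 → L v = 0 := by
    intro v hv
    have h1 := h v
    have h2 := h (-v)
    rw [map_neg, map_neg, hv, neg_zero, N_zero] at h2
    rw [hv, N_zero] at h1
    linarith
  have hker : LinearMap.ker B.rangeRestrict ≤ LinearMap.ker L := by
    intro v hv
    rw [LinearMap.ker_rangeRestrict] at hv
    exact hk v hv
  obtain ⟨g, hg⟩ : ∃ g : LinearMap.range B →ₗ[ℝ] ℝ, ∀ v, g (B.rangeRestrict v) = L v := by
    obtain ⟨r, hr⟩ := B.rangeRestrict.exists_rightInverse_of_surjective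
      (LinearMap.range_rangeRestrict B)
    refine ⟨L ∘ₗ r, fun v => ?_⟩
    have h1 : r (B.rangeRestrict v) - v ∈ LinearMap.ker B.rangeRestrict := by
      rw [LinearMap.mem_ker, map_sub, ← LinearMap.comp_apply, hr]
      simp
    have h2 := hker h1
    rw [LinearMap.mem_ker, map_sub, sub_eq_zero] at h2
    exact h2
  obtain ⟨l, hl, hl'⟩ := exists_extension_of_le_sublinear ⟨LinearMap.range B, g⟩ N N_hom N_add
    (by
      rintro ⟨_, v, rfl⟩
      have := hg v
      change g (B.rangeRestrict v) ≤ N (B v)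
      rw [this]
      exact h v)
  refine ⟨l, fun v => ?_, hl'⟩
  rw [← hg v]
  exact hl (B.rangeRestrict v)

/-- Riesz representation of a functional bounded along a linear map into a Hilbert space. -/
theorem exists_inner_eq_of_le_norm {V H : Type*} [AddCommGroup V] [Module ℝ V]
    [NormedAddCommGroup H] [InnerProductSpace ℝ H] [CompleteSpace H]
    (B : V →ₗ[ℝ] H) (L : V →ₗ[ℝ] ℝ) (C : ℝ) (hC : 0 ≤ C) (h : ∀ v, L v ≤ C * ‖B v‖) :
    ∃ g : H, ‖g‖ ≤ C ∧ ∀ v, L v = inner ℝ g (B v) := by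
  obtain ⟨l, hl, hl'⟩ := exists_extension_of_le_comp (fun x : H => C * ‖x‖)
    (fun c hc x => by rw [norm_smul, Real.norm_of_nonneg hc.le]; ring)
    (fun x y => by rw [← mul_add]; exact mul_le_mul_of_nonneg_left (norm_add_le x y) hC)
    (by simp) B L h
  have hb : ∀ x, ‖l x‖ ≤ C * ‖x‖ := by
    intro x
    rw [Real.norm_eq_abs, abs_le]
    have := hl' (-x)
    rw [map_neg, norm_neg] at this
    exact ⟨by linarith, hl' x⟩
  let l' : H →L[ℝ] ℝ := l.mkContinuous C hb
  refine ⟨(InnerProductSpace.toDual ℝ H).symm l', ?_, fun v => ?_⟩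
  · rw [LinearIsometryEquiv.norm_map]
    exact l.mkContinuous_norm_le hC hb
  · rw [InnerProductSpace.toDual_symm_apply, ← hl v]
    rfl

end FunctionalAnalysis

/-! ### Sobolev spaces on the whole space, parametrised by square integrable functions. -/

section TemperedSobolev

open TemperedDistribution FourierTransform

variable {n : ℕ}

/-- The Hilbert space `L²(ℝⁿ; ℂ)`. -/
abbrev LTwo (n : ℕ) : Type := Lp ℂ 2 (volume : Measure (Euc n))

/-- The symbol of the Bessel potential. -/
def besselSymbol (n : ℕ) (s : ℝ) : Euc n → ℂ := fun x => ((1 + ‖x‖ ^ 2) ^ (s / 2) : ℝ)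

theorem besselSymbol_hasTemperateGrowth (s : ℝ) : (besselSymbol n s).HasTemperateGrowth := by
  unfold besselSymbol
  fun_prop

theorem norm_besselSymbol (s : ℝ) (x : Euc n) :
    ‖besselSymbol n s x‖ = (1 + ‖x‖ ^ 2) ^ (s / 2) := by
  rw [besselSymbol, Complex.norm_real, Real.norm_of_nonneg (by positivity)]

/-- The parametrisation of `H^s(ℝⁿ)` by `L²(ℝⁿ)`. -/
def sob (s : ℝ) : LTwo n →L[ℂ] 𝓢'(Euc n, ℂ) :=
  (besselPotential (Euc n) ℂ (-s)).comp (Lp.toTemperedDistributionCLM ℂ volume 2)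

/-- The Bessel potential of a Schwartz function, as an element of `L²(ℝⁿ)`. -/
def bes (s : ℝ) : 𝓢(Euc n, ℂ) →L[ℂ] LTwo n :=
  (SchwartzMap.toLpCLM ℂ ℂ 2 volume).comp (SchwartzMap.fourierMultiplierCLM ℂ (besselSymbol n s))

theorem besselPotential_eq_iff_sob_eq (s : ℝ) (T : 𝓢'(Euc n, ℂ)) (f : LTwo n) :
    besselPotential (Euc n) ℂ s T = (f : 𝓢'(Euc n, ℂ)) ↔ sob s f = T := by
  rw [← besselPotential_neg_apply_eq_iff]
  rfl

theorem memSobolev_iff_exists_sob {s : ℝ} {T : 𝓢'(Euc n, ℂ)} :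
    MemSobolev s 2 T ↔ ∃ f : LTwo n, sob s f = T :=
  exists_congr fun f => besselPotential_eq_iff_sob_eq s T f

theorem sob_injective (s : ℝ) : Function.Injective (sob (n := n) s) := by
  intro f g h
  have h1 := (besselPotential_eq_iff_sob_eq s (sob s g) f).2 h
  have h2 := (besselPotential_eq_iff_sob_eq s (sob s g) g).2 rfl
  have h3 : Lp.toTemperedDistributionCLM ℂ volume 2 f = Lp.toTemperedDistributionCLM ℂ volume 2 g :=
    h1.symm.trans h2
  exact LinearMap.ker_eq_bot.1 (Lp.ker_toTemperedDistributionCLM_eq_bot (F := ℂ)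
    (μ := (volume : Measure (Euc n))) (p := 2)) h3

theorem sob_bes (s : ℝ) (φ : 𝓢(Euc n, ℂ)) : sob s (bes s φ) = (φ : 𝓢'(Euc n, ℂ)) := by
  rw [← besselPotential_eq_iff_sob_eq]
  change _ = Lp.toTemperedDistribution ((SchwartzMap.toLp _ 2 volume))
  rw [Lp.toTemperedDistribution_toLp_eq]
  exact fourierMultiplierCLM_toTemperedDistributionCLM_eq (besselSymbol_hasTemperateGrowth s) φ

theorem fourierInv_apply_neg (φ : 𝓢(Euc n, ℂ)) (x : Euc n) : 𝓕⁻ φ x = 𝓕 φ (-x) := by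
  rw [SchwartzMap.fourierInv_apply_eq]
  rfl

/-- The Fourier transform and its inverse differ by a reflection, which an even symbol does not see.
Hence such a multiplier is its own transpose. -/
theorem fourier_smulLeft_fourierInv {g : Euc n → ℂ} (hg : g.HasTemperateGrowth)
    (he : ∀ x, g (-x) = g x) (φ : 𝓢(Euc n, ℂ)) :
    𝓕 (SchwartzMap.smulLeftCLM ℂ g (𝓕⁻ φ)) = SchwartzMap.fourierMultiplierCLM ℂ g φ := by
  rw [SchwartzMap.fourierMultiplierCLM_apply]
  let N := SchwartzMap.compCLMOfContinuousLinearEquiv ℂ (D := Euc n) (E := Euc n) (F := ℂ)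
    (LinearIsometryEquiv.neg ℝ (E := Euc n))
  have h1 : ∀ ψ : 𝓢(Euc n, ℂ), 𝓕⁻ ψ = N (𝓕 ψ) := fun ψ => SchwartzMap.fourierInv_apply_eq ψ
  have hN : ∀ (ψ : 𝓢(Euc n, ℂ)) x, N ψ x = ψ (-x) := fun ψ x => rfl
  have h2 : ∀ ψ : 𝓢(Euc n, ℂ), 𝓕⁻ ψ = 𝓕 (N ψ) := by
    intro ψ
    have h3 : N (𝓕⁻ (N ψ)) = 𝓕 (N ψ) := by
      rw [h1]
      ext x
      simp [hN]
    rw [← h3]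
    have h4 : 𝓕 (N (𝓕⁻ (N ψ))) = ψ := by
      rw [h3]
      ext x
      have h5 := h1 (𝓕 (N ψ))
      rw [FourierTransform.fourierInv_fourier_eq] at h5
      have h6 := congrArg (fun f : 𝓢(Euc n, ℂ) => f (-x)) h5
      simp only [hN, neg_neg] at h6
      exact h6.symm
    rw [← h4, FourierTransform.fourierInv_fourier_eq, h4]
  rw [h2 (SchwartzMap.smulLeftCLM ℂ g (𝓕 φ))]
  congr 1
  ext x
  rw [SchwartzMap.smulLeftCLM_apply_apply hg, hN, SchwartzMap.smulLeftCLM_apply_apply hg,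
    fourierInv_apply_neg, he]

theorem besselSymbol_neg (s : ℝ) (x : Euc n) : besselSymbol n s (-x) = besselSymbol n s x := by
  simp [besselSymbol]

/-- The Bessel potential is symmetric for the bilinear pairing, so it can be moved onto the test
function. -/
theorem sob_apply (s : ℝ) (f : LTwo n) (φ : 𝓢(Euc n, ℂ)) :
    sob s f φ = ∫ x, bes (-s) φ x * f x := by
  change besselPotential (Euc n) ℂ (-s) (Lp.toTemperedDistribution f) φ = _
  rw [besselPotential, fourierMultiplierCLM_apply_apply]
  change Lp.toTemperedDistribution f
    (𝓕 (SchwartzMap.smulLeftCLM ℂ (besselSymbol n (-s)) (𝓕⁻ φ))) = _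
  rw [fourier_smulLeft_fourierInv (besselSymbol_hasTemperateGrowth (-s)) (besselSymbol_neg _),
    Lp.toTemperedDistribution_apply]
  apply integral_congr_ae
  filter_upwards [(SchwartzMap.fourierMultiplierCLM ℂ (besselSymbol n (-s)) φ).coeFn_toLp 2 volume]
    with x hx
  rw [smul_eq_mul]
  congr 1
  exact hx.symm


/-- `T` belongs to `H^s(ℝⁿ)` with norm at most `c`. -/
def SobBound (s : ℝ) (T : 𝓢'(Euc n, ℂ)) (c : ℝ) : Prop :=
  ∃ f : LTwo n, sob s f = T ∧ ‖f‖ ≤ c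

theorem SobBound.memSobolev {s c : ℝ} {T : 𝓢'(Euc n, ℂ)} (h : SobBound s T c) :
    MemSobolev s 2 T :=
  memSobolev_iff_exists_sob.2 ⟨h.choose, h.choose_spec.1⟩

theorem SobBound.mono {s c c' : ℝ} {T : 𝓢'(Euc n, ℂ)} (h : SobBound s T c) (hc : c ≤ c') :
    SobBound s T c' :=
  ⟨h.choose, h.choose_spec.1, h.choose_spec.2.trans hc⟩

theorem SobBound.add {s c c' : ℝ} {T T' : 𝓢'(Euc n, ℂ)} (h : SobBound s T c)
    (h' : SobBound s T' c') : SobBound s (T + T') (c + c') := by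
  obtain ⟨f, rfl, hf⟩ := h
  obtain ⟨f', rfl, hf'⟩ := h'
  exact ⟨f + f', map_add _ _ _, (norm_add_le _ _).trans (add_le_add hf hf')⟩

theorem SobBound.smul {s c : ℝ} {T : 𝓢'(Euc n, ℂ)} (h : SobBound s T c) (a : ℂ) :
    SobBound s (a • T) (‖a‖ * c) := by
  obtain ⟨f, rfl, hf⟩ := h
  exact ⟨a • f, map_smul _ _ _, (norm_smul_le _ _).trans
    (mul_le_mul_of_nonneg_left hf (norm_nonneg a))⟩

theorem SobBound.sub {s c c' : ℝ} {T T' : 𝓢'(Euc n, ℂ)} (h : SobBound s T c)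
    (h' : SobBound s T' c') : SobBound s (T - T') (c + c') := by
  have h1 := h.add (h'.smul (-1))
  have h2 : (-1 : ℂ) • T' = -T' := by ext; simp
  rw [h2, ← sub_eq_add_neg] at h1
  simpa using h1

theorem SobBound.sum {ι : Type*} (t : Finset ι) {s : ℝ} {c : ι → ℝ} {T : ι → 𝓢'(Euc n, ℂ)}
    (h : ∀ i ∈ t, SobBound s (T i) (c i)) : SobBound s (∑ i ∈ t, T i) (∑ i ∈ t, c i) := by
  classical
  induction t using Finset.induction_on with
  | empty => exact ⟨0, by simp, by simp⟩
  | insert a t ha ih =>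
    rw [Finset.sum_insert ha, Finset.sum_insert ha]
    exact (h a (Finset.mem_insert_self _ _)).add
      (ih fun i hi => h i (Finset.mem_insert_of_mem hi))

/-- A bounded Fourier multiplier on `L²`. -/
theorem exists_fourierMultiplier_lTwo {g : Euc n → ℂ} (hg : g.HasTemperateGrowth) {C : ℝ}
    (hC : 0 ≤ C) (h : ∀ x, ‖g x‖ ≤ C) (f : LTwo n) :
    ∃ f' : LTwo n, (f' : 𝓢'(Euc n, ℂ)) = fourierMultiplierCLM ℂ g (f : 𝓢'(Euc n, ℂ)) ∧
      ‖f'‖ ≤ C * ‖f‖ := by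
  let g' : BoundedContinuousFunction (Euc n) ℂ :=
    BoundedContinuousFunction.ofNormedAddCommGroup g hg.1.continuous C h
  have hm : MemLp g ⊤ (volume : Measure (Euc n)) := g'.memLp_top
  refine ⟨𝓕⁻ ((hm.toLp g) • 𝓕 f : LTwo n), ?_, ?_⟩
  · rw [fourierMultiplierCLM_apply, ← Lp.fourierInv_toTemperedDistribution_eq,
      Lp.toTemperedDistribution_smul_eq hg hm, Lp.fourier_toTemperedDistribution_eq]
  · have h1 : ‖(hm.toLp g : Lp ℂ ⊤ (volume : Measure (Euc n)))‖ ≤ C := by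
      rw [Lp.norm_toLp]
      refine ENNReal.toReal_le_of_le_ofReal hC ?_
      refine eLpNormEssSup_le_of_ae_bound (Filter.Eventually.of_forall h)
    have h2 : ‖(𝓕⁻ ((hm.toLp g) • 𝓕 f : LTwo n) : LTwo n)‖ = ‖((hm.toLp g) • 𝓕 f : LTwo n)‖ := by
      rw [← Lp.norm_fourier_eq, FourierTransform.fourier_fourierInv_eq]
    rw [h2]
    refine (Lp.norm_smul_le _ _).trans ?_
    rw [Lp.norm_fourier_eq]
    exact mul_le_mul_of_nonneg_right h1 (norm_nonneg _)

/-- A Fourier multiplier with symbol of order `t` maps `H^s` to `H^{s-t}`. -/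
theorem SobBound.fourierMultiplier {s t c C : ℝ} {T : 𝓢'(Euc n, ℂ)} (hT : SobBound s T c)
    {g : Euc n → ℂ} (hg : g.HasTemperateGrowth) (hC : 0 ≤ C)
    (h : ∀ x, ‖g x‖ ≤ C * (1 + ‖x‖ ^ 2) ^ (t / 2)) :
    SobBound (s - t) (fourierMultiplierCLM ℂ g T) (C * c) := by
  obtain ⟨f, hf, hc⟩ := hT
  -- The symbol divided by the weight of order `t` is bounded by `C`, hence acts on square
  -- integrable functions; the weight is absorbed in the change of order.
  have hb : (g * besselSymbol n (-t)).HasTemperateGrowth := hg.mul (besselSymbol_hasTemperateGrowth _)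
  obtain ⟨f', hf', hn⟩ := exists_fourierMultiplier_lTwo hb hC (fun x => by
    rw [Pi.mul_apply, norm_mul, norm_besselSymbol]
    refine (mul_le_mul_of_nonneg_right (h x) (by positivity)).trans ?_
    rw [mul_assoc, ← Real.rpow_add (by positivity)]
    simp [neg_div]) f
  refine ⟨f', ?_, hn.trans (mul_le_mul_of_nonneg_left hc hC)⟩
  rw [← besselPotential_eq_iff_sob_eq, hf', ← (besselPotential_eq_iff_sob_eq s T f).2 hf]
  change fourierMultiplierCLM ℂ (besselSymbol n (s - t)) _ =
    fourierMultiplierCLM ℂ _ (fourierMultiplierCLM ℂ (besselSymbol n s) T)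
  rw [fourierMultiplierCLM_fourierMultiplierCLM_apply hg (besselSymbol_hasTemperateGrowth _),
    fourierMultiplierCLM_fourierMultiplierCLM_apply (besselSymbol_hasTemperateGrowth _) hb]
  congr 2
  ext x
  have : besselSymbol n (s - t) x = besselSymbol n s x * besselSymbol n (-t) x := by
    simp only [besselSymbol]
    rw [← Complex.ofReal_mul, ← Real.rpow_add (by positivity)]
    congr 2
    ring
  simp only [Pi.mul_apply, this]
  ring

theorem SobBound.order_mono {s t c : ℝ} {T : 𝓢'(Euc n, ℂ)} (hT : SobBound s T c) (h : t ≤ s) :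
    SobBound t T c := by
  -- The identity is regarded as a multiplier of order `s - t ≥ 0`.
  have := hT.fourierMultiplier (t := s - t) (g := fun _ => 1) (C := 1) (by fun_prop) zero_le_one
    (fun x => by
      rw [one_mul, norm_one]
      exact Real.one_le_rpow (by nlinarith [sq_nonneg ‖x‖]) (by linarith))
  simpa using this

/-- Complex conjugation on `L²`. -/
def conjLTwo : LTwo n →L[ℝ] LTwo n :=
  (Complex.conjCLE : ℂ →L[ℝ] ℂ).compLpL 2 volume

theorem conjLTwo_coeFn (f : LTwo n) : ∀ᵐ x, conjLTwo f x = (starRingEnd ℂ) (f x) :=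
  ContinuousLinearMap.coeFn_compLp (Complex.conjCLE : ℂ →L[ℝ] ℂ) f

theorem norm_conjLTwo (f : LTwo n) : ‖conjLTwo f‖ = ‖f‖ := by
  rw [Lp.norm_def, Lp.norm_def]
  congr 1
  apply eLpNorm_congr_norm_ae
  filter_upwards [conjLTwo_coeFn f] with x hx
  rw [hx, RCLike.norm_conj]

/-- Complex conjugation of Schwartz functions. -/
def conjSchwartz : 𝓢(Euc n, ℂ) →L[ℝ] 𝓢(Euc n, ℂ) :=
  SchwartzMap.postcompCLM (Complex.conjCLE : ℂ →L[ℝ] ℂ)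

theorem conjSchwartz_apply (φ : 𝓢(Euc n, ℂ)) (x : Euc n) :
    conjSchwartz φ x = (starRingEnd ℂ) (φ x) := rfl

theorem fourier_conjSchwartz (φ : 𝓢(Euc n, ℂ)) : 𝓕 (conjSchwartz φ) = conjSchwartz (𝓕⁻ φ) := by
  ext x
  rw [conjSchwartz_apply, SchwartzMap.fourier_coe, SchwartzMap.fourierInv_coe, Real.fourier_eq',
    Real.fourierInv_eq', ← integral_conj]
  congr 1
  ext v
  rw [conjSchwartz_apply, smul_eq_mul, smul_eq_mul, map_mul, ← Complex.exp_conj]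
  simp [Complex.conj_ofNat]

theorem fourierMultiplier_conjSchwartz (s : ℝ) (φ : 𝓢(Euc n, ℂ)) :
    SchwartzMap.fourierMultiplierCLM ℂ (besselSymbol n s) (conjSchwartz φ) =
      conjSchwartz (SchwartzMap.fourierMultiplierCLM ℂ (besselSymbol n s) φ) := by
  have h := besselSymbol_hasTemperateGrowth (n := n) s
  have hs : ∀ ψ : 𝓢(Euc n, ℂ), SchwartzMap.smulLeftCLM ℂ (besselSymbol n s) (conjSchwartz ψ) =
      conjSchwartz (SchwartzMap.smulLeftCLM ℂ (besselSymbol n s) ψ) := by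
    intro ψ
    ext x
    rw [conjSchwartz_apply, SchwartzMap.smulLeftCLM_apply_apply h,
      SchwartzMap.smulLeftCLM_apply_apply h, conjSchwartz_apply, smul_eq_mul, smul_eq_mul, map_mul,
      besselSymbol, Complex.conj_ofReal]
  rw [← fourier_smulLeft_fourierInv h (besselSymbol_neg s) φ, SchwartzMap.fourierMultiplierCLM_apply,
    fourier_conjSchwartz, hs]
  have h3 : ∀ ψ : 𝓢(Euc n, ℂ), 𝓕⁻ (conjSchwartz ψ) = conjSchwartz (𝓕 ψ) := by
    intro ψ
    have := fourier_conjSchwartz (𝓕 ψ)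
    rw [FourierTransform.fourierInv_fourier_eq] at this
    rw [← this, FourierTransform.fourierInv_fourier_eq]
  exact h3 _

theorem bes_coeFn (s : ℝ) (φ : 𝓢(Euc n, ℂ)) :
    ∀ᵐ x, bes s φ x = SchwartzMap.fourierMultiplierCLM ℂ (besselSymbol n s) φ x :=
  (SchwartzMap.fourierMultiplierCLM ℂ (besselSymbol n s) φ).coeFn_toLp 2 volume

theorem bes_conjSchwartz (s : ℝ) (φ : 𝓢(Euc n, ℂ)) :
    bes s (conjSchwartz φ) = conjLTwo (bes s φ) := by
  apply Lp.ext
  filter_upwards [bes_coeFn s φ, bes_coeFn s (conjSchwartz φ), conjLTwo_coeFn (bes s φ)]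
    with x h1 h2 h3
  rw [h2, h3, h1, fourierMultiplier_conjSchwartz, conjSchwartz_apply]

theorem sob_conjLTwo (s : ℝ) (f : LTwo n) (φ : 𝓢(Euc n, ℂ)) :
    sob s (conjLTwo f) φ = (starRingEnd ℂ) (sob s f (conjSchwartz φ)) := by
  rw [sob_apply, sob_apply, ← integral_conj, bes_conjSchwartz]
  apply integral_congr_ae
  filter_upwards [conjLTwo_coeFn (bes (-s) φ), conjLTwo_coeFn f] with x h1 h2
  rw [map_mul, h1, h2, Complex.conj_conj]

/-- The real part of an element of `H^s(ℝⁿ)`. -/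
def reLTwo (f : LTwo n) : LTwo n := (2⁻¹ : ℝ) • (f + conjLTwo f)

theorem norm_reLTwo_le (f : LTwo n) : ‖reLTwo f‖ ≤ ‖f‖ := by
  rw [reLTwo, norm_smul]
  have h := norm_add_le f (conjLTwo f)
  rw [norm_conjLTwo] at h
  rw [Real.norm_of_nonneg (by norm_num)]
  linarith

theorem sob_reLTwo (s : ℝ) (f : LTwo n) (φ : 𝓢(Euc n, ℂ)) (hφ : conjSchwartz φ = φ) :
    sob s (reLTwo f) φ = ((sob s f φ).re : ℂ) := by
  have h1 : reLTwo f = (2⁻¹ : ℂ) • (f + conjLTwo f) := by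
    rw [reLTwo]
    have := RCLike.real_smul_eq_coe_smul (K := ℂ) (2⁻¹ : ℝ) (f + conjLTwo f)
    rw [this]
    norm_num
  rw [h1, map_smul, map_add]
  change (2⁻¹ : ℂ) * (sob s f φ + sob s (conjLTwo f) φ) = _
  rw [sob_conjLTwo, hφ, Complex.add_conj]
  push_cast
  ring

/-- As a real inner product the pairing is visibly continuous in `f`, and Riesz representation
applies to it. -/
theorem re_sob_apply (s : ℝ) (f : LTwo n) (φ : 𝓢(Euc n, ℂ)) :
    (sob s f φ).re = inner ℝ (conjLTwo f) (bes (-s) φ) := by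
  rw [sob_apply, L2.inner_def]
  have hi : Integrable (fun x => bes (-s) φ x * f x) volume := by
    have := L2.integrable_inner (𝕜 := ℂ) (conjLTwo f) (bes (-s) φ)
    refine this.congr ?_
    filter_upwards [conjLTwo_coeFn f] with x h1
    simp [h1]
  have := integral_re hi
  rw [RCLike.re_eq_complex_re] at this
  rw [← this]
  apply integral_congr_ae
  filter_upwards [conjLTwo_coeFn f] with x h1
  rw [h1, real_inner_eq_re_inner ℂ]
  simp

/-- This is the duality of orders `s` and `-s`. Riesz represents the real part of `L`; the imaginary
part follows by testing with `i φ`. -/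
theorem exists_sob_eq_of_le {s C : ℝ} (hC : 0 ≤ C) (L : 𝓢(Euc n, ℂ) →ₗ[ℂ] ℂ)
    (h : ∀ φ, ‖L φ‖ ≤ C * ‖bes (-s) φ‖) : ∃ f : LTwo n, ‖f‖ ≤ C ∧ ∀ φ, sob s f φ = L φ := by
  obtain ⟨g, hg, hgL⟩ := exists_inner_eq_of_le_norm
    (((bes (-s)).toLinearMap.restrictScalars ℝ : 𝓢(Euc n, ℂ) →ₗ[ℝ] LTwo n))
    (Complex.reLm ∘ₗ L.restrictScalars ℝ) C hC
    (fun φ => (Complex.re_le_norm _).trans (h φ))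
  have h1 : ∀ φ, (L φ).re = (sob s (conjLTwo g) φ).re := by
    intro φ
    rw [re_sob_apply]
    have h2 : conjLTwo (conjLTwo g) = g := by
      apply Lp.ext
      filter_upwards [conjLTwo_coeFn g, conjLTwo_coeFn (conjLTwo g)] with x h1 h2
      rw [h2, h1, Complex.conj_conj]
    rw [h2]
    exact hgL φ
  refine ⟨conjLTwo g, by rwa [norm_conjLTwo], fun φ => Complex.ext (h1 φ).symm ?_⟩
  have h2 := h1 (Complex.I • φ)
  rw [map_smul, map_smul] at h2
  simp only [smul_eq_mul, Complex.mul_re, Complex.I_re, Complex.I_im] at h2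
  linarith

end TemperedSobolev

/-! ### Multiplication by Schwartz functions on Sobolev spaces. -/

section Multiplication

open TemperedDistribution FourierTransform

variable {n : ℕ}

theorem one_add_norm_sq_le (ξ ζ : Euc n) :
    1 + ‖ξ‖ ^ 2 ≤ 2 * (1 + ‖ζ‖ ^ 2) * (1 + ‖ξ - ζ‖ ^ 2) := by
  have h : ‖ξ‖ ≤ ‖ζ‖ + ‖ξ - ζ‖ := by
    have := norm_add_le ζ (ξ - ζ)
    rwa [add_sub_cancel] at this
  have h0 := norm_nonneg ξ
  nlinarith [sq_nonneg (‖ζ‖ - ‖ξ - ζ‖), sq_nonneg (‖ζ‖ * ‖ξ - ζ‖), norm_nonneg ζ,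
    norm_nonneg (ξ - ζ)]

/-- Peetre's inequality. -/
theorem peetre (s : ℝ) (ξ ζ : Euc n) :
    (1 + ‖ξ‖ ^ 2) ^ (s / 2) ≤
      2 ^ (|s| / 2) * (1 + ‖ζ‖ ^ 2) ^ (|s| / 2) * (1 + ‖ξ - ζ‖ ^ 2) ^ (s / 2) := by
  have h1 : (0 : ℝ) < 1 + ‖ξ‖ ^ 2 := by positivity
  have h2 : (0 : ℝ) < 1 + ‖ζ‖ ^ 2 := by positivity
  have h3 : (0 : ℝ) < 1 + ‖ξ - ζ‖ ^ 2 := by positivity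
  rcases le_total 0 s with hs | hs
  · rw [abs_of_nonneg hs, ← Real.mul_rpow (by norm_num) h2.le,
      ← Real.mul_rpow (by positivity) h3.le]
    exact Real.rpow_le_rpow h1.le (one_add_norm_sq_le ξ ζ) (by linarith)
  · rw [abs_of_nonpos hs, ← Real.mul_rpow (by norm_num) h2.le]
    have h4 : s / 2 = -(-s / 2) := by ring
    rw [h4, Real.rpow_neg h1.le, Real.rpow_neg h3.le, ← div_eq_mul_inv, inv_eq_one_div,
      div_le_div_iff₀ (by positivity) (by positivity), one_mul,
      ← Real.mul_rpow (by positivity) h1.le]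
    refine Real.rpow_le_rpow h3.le ?_ (by linarith)
    have := one_add_norm_sq_le (ξ - ζ) (-ζ)
    simpa using this

/-- Young's inequality `L¹ * L² ⊆ L²`. -/
theorem lintegral_convolution_sq_le (k h : Euc n → ENNReal) (hk : Measurable k)
    (hh : Measurable h) :
    ∫⁻ ξ, (∫⁻ ζ, k ζ * h (ξ - ζ)) ^ (2 : ℝ) ≤ (∫⁻ ζ, k ζ) ^ (2 : ℝ) * ∫⁻ ξ, h ξ ^ (2 : ℝ) := by
  have hm : Measurable fun p : Euc n × Euc n => h (p.1 - p.2) :=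
    hh.comp (measurable_fst.sub measurable_snd)
  have h1 : ∀ ξ, (∫⁻ ζ, k ζ * h (ξ - ζ)) ^ (2 : ℝ) ≤
      (∫⁻ ζ, k ζ) * ∫⁻ ζ, k ζ * h (ξ - ζ) ^ (2 : ℝ) := by
    intro ξ
    have hξ : Measurable fun ζ => h (ξ - ζ) := hh.comp (measurable_const.sub measurable_id)
    -- Cauchy–Schwarz after splitting `k` into two factors `k ^ (1 / 2)`.
    have := ENNReal.lintegral_mul_le_Lp_mul_Lq (volume : Measure (Euc n))
      (Real.HolderConjugate.two_two) (f := fun ζ => k ζ ^ (1 / 2 : ℝ))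
      (g := fun ζ => k ζ ^ (1 / 2 : ℝ) * h (ξ - ζ)) (hk.pow_const _).aemeasurable
      ((hk.pow_const _).mul hξ).aemeasurable
    have e1 : ∀ ζ, ((fun ζ => k ζ ^ (1 / 2 : ℝ)) * fun ζ => k ζ ^ (1 / 2 : ℝ) * h (ξ - ζ)) ζ =
        k ζ * h (ξ - ζ) := by
      intro ζ
      rw [Pi.mul_apply, ← mul_assoc, ← ENNReal.rpow_add_of_nonneg _ _ (by norm_num) (by norm_num)]
      norm_num
    have e2 : ∀ ζ, (k ζ ^ (1 / 2 : ℝ)) ^ (2 : ℝ) = k ζ := by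
      intro ζ
      rw [← ENNReal.rpow_mul]
      norm_num
    have e3 : ∀ ζ, (k ζ ^ (1 / 2 : ℝ) * h (ξ - ζ)) ^ (2 : ℝ) = k ζ * h (ξ - ζ) ^ (2 : ℝ) := by
      intro ζ
      rw [ENNReal.mul_rpow_of_nonneg _ _ (by norm_num), e2]
    simp only [e1, e2, e3] at this
    calc _ ≤ ((∫⁻ ζ, k ζ) ^ (1 / 2 : ℝ) * (∫⁻ ζ, k ζ * h (ξ - ζ) ^ (2 : ℝ)) ^ (1 / 2 : ℝ)) ^ (2 : ℝ) :=
          ENNReal.rpow_le_rpow this (by norm_num)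
      _ = _ := by
          rw [ENNReal.mul_rpow_of_nonneg _ _ (by norm_num), ← ENNReal.rpow_mul, ← ENNReal.rpow_mul]
          norm_num
  calc _ ≤ ∫⁻ ξ, (∫⁻ ζ, k ζ) * ∫⁻ ζ, k ζ * h (ξ - ζ) ^ (2 : ℝ) := lintegral_mono h1
    _ = (∫⁻ ζ, k ζ) * ∫⁻ ξ, ∫⁻ ζ, k ζ * h (ξ - ζ) ^ (2 : ℝ) := by
        rw [lintegral_const_mul]
        exact Measurable.lintegral_prod_right'
          (f := fun p : Euc n × Euc n => k p.2 * h (p.1 - p.2) ^ (2 : ℝ))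
          ((hk.comp measurable_snd).mul (hm.pow_const _))
    _ = (∫⁻ ζ, k ζ) * ∫⁻ ζ, k ζ * ∫⁻ ξ, h ξ ^ (2 : ℝ) := by
        congr 1
        rw [lintegral_lintegral_swap]
        · congr 1
          ext ζ
          have : Measurable fun ξ => h (ξ - ζ) := hh.comp (measurable_id.sub measurable_const)
          rw [lintegral_const_mul _ (this.pow_const _)]
          congr 1
          exact lintegral_sub_right_eq_self (fun ξ => h ξ ^ (2 : ℝ)) ζ
        · exact ((hk.comp measurable_snd).mul (hm.pow_const _)).aemeasurable
    _ = _ := by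
        rw [lintegral_mul_const _ hk, ← mul_assoc]
        norm_num [sq]

theorem norm_bes (s : ℝ) (φ : 𝓢(Euc n, ℂ)) :
    ‖bes s φ‖ = ‖(SchwartzMap.smulLeftCLM ℂ (besselSymbol n s) (𝓕 φ)).toLp 2 volume‖ := by
  change ‖(SchwartzMap.fourierMultiplierCLM ℂ (besselSymbol n s) φ).toLp 2 volume‖ = _
  rw [← SchwartzMap.norm_fourier_toL2_eq, SchwartzMap.fourierMultiplierCLM_apply,
    FourierTransform.fourier_fourierInv_eq]

theorem fourier_smulLeft_apply (χ φ : 𝓢(Euc n, ℂ)) (ξ : Euc n) :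
    𝓕 (SchwartzMap.smulLeftCLM ℂ χ φ) ξ = ∫ ζ, 𝓕 χ ζ * 𝓕 φ (ξ - ζ) := by
  have h1 : SchwartzMap.convolution (ContinuousLinearMap.mul ℂ ℂ) (𝓕 χ) (𝓕 φ) =
      𝓕 (SchwartzMap.smulLeftCLM ℂ χ φ) := by
    have h0 : SchwartzMap.convolution (ContinuousLinearMap.mul ℂ ℂ) (𝓕 χ) (𝓕 φ) =
        𝓕⁻ (𝓕 (SchwartzMap.convolution (ContinuousLinearMap.mul ℂ ℂ) (𝓕 χ) (𝓕 φ))) :=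
      (FourierTransform.fourierInv_fourier_eq _).symm
    rw [h0, SchwartzMap.fourier_convolution]
    have h2 : ∀ (ψ : 𝓢(Euc n, ℂ)) x, 𝓕 (𝓕 ψ) x = ψ (-x) := by
      intro ψ x
      have := fourierInv_apply_neg (𝓕 ψ) (-x)
      rw [neg_neg, FourierTransform.fourierInv_fourier_eq] at this
      exact this.symm
    have h3 : SchwartzMap.pairing (ContinuousLinearMap.mul ℂ ℂ) (𝓕 (𝓕 χ)) (𝓕 (𝓕 φ)) =
        𝓕 (𝓕 (SchwartzMap.smulLeftCLM ℂ χ φ)) := by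
      ext x
      rw [SchwartzMap.pairing_apply_apply, h2, h2, h2,
        SchwartzMap.smulLeftCLM_apply_apply χ.hasTemperateGrowth]
      rfl
    rw [h3, FourierTransform.fourierInv_fourier_eq]
  rw [← h1, SchwartzMap.convolution_apply]
  rfl

/-- Multiplication by a Schwartz function is bounded on `H^s`, on Schwartz functions. -/
theorem exists_norm_bes_smulLeft_le (s : ℝ) (χ : 𝓢(Euc n, ℂ)) :
    ∃ C : ℝ, 0 ≤ C ∧ ∀ φ, ‖bes s (SchwartzMap.smulLeftCLM ℂ χ φ)‖ ≤ C * ‖bes s φ‖ := by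
  set κ : 𝓢(Euc n, ℂ) := SchwartzMap.smulLeftCLM ℂ (besselSymbol n |s|) (𝓕 χ) with hκ
  set c : ℝ := 2 ^ (|s| / 2)
  have hc : 0 ≤ c := by positivity
  let k : Euc n → ENNReal := fun ζ => ENNReal.ofReal c * ‖κ ζ‖ₑ
  have hkm : Measurable k := (κ.continuous.enorm.measurable).const_mul _
  have hkf : ∫⁻ ζ, k ζ ≠ ⊤ := by
    rw [lintegral_const_mul _ κ.continuous.enorm.measurable]
    exact ENNReal.mul_ne_top ENNReal.ofReal_ne_top (κ.integrable (μ := volume)).2.ne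
  refine ⟨(∫⁻ ζ, k ζ).toReal, ENNReal.toReal_nonneg, fun φ => ?_⟩
  set u := SchwartzMap.smulLeftCLM ℂ (besselSymbol n s) (𝓕 φ) with hu
  set v := SchwartzMap.smulLeftCLM ℂ (besselSymbol n s)
    (𝓕 (SchwartzMap.smulLeftCLM ℂ χ φ)) with hv
  rw [norm_bes, norm_bes, SchwartzMap.norm_toLp, SchwartzMap.norm_toLp, ← ENNReal.toReal_mul]
  refine ENNReal.toReal_mono (ENNReal.mul_ne_top hkf (u.memLp 2 volume).2.ne) ?_
  have hsq : ∀ f : 𝓢(Euc n, ℂ), eLpNorm f 2 volume ^ (2 : ℝ) = ∫⁻ x, ‖f x‖ₑ ^ (2 : ℝ) := by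
    intro f
    have := eLpNorm_nnreal_pow_eq_lintegral (f := (f : Euc n → ℂ)) (μ := volume) (p := 2) (by norm_num)
    simpa using this
  -- Multiplication is a convolution on the Fourier side. Peetre's inequality distributes the weight
  -- at `ξ` over both factors, the cost `(1 + ‖ζ‖ ^ 2) ^ (|s| / 2)` being absorbed by the rapidly
  -- decreasing transform of `χ`.
  have hpt : ∀ ξ, ‖v ξ‖ₑ ≤ ∫⁻ ζ, k ζ * ‖u (ξ - ζ)‖ₑ := by
    intro ξ
    rw [hv, SchwartzMap.smulLeftCLM_apply_apply (besselSymbol_hasTemperateGrowth s),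
      fourier_smulLeft_apply, smul_eq_mul, ← integral_const_mul]
    refine (enorm_integral_le_lintegral_enorm _).trans (lintegral_mono fun ζ => ?_)
    simp only [k, hκ, hu]
    rw [SchwartzMap.smulLeftCLM_apply_apply (besselSymbol_hasTemperateGrowth _),
      SchwartzMap.smulLeftCLM_apply_apply (besselSymbol_hasTemperateGrowth _), smul_eq_mul,
      smul_eq_mul, ← ofReal_norm, ← ofReal_norm, ← ofReal_norm,
      ← ENNReal.ofReal_mul hc, ← ENNReal.ofReal_mul (by positivity)]
    refine ENNReal.ofReal_le_ofReal ?_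
    simp only [norm_mul, norm_besselSymbol]
    have hp := peetre s ξ ζ
    have := mul_le_mul_of_nonneg_right hp
      (mul_nonneg (norm_nonneg (𝓕 χ ζ)) (norm_nonneg (𝓕 φ (ξ - ζ))))
    refine this.trans (le_of_eq ?_)
    ring
  rw [← ENNReal.rpow_le_rpow_iff (z := 2) (by norm_num), ENNReal.mul_rpow_of_nonneg _ _ (by norm_num),
    hsq, hsq]
  calc _ ≤ ∫⁻ ξ, (∫⁻ ζ, k ζ * ‖u (ξ - ζ)‖ₑ) ^ (2 : ℝ) :=
        lintegral_mono fun ξ => ENNReal.rpow_le_rpow (hpt ξ) (by norm_num)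
    _ ≤ _ := lintegral_convolution_sq_le k (fun x => ‖u x‖ₑ) hkm u.continuous.enorm.measurable

/-- Multiplication by a Schwartz function is bounded on `H^s`. -/
theorem exists_sobBound_smulLeft (s : ℝ) (χ : 𝓢(Euc n, ℂ)) :
    ∃ C : ℝ, 0 ≤ C ∧ ∀ T c, SobBound s T c → SobBound s (smulLeftCLM ℂ χ T) (C * c) := by
  obtain ⟨C, hC, h⟩ := exists_norm_bes_smulLeft_le (-s) χ
  refine ⟨C, hC, fun T c hT => ?_⟩
  obtain ⟨f, rfl, hf⟩ := hT
  -- The estimate on Schwartz functions in order `-s` is transposed to distributions of order `s`.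
  obtain ⟨g, hg, hgL⟩ := exists_sob_eq_of_le (s := s) (mul_nonneg hC (norm_nonneg f))
    (smulLeftCLM ℂ χ (sob s f)).toLinearMap (fun φ => by
      change ‖sob s f (SchwartzMap.smulLeftCLM ℂ χ φ)‖ ≤ _
      have h1 : ∀ ψ, ‖sob s f ψ‖ ≤ ‖f‖ * ‖bes (-s) ψ‖ := by
        intro ψ
        have h2 : sob s f ψ = inner ℂ (conjLTwo f) (bes (-s) ψ) := by
          rw [sob_apply, L2.inner_def]
          apply integral_congr_ae
          filter_upwards [conjLTwo_coeFn f] with x h1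
          simp [h1]
        rw [h2]
        refine (norm_inner_le_norm _ _).trans ?_
        rw [norm_conjLTwo]
      refine (h1 _).trans ?_
      have := mul_le_mul_of_nonneg_left (h φ) (norm_nonneg f)
      refine this.trans (le_of_eq (by ring)))
  refine ⟨g, ?_, hg.trans (mul_le_mul_of_nonneg_left hf hC)⟩
  ext φ
  exact hgL φ

end Multiplication

/-! ### Mollification by bump functions with arbitrary centre. -/

section Mollifier

open TemperedDistribution FourierTransform

variable {n : ℕ}

/-- The potential is invertible on Schwartz functions, so their density in every order reduces to
their density among square integrable functions. -/
theorem exists_norm_sub_bes_lt (s : ℝ) (f : LTwo n) {ε : ℝ} (hε : 0 < ε) :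
    ∃ φ : 𝓢(Euc n, ℂ), ‖f - bes s φ‖ < ε := by
  have hd := SchwartzMap.denseRange_toLpCLM (E := Euc n) (F := ℂ) (μ := volume) (p := 2)
    (by norm_num)
  obtain ⟨ψ, hψ⟩ := Metric.denseRange_iff.1 hd f ε hε
  refine ⟨SchwartzMap.fourierMultiplierCLM ℂ (besselSymbol n (-s)) ψ, ?_⟩
  have h1 : bes s (SchwartzMap.fourierMultiplierCLM ℂ (besselSymbol n (-s)) ψ) =
      ψ.toLp 2 volume := by
    change SchwartzMap.toLp (SchwartzMap.fourierMultiplierCLM ℂ (besselSymbol n s)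
      (SchwartzMap.fourierMultiplierCLM ℂ (besselSymbol n (-s)) ψ)) 2 volume = _
    rw [SchwartzMap.fourierMultiplierCLM_fourierMultiplierCLM_apply
      (besselSymbol_hasTemperateGrowth _) (besselSymbol_hasTemperateGrowth _)]
    have h2 : besselSymbol n s * besselSymbol n (-s) = fun _ => 1 := by
      ext x
      rw [Pi.mul_apply, besselSymbol, besselSymbol, ← Complex.ofReal_mul,
        ← Real.rpow_add (by positivity)]
      simp [neg_div]
    rw [h2]
    simp
  rw [h1, ← dist_eq_norm]
  exact hψ

/-- The normed bump function as a Schwartz function. -/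
def bumpSchwartz {c : Euc n} (κ : ContDiffBump c) : 𝓢(Euc n, ℂ) :=
  HasCompactSupport.toSchwartzMap (f := fun x => (κ.normed volume x : ℂ))
    (κ.hasCompactSupport_normed.comp_left (g := fun t : ℝ => (t : ℂ)) Complex.ofReal_zero)
    (Complex.ofRealCLM.contDiff.comp κ.contDiff_normed)

theorem bumpSchwartz_apply {c : Euc n} (κ : ContDiffBump c) (x : Euc n) :
    bumpSchwartz κ x = (κ.normed volume x : ℂ) := rfl

/-- The Fourier transform of the normed bump function. -/
def bumpSymbol {c : Euc n} (κ : ContDiffBump c) : 𝓢(Euc n, ℂ) := 𝓕 (bumpSchwartz κ)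

/-- Convolution of a tempered distribution with a normed bump function. -/
def mol {c : Euc n} (κ : ContDiffBump c) : 𝓢'(Euc n, ℂ) →L[ℂ] 𝓢'(Euc n, ℂ) :=
  fourierMultiplierCLM ℂ (bumpSymbol κ)

/-- The transpose of `mol`. -/
def molT {c : Euc n} (κ : ContDiffBump c) (φ : 𝓢(Euc n, ℂ)) : 𝓢(Euc n, ℂ) :=
  𝓕 (SchwartzMap.smulLeftCLM ℂ (bumpSymbol κ) (𝓕⁻ φ))

theorem mol_apply {c : Euc n} (κ : ContDiffBump c) (T : 𝓢'(Euc n, ℂ)) (φ : 𝓢(Euc n, ℂ)) :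
    mol κ T φ = T (molT κ φ) := rfl

/-- The sign in `x + v` fixes the direction: `mol κ` moves supports by vectors near the centre `c`,
and `molT κ` moves them by the opposite vectors. -/
theorem molT_apply {c : Euc n} (κ : ContDiffBump c) (φ : 𝓢(Euc n, ℂ)) (x : Euc n) :
    molT κ φ x = ∫ v, (κ.normed volume v : ℂ) * φ (x + v) := by
  let N := SchwartzMap.compCLMOfContinuousLinearEquiv ℂ (D := Euc n) (E := Euc n) (F := ℂ)
    (LinearIsometryEquiv.neg ℝ (E := Euc n))
  have hN : ∀ (ψ : 𝓢(Euc n, ℂ)) x, N ψ x = ψ (-x) := fun ψ x => rfl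
  have h1 : 𝓕⁻ φ = 𝓕 (N φ) := by
    have h2 : 𝓕⁻ (𝓕 (N φ)) = N φ := FourierTransform.fourierInv_fourier_eq _
    have h3 : 𝓕 (𝓕 (N φ)) = φ := by
      ext y
      have h4 := fourierInv_apply_neg (𝓕 (N φ)) (-y)
      rw [neg_neg, h2, hN, neg_neg] at h4
      exact h4.symm
    calc 𝓕⁻ φ = 𝓕⁻ (𝓕 (𝓕 (N φ))) := by rw [h3]
      _ = _ := FourierTransform.fourierInv_fourier_eq _
  have h2 : molT κ φ x = SchwartzMap.convolution (ContinuousLinearMap.mul ℂ ℂ)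
      (bumpSchwartz κ) (N φ) (-x) := by
    have h0 : SchwartzMap.convolution (ContinuousLinearMap.mul ℂ ℂ) (bumpSchwartz κ) (N φ) =
        𝓕⁻ (𝓕 (SchwartzMap.convolution (ContinuousLinearMap.mul ℂ ℂ) (bumpSchwartz κ) (N φ))) :=
      (FourierTransform.fourierInv_fourier_eq _).symm
    rw [h0, SchwartzMap.fourier_convolution, fourierInv_apply_neg, neg_neg, molT, h1, bumpSymbol]
    congr 2
    ext y
    rw [SchwartzMap.pairing_apply_apply, SchwartzMap.smulLeftCLM_apply_apply
      (SchwartzMap.hasTemperateGrowth _)]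
    rfl
  rw [h2, SchwartzMap.convolution_apply]
  change ∫ v, bumpSchwartz κ v * N φ (-x - v) = _
  congr 1
  ext v
  rw [hN, bumpSchwartz_apply]
  congr 2
  abel

theorem norm_fourier_bumpSchwartz_le {c : Euc n} (κ : ContDiffBump c) (ξ : Euc n) :
    ‖bumpSymbol κ ξ‖ ≤ 1 := by
  rw [bumpSymbol, SchwartzMap.fourier_coe]
  refine (VectorFourier.norm_fourierIntegral_le_integral_norm _ _ _ _ ξ).trans ?_
  rw [← κ.integral_normed (μ := volume)]
  apply le_of_eq
  congr 1
  ext v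
  rw [bumpSchwartz_apply, Complex.norm_real, Real.norm_of_nonneg (κ.nonneg_normed v)]

/-- The bound `|exp (i θ) - 1| ≤ |θ|` is integrated over the support of the bump, where `‖v‖ ≤ ‖c‖ +
κ.rOut`. The centre enters the bound because the mollifiers are also translations. -/
theorem norm_fourier_bumpSchwartz_sub_one_le {c : Euc n} (κ : ContDiffBump c) (ξ : Euc n) :
    ‖bumpSymbol κ ξ - 1‖ ≤ 2 * Real.pi * (‖c‖ + κ.rOut) * ‖ξ‖ := by
  have h1 : (1 : ℂ) = ∫ v, bumpSchwartz κ v := by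
    have := κ.integral_normed (μ := (volume : Measure (Euc n)))
    simp only [bumpSchwartz_apply]
    rw [integral_complex_ofReal, this, Complex.ofReal_one]
  have hi : Integrable (bumpSchwartz κ) volume := (bumpSchwartz κ).integrable
  have hin : Integrable (fun v => κ.normed volume v) (volume : Measure (Euc n)) := κ.integrable_normed
  rw [bumpSymbol, SchwartzMap.fourier_coe, Real.fourier_eq', h1, ← integral_sub _ hi]
  · have hle : ∀ v, ‖Complex.exp (↑(-2 * Real.pi * inner ℝ v ξ) * Complex.I) • bumpSchwartz κ v -
        bumpSchwartz κ v‖ ≤ 2 * Real.pi * (‖c‖ + κ.rOut) * ‖ξ‖ * κ.normed volume v := by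
      intro v
      have h2 : Complex.exp (↑(-2 * Real.pi * inner ℝ v ξ) * Complex.I) • bumpSchwartz κ v -
        bumpSchwartz κ v =
          (Complex.exp (Complex.I * ↑(-2 * Real.pi * inner ℝ v ξ)) - 1) * bumpSchwartz κ v := by
        rw [smul_eq_mul, mul_comm Complex.I]; ring
      rw [h2, norm_mul, bumpSchwartz_apply, Complex.norm_real,
        Real.norm_of_nonneg (κ.nonneg_normed v)]
      by_cases hv : κ.normed volume v = 0
      · rw [hv]; simp
      · refine mul_le_mul_of_nonneg_right ?_ (κ.nonneg_normed v)
        refine (Real.norm_exp_I_mul_ofReal_sub_one_le).trans ?_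
        have hvb : v ∈ Metric.ball c κ.rOut := by
          have : v ∈ Function.support (κ.normed volume) := hv
          rwa [κ.support_normed_eq] at this
        have hvn : ‖v‖ ≤ ‖c‖ + κ.rOut := by
          have h3 : ‖v - c‖ < κ.rOut := by rwa [← dist_eq_norm]
          have h4 := norm_add_le c (v - c)
          rw [add_sub_cancel] at h4
          linarith
        rw [norm_mul, norm_mul, norm_neg, Real.norm_of_nonneg Real.pi_pos.le,
          Real.norm_of_nonneg (by norm_num : (0 : ℝ) ≤ 2), mul_assoc _ _ ‖ξ‖]
        refine mul_le_mul_of_nonneg_left ((norm_inner_le_norm v ξ).trans ?_) (by positivity)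
        exact mul_le_mul_of_nonneg_right hvn (norm_nonneg _)
    refine (norm_integral_le_of_norm_le (hin.const_mul _) (Filter.Eventually.of_forall hle)).trans ?_
    rw [integral_const_mul, κ.integral_normed, mul_one]
  · have := (Real.fourierIntegral_convergent_iff (V := Euc n) (μ := volume) ξ).2 hi
    refine this.congr (Filter.Eventually.of_forall fun v => ?_)
    simp only [Circle.smul_def, Real.fourierChar_apply]
    congr 3
    push_cast
    ring

theorem mol_hasTemperateGrowth {c : Euc n} (κ : ContDiffBump c) :
    Function.HasTemperateGrowth (bumpSymbol κ) :=
  SchwartzMap.hasTemperateGrowth _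

theorem SobBound.mol {s a : ℝ} {T : 𝓢'(Euc n, ℂ)} (h : SobBound s T a) {c : Euc n}
    (κ : ContDiffBump c) : SobBound s (mol κ T) a := by
  have := h.fourierMultiplier (t := 0) (C := 1) (mol_hasTemperateGrowth κ) zero_le_one
    (fun x => by simpa using norm_fourier_bumpSchwartz_le κ x)
  rwa [sub_zero, one_mul] at this

theorem SobBound.mol_sub {s a : ℝ} {T : 𝓢'(Euc n, ℂ)} (h : SobBound (s + 1) T a) {c : Euc n}
    (κ : ContDiffBump c) :
    SobBound s (SobolevComplex.mol κ T - T) (2 * Real.pi * (‖c‖ + κ.rOut) * a) := by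
  have hg : Function.HasTemperateGrowth
      ((bumpSymbol κ : Euc n → ℂ) - fun _ => (1 : ℂ)) :=
    (mol_hasTemperateGrowth κ).sub (by fun_prop)
  have := h.fourierMultiplier (t := 1) (C := 2 * Real.pi * (‖c‖ + κ.rOut)) hg
    (mul_nonneg (by positivity) (add_nonneg (norm_nonneg _) κ.rOut_pos.le))
    (fun x => by
      refine (norm_fourier_bumpSchwartz_sub_one_le κ x).trans ?_
      refine mul_le_mul_of_nonneg_left ?_
        (mul_nonneg (by positivity) (add_nonneg (norm_nonneg _) κ.rOut_pos.le))
      rw [← Real.sqrt_eq_rpow]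
      exact Real.le_sqrt_of_sq_le (by linarith))
  rw [add_sub_cancel_right] at this
  convert this using 1
  rw [fourierMultiplierCLM_apply, smulLeftCLM_sub (mol_hasTemperateGrowth κ) (by fun_prop)]
  ext φ
  simp [SobolevComplex.mol, fourierMultiplierCLM_apply]

theorem memSobolev_mol {s : ℝ} (t : ℝ) {T : 𝓢'(Euc n, ℂ)} (h : MemSobolev s 2 T) {c : Euc n}
    (κ : ContDiffBump c) : MemSobolev t 2 (mol κ T) := by
  obtain ⟨f, rfl⟩ := memSobolev_iff_exists_sob.1 h
  -- The symbol of the mollifier is a Schwartz function, so it remains bounded after multiplication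
  -- by any weight.
  set ψ : 𝓢(Euc n, ℂ) := SchwartzMap.smulLeftCLM ℂ (besselSymbol n (t - s)) (bumpSymbol κ)
    with hψ
  have hb : SobBound s (sob s f) ‖f‖ := ⟨f, rfl, le_rfl⟩
  have := hb.fourierMultiplier (t := s - t) (C := SchwartzMap.seminorm ℝ 0 0 ψ)
    (mol_hasTemperateGrowth κ) (apply_nonneg _ _)
    (fun x => by
      have h1 := SchwartzMap.norm_le_seminorm ℝ ψ x
      rw [hψ, SchwartzMap.smulLeftCLM_apply_apply (besselSymbol_hasTemperateGrowth _), smul_eq_mul,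
        norm_mul, norm_besselSymbol] at h1
      have h2 := mul_le_mul_of_nonneg_right h1
        (by positivity : 0 ≤ (1 + ‖x‖ ^ 2) ^ ((s - t) / 2))
      refine le_trans (le_of_eq ?_) h2
      rw [mul_right_comm, ← Real.rpow_add (by positivity)]
      have : (t - s) / 2 + (s - t) / 2 = 0 := by ring
      rw [this, Real.rpow_zero, one_mul])
  rw [sub_sub_cancel] at this
  exact this.memSobolev

/-- Mollifications are contractions, and on a Schwartz function they converge at the rate `‖c‖ +
κ.rOut`, at the cost of one derivative. Density concludes, uniformly over all bumps near the origin.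
-/
theorem exists_sobBound_mol_sub {s : ℝ} {T : 𝓢'(Euc n, ℂ)} (h : MemSobolev s 2 T) {δ : ℝ}
    (hδ : 0 < δ) : ∃ δ' > 0, ∀ (c : Euc n) (κ : ContDiffBump c), ‖c‖ + κ.rOut < δ' →
      SobBound s (mol κ T - T) δ := by
  obtain ⟨f, rfl⟩ := memSobolev_iff_exists_sob.1 h
  obtain ⟨φ, hφ⟩ := exists_norm_sub_bes_lt s f (ε := δ / 4) (by positivity)
  set a := ‖bes (s + 1) φ‖
  have ha : 0 ≤ a := norm_nonneg _
  -- The Schwartz part may contribute `δ / 2`; the remainder of norm `δ / 4` counts twice. The `+ 1`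
  -- avoids a division by zero.
  refine ⟨δ / (2 * (2 * Real.pi * (a + 1))), by positivity, fun c κ hκ => ?_⟩
  have h1 : SobBound (s + 1) (φ : 𝓢'(Euc n, ℂ)) a := ⟨_, sob_bes (s + 1) φ, le_rfl⟩
  have h2 := h1.mol_sub κ
  have h3 : SobBound s (sob s f - (φ : 𝓢'(Euc n, ℂ))) (δ / 4) :=
    ⟨f - bes s φ, by rw [map_sub, sob_bes], hφ.le⟩
  have h4 := ((h3.mol κ).sub h3).add h2
  have h5 : mol κ (sob s f - (φ : 𝓢'(Euc n, ℂ))) - (sob s f - (φ : 𝓢'(Euc n, ℂ))) +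
      (mol κ (φ : 𝓢'(Euc n, ℂ)) - (φ : 𝓢'(Euc n, ℂ))) = mol κ (sob s f) - sob s f := by
    rw [map_sub]; abel
  rw [h5] at h4
  refine h4.mono ?_
  have h6 : 2 * Real.pi * (‖c‖ + κ.rOut) * a ≤ δ / 2 := by
    rw [lt_div_iff₀ (by positivity)] at hκ
    have h7 : 0 ≤ ‖c‖ + κ.rOut := add_nonneg (norm_nonneg _) κ.rOut_pos.le
    nlinarith [mul_nonneg Real.pi_pos.le h7]
  linarith

theorem mol_lineDerivOp {c : Euc n} (κ : ContDiffBump c) (m : Euc n) (T : 𝓢'(Euc n, ℂ)) :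
    mol κ (∂_{m} T) = ∂_{m} (mol κ T) := by
  have h1 : (fun x : Euc n => ((inner ℝ x m : ℝ) : ℂ)).HasTemperateGrowth := by fun_prop
  rw [lineDeriv_eq_fourierMultiplierCLM, lineDeriv_eq_fourierMultiplierCLM, map_smul, mol,
    fourierMultiplierCLM_fourierMultiplierCLM_apply h1 (mol_hasTemperateGrowth κ),
    fourierMultiplierCLM_fourierMultiplierCLM_apply (mol_hasTemperateGrowth κ) h1,
    mul_comm (bumpSymbol κ : Euc n → ℂ)]

end Mollifier

/-! ### Restriction to open sets and the quotient norm. -/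

section Restriction

open TemperedDistribution

variable {n : ℕ}

theorem toSchwartz_add {U : Opens (Euc n)} (φ ψ : 𝓓(U, ℝ)) :
    toSchwartz (φ + ψ) = toSchwartz φ + toSchwartz ψ := by
  ext x
  simp [toSchwartz_apply]

theorem toSchwartz_smul {U : Opens (Euc n)} (c : ℝ) (φ : 𝓓(U, ℝ)) :
    toSchwartz (c • φ) = c • toSchwartz φ := by
  ext x
  simp [toSchwartz_apply]

/-- `toSchwartz` as a continuous linear map. -/
def toSchwartzCLM (U : Opens (Euc n)) : 𝓓(U, ℝ) →L[ℝ] 𝓢(Euc n, ℂ) :=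
  TestFunction.mkCLM ℝ toSchwartz toSchwartz_add toSchwartz_smul (by
    intro K hK
    let L : 𝓓_{K}(Euc n, ℝ) →ₗ[ℝ] 𝓢(Euc n, ℂ) :=
      { toFun := fun f => toSchwartz (TestFunction.ofSupportedIn hK f)
        map_add' := fun f g => by ext x; simp [toSchwartz_apply]
        map_smul' := fun c f => by
          ext x
          change ((c * f x : ℝ) : ℂ) = c • (f x : ℂ)
          simp }
    change Continuous L
    refine WithSeminorms.continuous_of_isBounded
      (ContDiffMapSupportedIn.withSeminorms ℝ (Euc n) ℝ ⊤ K) (schwartz_withSeminorms ℝ (Euc n) ℂ) L ?_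
    rintro ⟨k, l⟩
    obtain ⟨R, hR0, hR⟩ := K.isCompact.isBounded.exists_pos_norm_le
    refine ⟨{l}, ⟨R ^ k, pow_nonneg hR0.le k⟩, fun f => ?_⟩
    refine SchwartzMap.seminorm_le_bound ℝ k l _ (apply_nonneg _ _) fun x => ?_
    have h1 : iteratedFDeriv ℝ l (L f) x = iteratedFDeriv ℝ l (Complex.ofRealLI ∘ f) x := rfl
    rw [h1, LinearIsometry.norm_iteratedFDeriv_comp_left _ f.contDiff.contDiffAt
      (by exact_mod_cast (le_top : (l : ℕ∞) ≤ ⊤))]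
    simp only [Finset.sup_singleton]
    have h2 := ContDiffMapSupportedIn.norm_iteratedFDeriv_apply_le_seminorm_top ℝ (f := f) (x := x) (i := l)
    by_cases hx : x ∈ (K : Set (Euc n))
    · exact mul_le_mul (pow_le_pow_left₀ (norm_nonneg _) (hR x hx) k) h2 (norm_nonneg _)
        (pow_nonneg hR0.le k)
    · have h3 : iteratedFDeriv ℝ l f x = 0 := f.iteratedFDeriv_zero_on_compl hx
      rw [h3, norm_zero, mul_zero]
      positivity)

theorem conjSchwartz_toSchwartz {U : Opens (Euc n)} (φ : 𝓓(U, ℝ)) :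
    conjSchwartz (toSchwartz φ) = toSchwartz φ := by
  ext x
  rw [conjSchwartz_apply, toSchwartz_apply, Complex.conj_ofReal]

/-- The real part of the restriction of a tempered distribution to `U`. -/
def restr (U : Opens (Euc n)) : 𝓢'(Euc n, ℂ) →ₗ[ℝ] 𝓓'(U, ℝ) where
  toFun T := ContinuousLinearMap.toUniformConvergenceCLM _ _ _
    { toFun := fun φ => (T (toSchwartz φ)).re
      map_add' := fun φ ψ => by rw [toSchwartz_add, map_add, Complex.add_re]
      map_smul' := fun c φ => by
        have h : toSchwartz (c • φ) = (c : ℂ) • toSchwartz φ := by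
          ext x
          simp [toSchwartz_apply]
        rw [h, map_smul]
        simp
      cont := Complex.continuous_re.comp (T.continuous.comp (toSchwartzCLM U).continuous) }
  map_add' S T := by ext φ; exact Complex.add_re _ _
  map_smul' c T := by
    ext φ
    change (c • T (toSchwartz φ)).re = c • (T (toSchwartz φ)).re
    simp

theorem restr_apply (U : Opens (Euc n)) (T : 𝓢'(Euc n, ℂ)) (φ : 𝓓(U, ℝ)) :
    restr U T φ = (T (toSchwartz φ)).re := rfl

theorem Extends.restr_eq {U : Opens (Euc n)} {T : 𝓢'(Euc n, ℂ)} {u : 𝓓'(U, ℝ)}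
    (h : Extends T u) : restr U T = u := by
  ext φ
  rw [restr_apply, h φ, Complex.ofReal_re]

theorem extends_sob_reLTwo {U : Opens (Euc n)} (s : ℝ) (f : LTwo n) :
    Extends (sob s (reLTwo f)) (restr U (sob s f)) := fun φ => by
  rw [sob_reLTwo s f _ (conjSchwartz_toSchwartz φ), restr_apply]

/-- Extensions of a real distribution need not be real outside `U`, and `restr` accepts even those
that are not real on `U`: passing to the real part of a complex extension does not increase the
norm. -/
theorem mem_scalarSobolev_iff {U : Opens (Euc n)} {s : ℝ} {u : 𝓓'(U, ℝ)} :
    u ∈ scalarSobolev U s ↔ ∃ f : LTwo n, restr U (sob s f) = u := by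
  constructor
  · rintro ⟨T, hT, hu⟩
    obtain ⟨f, rfl⟩ := memSobolev_iff_exists_sob.1 hT
    exact ⟨f, hu.restr_eq⟩
  · rintro ⟨f, rfl⟩
    exact ⟨_, memSobolev_iff_exists_sob.2 ⟨_, rfl⟩, extends_sob_reLTwo s f⟩

theorem bddBelow_scalarSobolevNorm (U : Opens (Euc n)) (s : ℝ) (u : 𝓓'(U, ℝ)) :
    BddBelow {r : ℝ | ∃ (T : 𝓢'(Euc n, ℂ)) (f : Lp ℂ 2 (volume : Measure (Euc n))),
    TemperedDistribution.besselPotential (Euc n) ℂ s T = (f : 𝓢'(Euc n, ℂ)) ∧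
      Extends T u ∧ r = ‖f‖} := by
  refine ⟨0, ?_⟩
  rintro r ⟨T, f, -, -, rfl⟩
  exact norm_nonneg f

theorem scalarSobolevNorm_nonneg (U : Opens (Euc n)) (s : ℝ) (u : 𝓓'(U, ℝ)) :
    0 ≤ scalarSobolevNorm U s u := by
  apply Real.sInf_nonneg
  rintro r ⟨T, f, -, -, rfl⟩
  exact norm_nonneg f

theorem scalarSobolevNorm_restr_le (U : Opens (Euc n)) (s : ℝ) (f : LTwo n) :
    scalarSobolevNorm U s (restr U (sob s f)) ≤ ‖f‖ :=
  (csInf_le (bddBelow_scalarSobolevNorm U s _)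
    ⟨_, reLTwo f, (besselPotential_eq_iff_sob_eq s _ _).2 rfl, extends_sob_reLTwo s f, rfl⟩).trans
    (norm_reLTwo_le f)

theorem continuous_restr_sob_apply (U : Opens (Euc n)) (s : ℝ) (φ : 𝓓(U, ℝ)) :
    Continuous fun f : LTwo n => restr U (sob s f) φ := by
  simp only [restr_apply, re_sob_apply]
  fun_prop

/-- The extensions of `u` form a closed convex set in a Hilbert space, so the infimum in the
quotient norm is attained. With a minimiser at hand, the properties of the norm are inherited from
the space of parameters. -/
theorem exists_norm_eq_scalarSobolevNorm {U : Opens (Euc n)} {s : ℝ} {u : 𝓓'(U, ℝ)}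
    (hu : u ∈ scalarSobolev U s) :
    ∃ f : LTwo n, restr U (sob s f) = u ∧ ‖f‖ = scalarSobolevNorm U s u := by
  let A : Set (LTwo n) := {f | restr U (sob s f) = u}
  have hA : IsClosed A := by
    have : A = ⋂ φ : 𝓓(U, ℝ), {f | restr U (sob s f) φ = u φ} := by
      ext f
      simp only [A, Set.mem_ofPred_eq, Set.mem_iInter]
      exact ⟨fun h φ => by rw [h], fun h => by ext φ; exact h φ⟩
    rw [this]
    exact isClosed_iInter fun φ => isClosed_eq (continuous_restr_sob_apply U s φ) continuous_const
  have hlin : ∀ (a b : ℝ) (f g : LTwo n), restr U (sob s (a • f + b • g)) =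
      a • restr U (sob s f) + b • restr U (sob s g) := by
    intro a b f g
    have h1 := map_add (restr U ∘ₗ (sob (n := n) s).toLinearMap.restrictScalars ℝ) (a • f) (b • g)
    rw [map_smul, map_smul] at h1
    exact h1
  have hc : Convex ℝ A := by
    intro f hf g hg a b ha hb hab
    change restr U (sob s f) = u at hf
    change restr U (sob s g) = u at hg
    change restr U (sob s (a • f + b • g)) = u
    rw [hlin, hf, hg, ← add_smul, hab, one_smul]
  obtain ⟨f, hf, hmin⟩ := exists_norm_eq_iInf_of_complete_convex (mem_scalarSobolev_iff.1 hu)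
    hA.isComplete hc 0
  refine ⟨f, hf, le_antisymm ?_ ?_⟩
  · apply le_csInf
    · exact ⟨_, _, reLTwo f, (besselPotential_eq_iff_sob_eq s _ _).2 rfl,
        by simpa only [show restr U (sob s f) = u from hf] using extends_sob_reLTwo (U := U) s f, rfl⟩
    · rintro r ⟨T, g, hg, hT, rfl⟩
      rw [besselPotential_eq_iff_sob_eq] at hg
      have hgA : g ∈ A := by
        change restr U (sob s g) = u
        rw [hg, hT.restr_eq]
      have := ciInf_le (f := fun w : A => ‖(0 : LTwo n) - w‖)
        ⟨0, by rintro _ ⟨w, rfl⟩; exact norm_nonneg _⟩ ⟨g, hgA⟩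
      have h2 : ‖(0 : LTwo n) - f‖ ≤ ‖(0 : LTwo n) - g‖ := hmin.trans_le this
      simpa using h2
  · have := scalarSobolevNorm_restr_le U s f
    rwa [show restr U (sob s f) = u from hf] at this

end Restriction

/-! ### Vector-valued Sobolev spaces in an orthonormal basis. -/

section Vector

open TemperedDistribution

variable {n : ℕ} (X : Type*) [NormedAddCommGroup X] [InnerProductSpace ℝ X]
  [FiniteDimensional ℝ X]

/-- The index set of an orthonormal basis of `X`. -/
abbrev Idx : Type := Fin (Module.finrank ℝ X)

variable {X}

/-- The `X`-valued distribution with given components. -/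
def vec {U : Opens (Euc n)} : (Idx X → 𝓓'(U, ℝ)) →ₗ[ℝ] 𝓓'(U, X) :=
  LinearMap.lsum ℝ (fun _ => 𝓓'(U, ℝ)) ℝ fun i =>
    (Distribution.mapCLM
      (ContinuousLinearMap.toSpanSingleton ℝ (stdOrthonormalBasis ℝ X i))).toLinearMap

theorem vec_apply {U : Opens (Euc n)} (u : Idx X → 𝓓'(U, ℝ)) (φ : 𝓓(U, ℝ)) :
    vec u φ = ∑ i, u i φ • stdOrthonormalBasis ℝ X i := by
  simp only [vec, LinearMap.lsum_apply, LinearMap.sum_apply, LinearMap.comp_apply,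
    LinearMap.proj_apply]
  rw [sum_apply]
  rfl

theorem component_apply {U : Opens (Euc n)} (x : X) (u : 𝓓'(U, X)) (φ : 𝓓(U, ℝ)) :
    component x u φ = inner ℝ x (u φ) := rfl

theorem component_vec {U : Opens (Euc n)} (u : Idx X → 𝓓'(U, ℝ)) (i : Idx X) :
    component (stdOrthonormalBasis ℝ X i) (vec u) = u i := by
  ext φ
  rw [component_apply, vec_apply, inner_sum]
  simp [inner_smul_right, orthonormal_iff_ite.1 (stdOrthonormalBasis ℝ X).orthonormal]

theorem vec_component {U : Opens (Euc n)} (u : 𝓓'(U, X)) :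
    vec (fun i => component (stdOrthonormalBasis ℝ X i) u) = u := by
  ext φ
  rw [vec_apply]
  exact (stdOrthonormalBasis ℝ X).sum_repr' (u φ)

theorem mem_sobolev_iff {U : Opens (Euc n)} {s : ℝ} {u : 𝓓'(U, X)} :
    u ∈ sobolev X U s ↔ ∀ i, component (stdOrthonormalBasis ℝ X i) u ∈ scalarSobolev U s := by
  simp only [sobolev, Submodule.mem_iInf, Submodule.mem_comap]
  refine ⟨fun h i => h _, fun h x => ?_⟩
  have : component x u = ∑ i, inner ℝ (stdOrthonormalBasis ℝ X i) x •
      component (stdOrthonormalBasis ℝ X i) u := by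
    ext φ
    rw [sum_apply, component_apply,
      ← (stdOrthonormalBasis ℝ X).sum_inner_mul_inner]
    refine Finset.sum_congr rfl fun i _ => ?_
    rw [real_inner_comm]
    rfl
  rw [this]
  exact Submodule.sum_mem _ fun i _ => Submodule.smul_mem _ _ (h i)

variable (n X) in
/-- Tuples of square integrable functions, parametrising `H^s ⊗ X`. -/
abbrev VTwo : Type := PiLp 2 fun _ : Idx X => LTwo n

/-- The parametrisation of `H^s(U) ⊗ X` by tuples of square integrable functions. -/
def rho (U : Opens (Euc n)) (s : ℝ) : VTwo n X →ₗ[ℝ] 𝓓'(U, X) :=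
  vec ∘ₗ LinearMap.pi fun i => restr U ∘ₗ ((sob s).toLinearMap.restrictScalars ℝ) ∘ₗ
    (PiLp.projₗ (𝕜 := ℝ) 2 (fun _ : Idx X => LTwo n) i)

theorem rho_eq (U : Opens (Euc n)) (s : ℝ) (g : VTwo n X) :
    rho U s g = vec fun i => restr U (sob s (g i)) := rfl

theorem continuous_rho_apply (U : Opens (Euc n)) (s : ℝ) (φ : 𝓓(U, ℝ)) :
    Continuous fun g : VTwo n X => rho U s g φ := by
  simp only [rho_eq, vec_apply]
  refine continuous_finsetSum _ fun i _ => Continuous.smul ?_ continuous_const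
  exact (continuous_restr_sob_apply U s φ).comp (PiLp.continuous_apply 2 _ i)

theorem mem_sobolev_iff_exists_rho {U : Opens (Euc n)} {s : ℝ} {u : 𝓓'(U, X)} :
    u ∈ sobolev X U s ↔ ∃ g : VTwo n X, rho U s g = u := by
  rw [mem_sobolev_iff]
  constructor
  · intro h
    choose f hf using fun i => mem_scalarSobolev_iff.1 (h i)
    refine ⟨WithLp.toLp 2 f, ?_⟩
    rw [rho_eq]
    simp only [hf]
    exact vec_component u
  · rintro ⟨g, rfl⟩ i
    rw [rho_eq, component_vec]
    exact mem_scalarSobolev_iff.2 ⟨_, rfl⟩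

theorem sobolevNorm_nonneg (U : Opens (Euc n)) (s : ℝ) (u : 𝓓'(U, X)) : 0 ≤ sobolevNorm U s u :=
  Real.sqrt_nonneg _

theorem sobolevNorm_rho_le (U : Opens (Euc n)) (s : ℝ) (g : VTwo n X) :
    sobolevNorm U s (rho U s g) ≤ ‖g‖ := by
  rw [PiLp.norm_eq_of_L2, sobolevNorm]
  refine Real.sqrt_le_sqrt (Finset.sum_le_sum fun i _ => ?_)
  rw [rho_eq, component_vec]
  exact pow_le_pow_left₀ (scalarSobolevNorm_nonneg _ _ _) (scalarSobolevNorm_restr_le U s _) 2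

theorem exists_norm_eq_sobolevNorm {U : Opens (Euc n)} {s : ℝ} {u : 𝓓'(U, X)}
    (hu : u ∈ sobolev X U s) : ∃ g : VTwo n X, rho U s g = u ∧ ‖g‖ = sobolevNorm U s u := by
  choose f hf hn using fun i => exists_norm_eq_scalarSobolevNorm (mem_sobolev_iff.1 hu i)
  refine ⟨WithLp.toLp 2 f, ?_, ?_⟩
  · rw [rho_eq]
    simp only [hf]
    exact vec_component u
  · rw [PiLp.norm_eq_of_L2, sobolevNorm]
    simp only [hn]

theorem sobolevNorm_add_le {U : Opens (Euc n)} {s : ℝ} {u v : 𝓓'(U, X)}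
    (hu : u ∈ sobolev X U s) (hv : v ∈ sobolev X U s) :
    sobolevNorm U s (u + v) ≤ sobolevNorm U s u + sobolevNorm U s v := by
  obtain ⟨g, rfl, hg⟩ := exists_norm_eq_sobolevNorm hu
  obtain ⟨h, rfl, hh⟩ := exists_norm_eq_sobolevNorm hv
  rw [← hg, ← hh, ← map_add]
  exact (sobolevNorm_rho_le U s _).trans (norm_add_le _ _)

theorem sobolevNorm_smul_le {U : Opens (Euc n)} {s : ℝ} {u : 𝓓'(U, X)}
    (hu : u ∈ sobolev X U s) (c : ℝ) : sobolevNorm U s (c • u) ≤ |c| * sobolevNorm U s u := by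
  obtain ⟨g, rfl, hg⟩ := exists_norm_eq_sobolevNorm hu
  rw [← hg, ← map_smul]
  exact (sobolevNorm_rho_le U s _).trans (norm_smul_le c g)

theorem sobolevNorm_zero (U : Opens (Euc n)) (s : ℝ) : sobolevNorm U s (0 : 𝓓'(U, X)) = 0 := by
  refine le_antisymm ?_ (sobolevNorm_nonneg _ _ _)
  have := sobolevNorm_rho_le U s (0 : VTwo n X)
  rwa [map_zero, norm_zero] at this

theorem sobolev_anti {U : Opens (Euc n)} {s t : ℝ} (h : t ≤ s) : sobolev X U s ≤ sobolev X U t := by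
  intro u hu
  rw [mem_sobolev_iff] at hu ⊢
  intro i
  obtain ⟨f, hf⟩ := mem_scalarSobolev_iff.1 (hu i)
  obtain ⟨g, hg, -⟩ := (show SobBound s (sob s f) ‖f‖ from ⟨f, rfl, le_rfl⟩).order_mono h
  exact mem_scalarSobolev_iff.2 ⟨g, by rw [hg, hf]⟩

theorem sobolevNorm_anti {U : Opens (Euc n)} {s t : ℝ} (h : t ≤ s) {u : 𝓓'(U, X)}
    (hu : u ∈ sobolev X U s) : sobolevNorm U t u ≤ sobolevNorm U s u := by
  refine Real.sqrt_le_sqrt (Finset.sum_le_sum fun i _ =>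
    pow_le_pow_left₀ (scalarSobolevNorm_nonneg _ _ _) ?_ 2)
  obtain ⟨f, hf, hn⟩ := exists_norm_eq_scalarSobolevNorm (mem_sobolev_iff.1 hu i)
  obtain ⟨g, hg, hgn⟩ := (show SobBound s (sob s f) ‖f‖ from ⟨f, rfl, le_rfl⟩).order_mono h
  rw [← hn, ← hf, ← hg]
  exact (scalarSobolevNorm_restr_le U t g).trans hgn

end Vector

/-! ### Differential operators on tuples of components. -/

section PartialDerivatives

open LineDeriv

variable {n : ℕ} {M M' : Type*} [AddCommGroup M] [Module ℝ M] [LineDeriv (Euc n) M M]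
  [LineDerivAdd (Euc n) M M] [LineDerivSMul ℝ (Euc n) M M] [AddCommGroup M'] [Module ℝ M']
  [LineDeriv (Euc n) M' M'] [LineDerivAdd (Euc n) M' M'] [LineDerivSMul ℝ (Euc n) M' M']

/-- The partial derivatives. -/
def pd (i : Fin n) : M →ₗ[ℝ] M where
  toFun x := ∂_{EuclideanSpace.single i (1 : ℝ)} x
  map_add' _ _ := lineDerivOp_add _ _ _
  map_smul' _ _ := lineDerivOp_smul _ _ _

theorem pd_apply (i : Fin n) (x : M) : pd i x = ∂_{EuclideanSpace.single i (1 : ℝ)} x := rfl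

/-- The iterated partial derivatives. -/
def iterPd : {k : ℕ} → (Fin k → Fin n) → (M →ₗ[ℝ] M)
  | 0, _ => LinearMap.id
  | _ + 1, I => pd (I 0) ∘ₗ iterPd (Fin.tail I)

theorem iterPd_succ {k : ℕ} (I : Fin (k + 1) → Fin n) (x : M) :
    iterPd I x = pd (I 0) (iterPd (Fin.tail I) x) := rfl

theorem iterPd_eq {k : ℕ} (I : Fin k → Fin n) (x : M) :
    iterPd I x = ∂^{fun i => (EuclideanSpace.single (I i) (1 : ℝ) : Euc n)} x := by
  induction k with
  | zero => rfl
  | succ k ih =>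
    rw [iterPd_succ, ih, iteratedLineDerivOp_succ_left]
    rfl

theorem map_iterPd (F : M →ₗ[ℝ] M') (hF : ∀ (i : Fin n) x, F (pd i x) = pd i (F x)) {k : ℕ}
    (I : Fin k → Fin n) (x : M) : F (iterPd I x) = iterPd I (F x) := by
  induction k with
  | zero => rfl
  | succ k ih => rw [iterPd_succ, hF, ih, iterPd_succ]

variable {α : ℕ} {X Y : Type*} [NormedAddCommGroup X] [InnerProductSpace ℝ X]
  [FiniteDimensional ℝ X] [NormedAddCommGroup Y] [InnerProductSpace ℝ Y] [FiniteDimensional ℝ Y]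

/-- The matrix entries of the coefficients of a differential operator. -/
def DiffOp.entry (D : DiffOp n α X Y) (k : Fin (α + 1)) (I : Fin k → Fin n) (i : Idx X)
    (j : Idx Y) : ℝ :=
  inner ℝ (stdOrthonormalBasis ℝ Y j) (D.coeff k I (stdOrthonormalBasis ℝ X i))

/-- The action of a differential operator on tuples of components. -/
def DiffOp.act (D : DiffOp n α X Y) : (Idx X → M) →ₗ[ℝ] (Idx Y → M) :=
  LinearMap.pi fun j => ∑ k : Fin (α + 1), ∑ I : Fin k → Fin n, ∑ i : Idx X,
    D.entry k I i j • (iterPd I ∘ₗ LinearMap.proj i)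

theorem DiffOp.act_apply (D : DiffOp n α X Y) (T : Idx X → M) (j : Idx Y) :
    D.act T j = ∑ k : Fin (α + 1), ∑ I : Fin k → Fin n, ∑ i : Idx X,
      D.entry k I i j • iterPd I (T i) := by
  simp [DiffOp.act, LinearMap.sum_apply]

theorem DiffOp.map_act (D : DiffOp n α X Y) (F : M →ₗ[ℝ] M')
    (hF : ∀ (i : Fin n) x, F (pd i x) = pd i (F x)) (T : Idx X → M) (j : Idx Y) :
    F (D.act T j) = D.act (fun i => F (T i)) j := by
  simp only [DiffOp.act_apply, map_sum, map_smul, map_iterPd F hF]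

end PartialDerivatives

/-! ### Operators on vector distributions, the pairing with test fields and the formal adjoint. -/

section Components

variable {n α : ℕ} {X Y : Type*} [NormedAddCommGroup X] [InnerProductSpace ℝ X]
  [FiniteDimensional ℝ X] [NormedAddCommGroup Y] [InnerProductSpace ℝ Y] [FiniteDimensional ℝ Y]
  {U U' : Opens (Euc n)}

theorem pd_vec (u : Idx X → 𝓓'(U, ℝ)) (l : Fin n) : pd l (vec u) = vec fun i => pd l (u i) := by
  ext φ
  simp only [pd_apply, Distribution.lineDerivOp_apply_apply, vec_apply]

theorem iterPd_vec (u : Idx X → 𝓓'(U, ℝ)) {k : ℕ} (I : Fin k → Fin n) :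
    iterPd I (vec u) = vec fun i => iterPd I (u i) := by
  induction k with
  | zero => rfl
  | succ k ih => simp only [iterPd_succ, ih, pd_vec]

theorem mapCLM_vec (A : X →ₗ[ℝ] Y) (u : Idx X → 𝓓'(U, ℝ)) :
    Distribution.mapCLM (LinearMap.toContinuousLinearMap A) (vec u) =
      vec fun j => ∑ i, inner ℝ (stdOrthonormalBasis ℝ Y j) (A (stdOrthonormalBasis ℝ X i)) •
        u i := by
  ext φ
  rw [Distribution.mapCLM_apply, vec_apply, vec_apply]
  simp only [map_sum, map_smul, sum_apply]
  simp only [Finset.sum_smul]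
  rw [Finset.sum_comm]
  refine Finset.sum_congr rfl fun i _ => ?_
  conv_lhs => rw [← (stdOrthonormalBasis ℝ Y).sum_repr'
    (LinearMap.toContinuousLinearMap A (stdOrthonormalBasis ℝ X i)), Finset.smul_sum]
  refine Finset.sum_congr rfl fun j _ => ?_
  rw [smul_smul, mul_comm]
  rfl

theorem DiffOp.onDist_vec (D : DiffOp n α X Y) (u : Idx X → 𝓓'(U, ℝ)) :
    D.onDist U (vec u) = vec (D.act u) := by
  have h : D.act u = ∑ k : Fin (α + 1), ∑ I : Fin k → Fin n,
      fun j => ∑ i : Idx X, D.entry k I i j • iterPd I (u i) := by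
    ext1 j
    simp only [DiffOp.act_apply, Finset.sum_apply]
  rw [h, map_sum]
  simp only [map_sum, DiffOp.onDist, LinearMap.sum_apply, LinearMap.comp_apply]
  refine Finset.sum_congr rfl fun k _ => Finset.sum_congr rfl fun I _ => ?_
  have h1 := iterPd_eq I (vec u)
  rw [iterPd_vec] at h1
  have h2 := mapCLM_vec (D.coeff k I) fun i => iterPd I (u i)
  rw [h1] at h2
  exact h2

theorem toSchwartz_pd (φ : 𝓓(U, ℝ)) (l : Fin n) : toSchwartz (pd l φ) = pd l (toSchwartz φ) := by
  ext x
  rw [pd_apply, pd_apply, toSchwartz_apply, SchwartzMap.lineDerivOp_apply,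
    TestFunction.lineDerivOp_eq_lineDerivCLM ℝ, TestFunction.lineDerivCLM_apply_of_le (by simp)]
  have hd : DifferentiableAt ℝ φ x := (φ.contDiff.differentiable (by simp)).differentiableAt
  rw [hd.lineDeriv_eq_fderiv, (toSchwartz φ).differentiableAt.lineDeriv_eq_fderiv]
  have h := (Complex.ofRealCLM.hasFDerivAt.comp x hd.hasFDerivAt).fderiv
  have h2 : fderiv ℝ (toSchwartz φ) x = Complex.ofRealCLM.comp (fderiv ℝ φ x) := h
  rw [h2]
  rfl

theorem pd_comm (φ : 𝓓(U, ℝ)) (l m : Fin n) : pd l (pd m φ) = pd m (pd l φ) := by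
  have hd : ∀ (φ : 𝓓(U, ℝ)) (l : Fin n), ⇑(pd l φ : 𝓓(U, ℝ)) =
      fun x => fderiv ℝ φ x (EuclideanSpace.single l 1) := by
    intro φ l
    ext x
    rw [pd_apply, TestFunction.lineDerivOp_eq_lineDerivCLM ℝ,
      TestFunction.lineDerivCLM_apply_of_le (by simp)]
    exact (φ.contDiff.differentiable (by simp)).differentiableAt.lineDeriv_eq_fderiv
  have h2 : ∀ x, DifferentiableAt ℝ (fderiv ℝ φ) x := fun x =>
    ((φ.contDiff.fderiv_right (m := 1)
      (by rw [one_add_one_eq_two]; exact ENat.LEInfty.out)).differentiable (by simp)).differentiableAt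
  have h3 : ∀ l m x, pd l (pd m φ) x =
      fderiv ℝ (fderiv ℝ φ) x (EuclideanSpace.single l 1) (EuclideanSpace.single m 1) := by
    intro l m x
    rw [hd, hd]
    simp only
    rw [fderiv_clm_apply (h2 x) (by fun_prop)]
    simp
  ext x
  rw [h3, h3]
  exact (φ.contDiff.contDiffAt.isSymmSndFDerivAt
    (by rw [minSmoothness_of_isRCLikeNormedField]; exact ENat.LEInfty.out)).eq _ _

theorem iterPd_apply_apply (u : 𝓓'(U, ℝ)) {k : ℕ} (I : Fin k → Fin n) (φ : 𝓓(U, ℝ)) :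
    iterPd I u φ = (-1) ^ k * u (iterPd I φ) := by
  induction k generalizing φ with
  | zero => simp [iterPd]
  | succ k ih =>
    rw [iterPd_succ, pd_apply, Distribution.lineDerivOp_apply_apply, map_neg, ← pd_apply, ih,
      ← map_iterPd (pd (I 0)) (fun i x => pd_comm x _ _), iterPd_succ]
    ring

/-- The pairing of a distribution with a tuple of test functions. -/
def pair (w : 𝓓'(U, X)) (Φ : Idx X → 𝓓(U, ℝ)) : ℝ :=
  ∑ i, component (stdOrthonormalBasis ℝ X i) w (Φ i)

theorem pair_vec (w : Idx X → 𝓓'(U, ℝ)) (Φ : Idx X → 𝓓(U, ℝ)) :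
    pair (vec w) Φ = ∑ i, w i (Φ i) := by
  simp only [pair, component_vec]

theorem pair_add_left (w w' : 𝓓'(U, X)) (Φ : Idx X → 𝓓(U, ℝ)) :
    pair (w + w') Φ = pair w Φ + pair w' Φ := by
  simp only [pair, map_add, ← Finset.sum_add_distrib]
  rfl

theorem pair_smul_left (c : ℝ) (w : 𝓓'(U, X)) (Φ : Idx X → 𝓓(U, ℝ)) :
    pair (c • w) Φ = c * pair w Φ := by
  simp only [pair, map_smul, Finset.mul_sum]
  rfl

/-- The pairing with a fixed distribution, as a linear map. -/
def pairL (w : 𝓓'(U, X)) : (Idx X → 𝓓(U, ℝ)) →ₗ[ℝ] ℝ where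
  toFun := pair w
  map_add' Φ Ψ := by simp only [pair, Pi.add_apply, map_add, Finset.sum_add_distrib]
  map_smul' c Φ := by
    simp only [pair, Pi.smul_apply, map_smul, Finset.mul_sum, smul_eq_mul, RingHom.id_apply]

/-- The sign `(-1) ^ k` in the adjoint cancels the one from moving `k` derivatives onto the test
functions, and the matrix of coefficients is transposed. -/
theorem DiffOp.pair_adjoint (D : DiffOp n α X Y) (w : 𝓓'(U, Y)) (Φ : Idx X → 𝓓(U, ℝ)) :
    pair (D.adjoint.onDist U w) Φ = pair w (D.act Φ) := by
  obtain ⟨u, rfl⟩ : ∃ u, vec u = w := ⟨_, vec_component w⟩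
  have he : ∀ k I i j, D.adjoint.entry k I j i = (-1) ^ (k : ℕ) * D.entry k I i j := by
    intro k I i j
    simp only [DiffOp.entry, DiffOp.adjoint, LinearMap.smul_apply, inner_smul_right,
      LinearMap.adjoint_inner_right]
    rw [real_inner_comm]
  have hs : ∀ k : ℕ, ((-1 : ℝ) ^ k * (-1) ^ k) = 1 := fun k => by
    rw [← mul_pow]; simp
  rw [DiffOp.onDist_vec, pair_vec, pair_vec]
  simp only [DiffOp.act_apply, map_sum, map_smul, sum_apply, smul_apply, iterPd_apply_apply,
    smul_eq_mul, he]
  have hc : ∀ (k : Fin (α + 1)) (I : Fin k → Fin n) i j,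
      (-1) ^ (k : ℕ) * D.entry k I i j * ((-1) ^ (k : ℕ) * u j (iterPd I (Φ i))) =
        D.entry k I i j * u j (iterPd I (Φ i)) := by
    intro k I i j
    linear_combination (D.entry k I i j * u j (iterPd I (Φ i))) * hs k
  simp only [hc]
  rw [Finset.sum_comm]
  conv_rhs => rw [Finset.sum_comm]
  refine Finset.sum_congr rfl fun k _ => ?_
  rw [Finset.sum_comm]
  conv_rhs => rw [Finset.sum_comm]
  refine Finset.sum_congr rfl fun I _ => ?_
  rw [Finset.sum_comm]

end Components

/-! ### Differential operators on tempered distributions: order, commutators, restriction. -/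

section TemperedAction

open TemperedDistribution LineDeriv

variable {n : ℕ}

theorem real_smul_tempered (c : ℝ) (T : 𝓢'(Euc n, ℂ)) : c • T = (c : ℂ) • T := by
  ext φ
  change c • T φ = (c : ℂ) • T φ
  simp

theorem SobBound.real_smul {s a : ℝ} {T : 𝓢'(Euc n, ℂ)} (h : SobBound s T a) (c : ℝ) :
    SobBound s (c • T) (|c| * a) := by
  rw [real_smul_tempered]
  simpa using h.smul (c : ℂ)

theorem SobBound.pd {s a : ℝ} {T : 𝓢'(Euc n, ℂ)} (h : SobBound s T a) (i : Fin n) :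
    SobBound (s - 1) (SobolevComplex.pd i T) (2 * Real.pi * a) := by
  rw [pd_apply, lineDeriv_eq_fourierMultiplierCLM]
  have := (h.fourierMultiplier (t := 1) (C := 1)
    (g := fun x => ((inner ℝ x (EuclideanSpace.single i (1 : ℝ) : Euc n) : ℝ) : ℂ))
    (by fun_prop) zero_le_one (fun x => by
      rw [one_mul, Complex.norm_real, ← Real.sqrt_eq_rpow]
      refine (norm_inner_le_norm _ _).trans ?_
      rw [PiLp.norm_single, norm_one, mul_one]
      exact Real.le_sqrt_of_sq_le (by linarith))).smul (2 * Real.pi * Complex.I)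
  rw [one_mul] at this
  refine this.mono (le_of_eq ?_)
  simp [abs_of_pos Real.pi_pos]

theorem SobBound.iterPd {s a : ℝ} {T : 𝓢'(Euc n, ℂ)} (h : SobBound s T a) {k : ℕ}
    (I : Fin k → Fin n) :
    SobBound (s - k) (SobolevComplex.iterPd I T) ((2 * Real.pi) ^ k * a) := by
  induction k with
  | zero => simpa [SobolevComplex.iterPd] using h
  | succ k ih =>
    rw [iterPd_succ]
    have := (ih (Fin.tail I)).pd (I 0)
    rw [Nat.cast_succ, ← sub_sub, pow_succ', mul_assoc]
    exact this

variable {α : ℕ} {X Y : Type*} [NormedAddCommGroup X] [InnerProductSpace ℝ X]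
  [FiniteDimensional ℝ X] [NormedAddCommGroup Y] [InnerProductSpace ℝ Y] [FiniteDimensional ℝ Y]

theorem DiffOp.exists_sobBound_act (D : DiffOp n α X Y) (s : ℝ) : ∃ C : ℝ, 0 ≤ C ∧
    ∀ (T : Idx X → 𝓢'(Euc n, ℂ)) (c : ℝ), 0 ≤ c → (∀ i, SobBound s (T i) c) →
      ∀ j, SobBound (s - α) (D.act T j) (C * c) := by
  refine ⟨∑ j : Idx Y, ∑ k : Fin (α + 1), ∑ I : Fin k → Fin n, ∑ i : Idx X,
    |D.entry k I i j| * (2 * Real.pi) ^ (k : ℕ), by positivity, fun T c hc hT j => ?_⟩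
  have h : SobBound (s - α) (D.act T j) (∑ k : Fin (α + 1), ∑ I : Fin k → Fin n, ∑ i : Idx X,
      |D.entry k I i j| * ((2 * Real.pi) ^ (k : ℕ) * c)) := by
    rw [DiffOp.act_apply]
    refine SobBound.sum _ fun k _ => SobBound.sum _ fun I _ => SobBound.sum _ fun i _ => ?_
    refine (((hT i).iterPd I).order_mono ?_).real_smul _
    have : ((k : ℕ) : ℝ) ≤ α := by exact_mod_cast Nat.lt_succ_iff.1 k.2
    linarith
  refine h.mono ?_
  refine (le_of_eq ?_).trans (mul_le_mul_of_nonneg_right (Finset.single_le_sum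
    (f := fun j => ∑ k : Fin (α + 1), ∑ I : Fin k → Fin n, ∑ i : Idx X,
      |D.entry k I i j| * (2 * Real.pi) ^ (k : ℕ)) (fun j _ => by positivity)
    (Finset.mem_univ j)) hc)
  simp only [Finset.sum_mul, mul_assoc]

theorem smulLeft_pd (χ : 𝓢(Euc n, ℂ)) (l : Fin n) (T : 𝓢'(Euc n, ℂ)) :
    pd l (smulLeftCLM ℂ χ T) =
      smulLeftCLM ℂ χ (pd l T) + smulLeftCLM ℂ (pd l χ : 𝓢(Euc n, ℂ)) T := by
  have h : ∀ φ : 𝓢(Euc n, ℂ), ∂_{(EuclideanSpace.single l (1 : ℝ) : Euc n)}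
      (SchwartzMap.smulLeftCLM ℂ χ φ) =
      SchwartzMap.smulLeftCLM ℂ χ (∂_{(EuclideanSpace.single l (1 : ℝ) : Euc n)} φ) +
      SchwartzMap.smulLeftCLM ℂ (pd l χ : 𝓢(Euc n, ℂ)) φ := by
    intro φ
    ext x
    have h1 : ⇑(SchwartzMap.smulLeftCLM ℂ χ φ) = fun x => χ x * φ x := by
      ext y
      rw [SchwartzMap.smulLeftCLM_apply_apply χ.hasTemperateGrowth, smul_eq_mul]
    rw [SchwartzMap.lineDerivOp_apply_eq_fderiv, h1, add_apply,
      SchwartzMap.smulLeftCLM_apply_apply χ.hasTemperateGrowth,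
      SchwartzMap.smulLeftCLM_apply_apply (SchwartzMap.hasTemperateGrowth _), pd_apply,
      SchwartzMap.lineDerivOp_apply_eq_fderiv, SchwartzMap.lineDerivOp_apply_eq_fderiv,
      fderiv_fun_mul χ.differentiableAt φ.differentiableAt]
    simp only [add_apply, smul_apply, smul_eq_mul]
    ring
  ext φ
  change T (SchwartzMap.smulLeftCLM ℂ χ (-∂_{(EuclideanSpace.single l (1 : ℝ) : Euc n)} φ)) =
    T (-∂_{(EuclideanSpace.single l (1 : ℝ) : Euc n)} (SchwartzMap.smulLeftCLM ℂ χ φ)) +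
      T (SchwartzMap.smulLeftCLM ℂ (pd l χ : 𝓢(Euc n, ℂ)) φ)
  rw [h φ, map_neg, ← map_add]
  congr 1
  abel

theorem MemSobolev.pd {s : ℝ} {T : 𝓢'(Euc n, ℂ)} (h : MemSobolev s 2 T) (l : Fin n) :
    MemSobolev (s - 1) 2 (SobolevComplex.pd l T) := h.lineDerivOp

theorem MemSobolev.iterPd {s : ℝ} {T : 𝓢'(Euc n, ℂ)} (h : MemSobolev s 2 T) {k : ℕ}
    (I : Fin k → Fin n) : MemSobolev (s - k) 2 (SobolevComplex.iterPd I T) := by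
  obtain ⟨f, hf⟩ := memSobolev_iff_exists_sob.1 h
  exact (SobBound.iterPd ⟨f, hf, le_rfl⟩ I).memSobolev

theorem MemSobolev.smulLeft {s : ℝ} {T : 𝓢'(Euc n, ℂ)} (h : MemSobolev s 2 T)
    (χ : 𝓢(Euc n, ℂ)) : MemSobolev s 2 (smulLeftCLM ℂ χ T) := by
  obtain ⟨f, hf⟩ := memSobolev_iff_exists_sob.1 h
  obtain ⟨C, -, hC⟩ := exists_sobBound_smulLeft s χ
  exact (hC T ‖f‖ ⟨f, hf, le_rfl⟩).memSobolev

/-- By the Leibniz rule, one more derivative differentiates the previous commutator and adds a term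
in which the derivative falls on `χ`. Either way one derivative of `T` is spared, which is the order
gained in the regularisation of kernels. -/
theorem memSobolev_commutator_iterPd {s : ℝ} {T : 𝓢'(Euc n, ℂ)} (h : MemSobolev s 2 T)
    (χ : 𝓢(Euc n, ℂ)) {k : ℕ} (I : Fin k → Fin n) :
    MemSobolev (s - k + 1) 2
      (iterPd I (smulLeftCLM ℂ χ T) - smulLeftCLM ℂ χ (iterPd I T)) := by
  induction k with
  | zero =>
    simp only [iterPd, LinearMap.id_apply, sub_self]
    exact memSobolev_fun_zero _ _ _ 2
  | succ k ih =>
    have h1 : iterPd I (smulLeftCLM ℂ χ T) - smulLeftCLM ℂ χ (iterPd I T) =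
        pd (I 0) (iterPd (Fin.tail I) (smulLeftCLM ℂ χ T) -
          smulLeftCLM ℂ χ (iterPd (Fin.tail I) T)) +
        smulLeftCLM ℂ (pd (I 0) χ : 𝓢(Euc n, ℂ)) (iterPd (Fin.tail I) T) := by
      rw [iterPd_succ, iterPd_succ, map_sub, smulLeft_pd]
      abel
    rw [h1]
    have h2 : s - (k + 1 : ℕ) + 1 = s - k := by push_cast; ring
    rw [h2]
    refine MemSobolev.add ?_ (MemSobolev.smulLeft (MemSobolev.iterPd h _) _)
    have := MemSobolev.pd (ih (Fin.tail I)) (I 0)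
    rwa [add_sub_cancel_right] at this

theorem memSobolev_sum {ι : Type*} (t : Finset ι) {s : ℝ} {T : ι → 𝓢'(Euc n, ℂ)}
    (h : ∀ i ∈ t, MemSobolev s 2 (T i)) : MemSobolev s 2 (∑ i ∈ t, T i) := by
  choose! f hf using fun i hi => memSobolev_iff_exists_sob.1 (h i hi)
  exact (SobBound.sum t fun i hi => ⟨f i, hf i hi, le_rfl⟩).memSobolev

theorem DiffOp.memSobolev_commutator (D : DiffOp n α X Y) {s : ℝ} {T : Idx X → 𝓢'(Euc n, ℂ)}
    (h : ∀ i, MemSobolev s 2 (T i)) (χ : 𝓢(Euc n, ℂ)) (j : Idx Y) :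
    MemSobolev (s - α + 1) 2
      (D.act (fun i => smulLeftCLM ℂ χ (T i)) j - smulLeftCLM ℂ χ (D.act T j)) := by
  have h1 : D.act (fun i => smulLeftCLM ℂ χ (T i)) j - smulLeftCLM ℂ χ (D.act T j) =
      ∑ k : Fin (α + 1), ∑ I : Fin k → Fin n, ∑ i : Idx X, (D.entry k I i j : ℂ) •
        (iterPd I (smulLeftCLM ℂ χ (T i)) - smulLeftCLM ℂ χ (iterPd I (T i))) := by
    simp only [DiffOp.act_apply, map_sum, real_smul_tempered, map_smul, ← Finset.sum_sub_distrib,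
      smul_sub]
  rw [h1]
  refine memSobolev_sum _ fun k _ => memSobolev_sum _ fun I _ => memSobolev_sum _ fun i _ => ?_
  refine (MemSobolev.mono ?_ (memSobolev_commutator_iterPd (h i) χ I)).smul _
  have : ((k : ℕ) : ℝ) ≤ α := by exact_mod_cast Nat.lt_succ_iff.1 k.2
  linarith

theorem DiffOp.act_mol (D : DiffOp n α X Y) {c : Euc n} (κ : ContDiffBump c)
    (T : Idx X → 𝓢'(Euc n, ℂ)) (j : Idx Y) :
    D.act (fun i => mol κ (T i)) j = mol κ (D.act T j) :=
  (D.map_act ((mol κ).toLinearMap.restrictScalars ℝ) (fun _ T => mol_lineDerivOp κ _ T) T j).symm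

theorem restr_pd (U : Opens (Euc n)) (T : 𝓢'(Euc n, ℂ)) (l : Fin n) :
    restr U (pd l T) = pd l (restr U T) := by
  ext φ
  rw [pd_apply l (restr U T), Distribution.lineDerivOp_apply_apply, map_neg, ← pd_apply,
    restr_apply, restr_apply, toSchwartz_pd, ← Complex.neg_re, ← map_neg]
  rfl

theorem DiffOp.restr_act (D : DiffOp n α X Y) (U : Opens (Euc n)) (T : Idx X → 𝓢'(Euc n, ℂ))
    (j : Idx Y) : restr U (D.act T j) = D.act (fun i => restr U (T i)) j :=
  D.map_act (restr U) (fun i T => restr_pd U T i) T j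

theorem DiffOp.onDist_restr (D : DiffOp n α X Y) (U : Opens (Euc n))
    (T : Idx X → 𝓢'(Euc n, ℂ)) :
    D.onDist U (vec fun i => restr U (T i)) = vec fun j => restr U (D.act T j) := by
  rw [DiffOp.onDist_vec]
  congr 1
  ext1 j
  rw [DiffOp.restr_act]

end TemperedAction

/-! ### Smooth fields as distributions and the duality of opposite orders. -/

section SmoothFields

open TemperedDistribution LineDeriv

variable {n α : ℕ} {X Y : Type*} [NormedAddCommGroup X] [InnerProductSpace ℝ X]
  [FiniteDimensional ℝ X] [NormedAddCommGroup Y] [InnerProductSpace ℝ Y] [FiniteDimensional ℝ Y]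
  {U U' : Opens (Euc n)}

/-- A test function as a tempered distribution. -/
def testTempered : 𝓓(U, ℝ) →ₗ[ℝ] 𝓢'(Euc n, ℂ) :=
  (SchwartzMap.toTemperedDistributionCLM (Euc n) ℂ volume).toLinearMap.restrictScalars ℝ ∘ₗ
    (toSchwartzCLM U).toLinearMap

theorem testTempered_eq_sob (s : ℝ) (φ : 𝓓(U, ℝ)) :
    testTempered φ = sob s (bes s (toSchwartz φ)) := (sob_bes s _).symm

theorem testTempered_apply (φ : 𝓓(U, ℝ)) (ψ : 𝓢(Euc n, ℂ)) :
    testTempered φ ψ = ∫ x, ψ x * (φ x : ℂ) :=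
  SchwartzMap.toTemperedDistributionCLM_apply_apply volume (toSchwartz φ) ψ

theorem testTempered_pd (φ : 𝓓(U, ℝ)) (l : Fin n) :
    testTempered (pd l φ) = pd l (testTempered φ) := by
  have h : ∀ φ : 𝓢(Euc n, ℂ), ((pd l φ : 𝓢(Euc n, ℂ)) : 𝓢'(Euc n, ℂ)) =
      pd l (φ : 𝓢'(Euc n, ℂ)) := by
    intro φ
    ext ψ
    change _ = (φ : 𝓢'(Euc n, ℂ)) (-∂_{(EuclideanSpace.single l (1 : ℝ) : Euc n)} ψ)
    have h0 : ∀ a b : 𝓢(Euc n, ℂ), (a : 𝓢'(Euc n, ℂ)) b = ∫ x, b x • a x := fun a b =>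
      SchwartzMap.toTemperedDistributionCLM_apply_apply volume a b
    rw [h0, h0]
    refine (SchwartzMap.integral_mul_lineDerivOp_right_eq_neg_left ψ φ _).trans ?_
    rw [← integral_neg]
    refine integral_congr_ae (Filter.Eventually.of_forall fun x => ?_)
    simp
  change ((toSchwartz (pd l φ) : 𝓢(Euc n, ℂ)) : 𝓢'(Euc n, ℂ)) = _
  rw [toSchwartz_pd, h]
  rfl

/-- A tuple of test functions on `U'` as an `X`-valued distribution on `U`. -/
def smoothField (U : Opens (Euc n)) : (Idx X → 𝓓(U', ℝ)) →ₗ[ℝ] 𝓓'(U, X) :=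
  vec ∘ₗ LinearMap.pi fun i => restr U ∘ₗ testTempered ∘ₗ LinearMap.proj i

theorem smoothField_eq (Φ : Idx X → 𝓓(U', ℝ)) :
    smoothField U Φ = vec fun i => restr U (testTempered (Φ i)) := rfl

theorem restr_testTempered_apply (φ : 𝓓(U', ℝ)) (ψ : 𝓓(U, ℝ)) :
    restr U (testTempered φ) ψ = ∫ x, ψ x * φ x := by
  rw [restr_apply, testTempered_apply]
  simp only [toSchwartz_apply, ← Complex.ofReal_mul]
  rw [integral_complex_ofReal, Complex.ofReal_re]

theorem DiffOp.onDist_smoothField (D : DiffOp n α X Y) (Φ : Idx X → 𝓓(U', ℝ)) :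
    D.onDist U (smoothField U Φ) = smoothField U (D.act Φ) := by
  rw [smoothField_eq, DiffOp.onDist_restr, smoothField_eq]
  congr 1
  ext1 j
  rw [D.map_act testTempered (fun i φ => testTempered_pd φ i)]

theorem rho_bes (U : Opens (Euc n)) (s : ℝ) (Φ : Idx X → 𝓓(U', ℝ)) :
    rho U s (WithLp.toLp 2 fun i => bes s (toSchwartz (Φ i))) = smoothField U Φ := by
  rw [rho_eq, smoothField_eq]
  simp only [testTempered_eq_sob s]

theorem smoothField_mem_sobolev (U : Opens (Euc n)) (s : ℝ) (Φ : Idx X → 𝓓(U', ℝ)) :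
    smoothField U Φ ∈ sobolev X U s :=
  mem_sobolev_iff_exists_rho.2 ⟨_, rho_bes U s Φ⟩

theorem smoothDist_eq_smoothField (φ : 𝓓(U', ℝ)) (x : X) :
    smoothDist U φ x = smoothField U fun i => inner ℝ (stdOrthonormalBasis ℝ X i) x • φ := by
  ext ψ
  rw [smoothDist_apply, smoothField_eq, vec_apply]
  simp only [map_smul, smul_apply, restr_testTempered_apply, smul_smul]
  rw [integral_smul_const]
  conv_lhs => rw [← (stdOrthonormalBasis ℝ X).sum_repr' x, Finset.smul_sum]
  refine Finset.sum_congr rfl fun i _ => ?_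
  rw [smul_smul, smul_eq_mul, mul_comm]

theorem pair_smul_eq (w : 𝓓'(U, X)) (φ : 𝓓(U, ℝ)) (x : X) :
    pair w (fun i => inner ℝ (stdOrthonormalBasis ℝ X i) x • φ) = inner ℝ (w φ) x := by
  simp only [pair, map_smul, component_apply, smul_eq_mul]
  rw [← (stdOrthonormalBasis ℝ X).sum_inner_mul_inner]
  refine Finset.sum_congr rfl fun i _ => ?_
  rw [mul_comm, real_inner_comm]

/-- The `H^s`-norm of a tuple of test functions. -/
def besNorm (s : ℝ) (Φ : Idx X → 𝓓(U, ℝ)) : ℝ :=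
  ‖(WithLp.toLp 2 fun i => bes s (toSchwartz (Φ i)) : VTwo n X)‖

theorem sobolevNorm_smoothField_le (U : Opens (Euc n)) (s : ℝ) (Φ : Idx X → 𝓓(U', ℝ)) :
    sobolevNorm U s (smoothField U Φ) ≤ besNorm s Φ := by
  rw [← rho_bes U s]
  exact sobolevNorm_rho_le U s _

theorem pair_rho (s : ℝ) (g : VTwo n X) (Φ : Idx X → 𝓓(U, ℝ)) :
    pair (rho U s g) Φ =
      ∑ i, inner ℝ (conjLTwo (g i)) (bes (-s) (toSchwartz (Φ i))) := by
  rw [rho_eq, pair_vec]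
  simp only [restr_apply, re_sob_apply]

theorem abs_pair_rho_le (s : ℝ) (g : VTwo n X) (Φ : Idx X → 𝓓(U, ℝ)) :
    |pair (rho U s g) Φ| ≤ ‖g‖ * besNorm (-s) Φ := by
  have h : pair (rho U s g) Φ = inner ℝ (WithLp.toLp 2 fun i => conjLTwo (g i) : VTwo n X)
      (WithLp.toLp 2 fun i => bes (-s) (toSchwartz (Φ i)) : VTwo n X) := by
    rw [pair_rho, PiLp.inner_apply]
  rw [h]
  refine (abs_real_inner_le_norm _ _).trans (le_of_eq ?_)
  rw [besNorm, PiLp.norm_eq_of_L2 (WithLp.toLp 2 fun i => conjLTwo (g i) : VTwo n X),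
    PiLp.norm_eq_of_L2 g]
  simp only [norm_conjLTwo]

/-- Hahn–Banach and Riesz in the Hilbert space of tuples. The conjugation restores the bilinear
pairing from the inner product. -/
theorem exists_rho_eq_of_le (s : ℝ) {C : ℝ} (hC : 0 ≤ C) (L : (Idx X → 𝓓(U, ℝ)) →ₗ[ℝ] ℝ)
    (h : ∀ Φ, L Φ ≤ C * besNorm (-s) Φ) :
    ∃ g : VTwo n X, ‖g‖ ≤ C ∧ ∀ Φ, pair (rho U s g) Φ = L Φ := by
  let B : (Idx X → 𝓓(U, ℝ)) →ₗ[ℝ] VTwo n X :=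
    { toFun := fun Φ => WithLp.toLp 2 fun i => bes (-s) (toSchwartzCLM U (Φ i))
      map_add' := fun Φ Ψ => by
        ext1 i
        change bes (-s) (toSchwartzCLM U (Φ i + Ψ i)) = _
        rw [map_add, map_add]
        rfl
      map_smul' := fun c Φ => by
        ext1 i
        change bes (-s) (toSchwartzCLM U (c • Φ i)) = _
        rw [map_smul]
        exact ((bes (n := n) (-s)).toLinearMap.restrictScalars ℝ).map_smul c _ }
  obtain ⟨g, hg, hgL⟩ := exists_inner_eq_of_le_norm B L C hC h
  refine ⟨WithLp.toLp 2 fun i => conjLTwo (g i), ?_, fun Φ => ?_⟩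
  · rw [PiLp.norm_eq_of_L2] at hg ⊢
    simpa only [norm_conjLTwo] using hg
  · rw [pair_rho, hgL, PiLp.inner_apply]
    refine Finset.sum_congr rfl fun i _ => ?_
    congr 1
    change conjLTwo (conjLTwo (g i)) = g i
    apply Lp.ext
    filter_upwards [conjLTwo_coeFn (conjLTwo (g i)), conjLTwo_coeFn (g i)] with x h1 h2
    rw [h1, h2, Complex.conj_conj]

end SmoothFields

/-! ### Supports of mollified test functions, and uniqueness of extensions to the whole space. -/

section Uniqueness

open TemperedDistribution LineDeriv

variable {n : ℕ} {U U' : Opens (Euc n)}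

theorem exists_toSchwartz_eq (S : 𝓢(Euc n, ℂ)) (hre : ∀ x, (S x).im = 0)
    (hc : HasCompactSupport S) (hs : tsupport S ⊆ U) : ∃ ψ : 𝓓(U, ℝ), toSchwartz ψ = S := by
  have hts : tsupport (fun x => (S x).re) ⊆ tsupport S :=
    closure_mono fun x hx h => hx (by simp [h])
  refine ⟨⟨fun x => (S x).re, Complex.reCLM.contDiff.comp (S.smooth ⊤),
    hc.mono' fun x hx => subset_tsupport _ fun h => hx (by simp [h]), hts.trans hs⟩, ?_⟩
  ext x
  exact Complex.ext rfl (hre x).symm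

theorem im_molT_toSchwartz {c : Euc n} (κ : ContDiffBump c) (φ : 𝓢(Euc n, ℂ))
    (hφ : ∀ x, (φ x).im = 0) (x : Euc n) : (molT κ φ x).im = 0 := by
  have h : molT κ φ x = ((∫ v, κ.normed volume v * (φ (x + v)).re : ℝ) : ℂ) := by
    rw [molT_apply, ← integral_complex_ofReal]
    refine integral_congr_ae (Filter.Eventually.of_forall fun v => ?_)
    have : φ (x + v) = ((φ (x + v)).re : ℂ) := Complex.ext rfl (hφ _)
    simp only
    rw [this]
    simp
  rw [h, Complex.ofReal_im]

theorem exists_of_molT_ne_zero {c : Euc n} (κ : ContDiffBump c) (φ : 𝓢(Euc n, ℂ)) {x : Euc n}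
    (hx : molT κ φ x ≠ 0) : ∃ v ∈ Metric.closedBall c κ.rOut, φ (x + v) ≠ 0 := by
  by_contra! h
  apply hx
  rw [molT_apply]
  refine integral_eq_zero_of_ae (Filter.Eventually.of_forall fun v => ?_)
  by_cases hv : v ∈ Metric.closedBall c κ.rOut
  · simp [h v hv]
  · have : κ.normed volume v = 0 := by
      rw [← Function.notMem_support, κ.support_normed_eq]
      exact fun h => hv (Metric.ball_subset_closedBall h)
    simp [this]

theorem isCompact_preimage_add {K C : Set (Euc n)} (hK : IsCompact K) (hC : IsCompact C) :
    IsCompact {x : Euc n | ∃ v ∈ C, x + v ∈ K} := by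
  have : {x : Euc n | ∃ v ∈ C, x + v ∈ K} = (fun p : Euc n × Euc n => p.1 - p.2) '' (K ×ˢ C) := by
    ext x
    constructor
    · rintro ⟨v, hv, hx⟩
      exact ⟨(x + v, v), ⟨hx, hv⟩, by simp⟩
    · rintro ⟨⟨y, v⟩, ⟨hy, hv⟩, rfl⟩
      exact ⟨v, hv, by simpa using hy⟩
  rw [this]
  exact (hK.prod hC).image (by fun_prop)

theorem tsupport_molT_subset {c : Euc n} (κ : ContDiffBump c) (φ : 𝓢(Euc n, ℂ))
    (hφ : HasCompactSupport φ) :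
    tsupport (molT κ φ) ⊆ {x | ∃ v ∈ Metric.closedBall c κ.rOut, x + v ∈ tsupport φ} := by
  refine closure_minimal (fun x hx => ?_)
    (isCompact_preimage_add hφ (isCompact_closedBall c κ.rOut)).isClosed
  obtain ⟨v, hv, h⟩ := exists_of_molT_ne_zero κ φ hx
  exact ⟨v, hv, subset_tsupport _ h⟩

theorem hasCompactSupport_toSchwartz (φ : 𝓓(U, ℝ)) : HasCompactSupport (toSchwartz φ) :=
  φ.hasCompactSupport.comp_left (g := fun t : ℝ => (t : ℂ)) Complex.ofReal_zero

theorem tsupport_toSchwartz (φ : 𝓓(U, ℝ)) : tsupport (toSchwartz φ) = tsupport φ := by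
  rw [tsupport, tsupport]
  congr 1
  ext x
  simp [toSchwartz_apply]

theorem hasCompactSupport_molT {c : Euc n} (κ : ContDiffBump c) (φ : 𝓢(Euc n, ℂ))
    (hφ : HasCompactSupport φ) : HasCompactSupport (molT κ φ) :=
  (isCompact_preimage_add hφ (isCompact_closedBall c κ.rOut)).of_isClosed_subset
    (isClosed_tsupport _) (tsupport_molT_subset κ φ hφ)

/-- The mollifications of `T` are square integrable and still vanish on real test functions, hence
are zero by the fundamental lemma of the calculus of variations. They converge to `T`. -/
theorem eq_zero_of_forall_toSchwartz {s : ℝ} {T : 𝓢'(Euc n, ℂ)} (h : MemSobolev s 2 T)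
    (hT : ∀ φ : 𝓓((⊤ : Opens (Euc n)), ℝ), T (toSchwartz φ) = 0) : T = 0 := by
  have hm : ∀ (c : Euc n) (κ : ContDiffBump c), mol κ T = 0 := by
    intro c κ
    obtain ⟨f, hf⟩ := memSobolev_zero_iff.1 (memSobolev_mol 0 h κ)
    have hf0 : ∀ᵐ x, f x = 0 := by
      refine ae_eq_zero_of_integral_contDiff_smul_eq_zero
        ((Lp.memLp f).locallyIntegrable (by norm_num)) fun g hg hgc => ?_
      let φ : 𝓓((⊤ : Opens (Euc n)), ℝ) := ⟨g, hg, hgc, fun _ _ => trivial⟩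
      obtain ⟨ψ, hψ⟩ := exists_toSchwartz_eq (U := ⊤) (molT κ (toSchwartz φ))
        (im_molT_toSchwartz κ _ fun x => Complex.ofReal_im _)
        (hasCompactSupport_molT κ _ (hasCompactSupport_toSchwartz φ)) (fun _ _ => trivial)
      have h1 : mol κ T (toSchwartz φ) = 0 := by rw [mol_apply, ← hψ, hT]
      rw [hf, Lp.toTemperedDistribution_apply] at h1
      rw [← h1]
      rfl
    have : f = 0 := Lp.ext (by
      filter_upwards [hf0, Lp.coeFn_zero ℂ 2 volume] with x h1 h2
      rw [h1, h2, Pi.zero_apply])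
    rw [hf, this]
    exact map_zero (Lp.toTemperedDistributionCLM ℂ volume 2)
  obtain ⟨f, rfl⟩ := memSobolev_iff_exists_sob.1 h
  have hn : ‖f‖ ≤ 0 := by
    refine le_of_forall_pos_le_add fun δ hδ => ?_
    obtain ⟨δ', hδ', H⟩ := exists_sobBound_mol_sub h hδ
    let κ : ContDiffBump (0 : Euc n) := ⟨δ' / 4, δ' / 2, by positivity, by linarith⟩
    obtain ⟨g, hg, hgn⟩ := H 0 κ (by simp only [norm_zero, zero_add, κ]; linarith)
    rw [hm, zero_sub, ← map_neg] at hg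
    rw [sob_injective s hg, norm_neg] at hgn
    linarith
  rw [norm_le_zero_iff.1 hn, map_zero]

variable {X : Type*} [NormedAddCommGroup X] [InnerProductSpace ℝ X] [FiniteDimensional ℝ X]

/-- On the whole space a real extension is unique, so the quotient norm loses nothing: the real part
of any minimiser is the Bessel potential of the field itself. -/
theorem besNorm_le_sobolevNorm_top (s : ℝ) (Φ : Idx X → 𝓓(U', ℝ)) :
    besNorm s Φ ≤ sobolevNorm ⊤ s (smoothField ⊤ Φ) := by
  obtain ⟨g, hg, hgn⟩ := exists_norm_eq_sobolevNorm (smoothField_mem_sobolev ⊤ s Φ)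
  have h : ∀ i, reLTwo (g i) = bes s (toSchwartz (Φ i)) := by
    intro i
    have hi : restr ⊤ (sob s (g i)) = restr ⊤ (testTempered (Φ i)) := by
      have := congrArg (component (stdOrthonormalBasis ℝ X i)) hg
      rwa [rho_eq, smoothField_eq, component_vec, component_vec] at this
    have h0 : sob s (reLTwo (g i) - bes s (toSchwartz (Φ i))) = 0 := by
      refine eq_zero_of_forall_toSchwartz (memSobolev_iff_exists_sob.2 ⟨_, rfl⟩) fun φ => ?_
      rw [map_sub, ← testTempered_eq_sob]
      change sob s (reLTwo (g i)) (toSchwartz φ) - testTempered (Φ i) (toSchwartz φ) = 0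
      rw [extends_sob_reLTwo s (g i) φ, hi, restr_testTempered_apply, testTempered_apply,
        ← integral_complex_ofReal, sub_eq_zero]
      simp [toSchwartz_apply]
    exact sub_eq_zero.1 (sob_injective s (h0.trans (map_zero _).symm))
  rw [← hgn, besNorm, PiLp.norm_eq_of_L2, PiLp.norm_eq_of_L2]
  refine Real.sqrt_le_sqrt (Finset.sum_le_sum fun i _ => pow_le_pow_left₀ (norm_nonneg _) ?_ 2)
  change ‖bes s (toSchwartz (Φ i))‖ ≤ ‖g i‖
  rw [← h]
  exact norm_reLTwo_le _

end Uniqueness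

/-! ### Inward translations on Lipschitz domains. -/

section Geometry

variable {n : ℕ}

/-- Arbitrarily short vectors from a small ball translate `K ∩ closure Ω` into `Ω`. -/
def InwardTranslatable (Ω : Opens (Euc n)) (K : Set (Euc n)) : Prop :=
  ∀ δ > 0, ∃ (c : Euc n) (r : ℝ), 0 < r ∧ ‖c‖ + r < δ ∧ ∀ v ∈ Metric.closedBall c r,
    ∀ x ∈ closure (Ω : Set (Euc n)), (x ∈ K ∨ x + v ∈ K) → x + v ∈ Ω

theorem InwardTranslatable.mono {Ω : Opens (Euc n)} {K K' : Set (Euc n)}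
    (h : InwardTranslatable Ω K) (hK : K' ⊆ K) : InwardTranslatable Ω K' := by
  intro δ hδ
  obtain ⟨c, r, hr, hc, H⟩ := h δ hδ
  exact ⟨c, r, hr, hc, fun v hv x hx hxv => H v hv x hx (hxv.imp (@hK _) (@hK _))⟩

theorem inwardTranslatable_of_mem {Ω : Opens (Euc n)} {x₀ : Euc n} (hx₀ : x₀ ∈ Ω) :
    ∃ ρ > 0, InwardTranslatable Ω (Metric.ball x₀ ρ) := by
  obtain ⟨ρ, hρ, hb⟩ := Metric.isOpen_iff.1 Ω.isOpen x₀ hx₀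
  refine ⟨ρ / 2, by positivity, fun δ hδ => ⟨0, min δ ρ / 2, by positivity, ?_, ?_⟩⟩
  · rw [norm_zero, zero_add]
    have := min_le_left δ ρ
    linarith
  · intro v hv x hx hxv
    apply hb
    rw [mem_closedBall_zero_iff] at hv
    have h1 := min_le_right δ ρ
    rw [mem_ball_iff_norm]
    rcases hxv with h | h
    · rw [mem_ball_iff_norm] at h
      have : x + v - x₀ = (x - x₀) + v := by abel
      rw [this]
      exact (norm_add_le _ _).trans_lt (by linarith)
    · rw [mem_ball_iff_norm] at h
      linarith

/-- Above a Lipschitz graph there is a uniform cone of vectors around the vertical that lead from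
the closure into the domain. -/
theorem inwardTranslatable_of_frontier {Ω : Opens (Euc n)} (hΩ : IsLipschitzDomain Ω) {x₀ : Euc n}
    (hx₀ : x₀ ∈ frontier (Ω : Set (Euc n))) :
    ∃ ρ > 0, InwardTranslatable Ω (Metric.ball x₀ ρ) := by
  obtain ⟨e, r, L, g, he, hr, hg, H⟩ := hΩ.locally_graph x₀ hx₀
  set P : Euc n → Euc n := fun x => x - (inner ℝ e x : ℝ) • e with hP
  have hPc : Continuous P := by fun_prop
  have hPadd : ∀ x y, P (x + y) = P x + P y := by
    intro x y
    simp only [hP, inner_add_right, add_smul]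
    abel
  have hPn : ∀ x, ‖P x‖ ≤ 2 * ‖x‖ := by
    intro x
    have h1 := abs_real_inner_le_norm e x
    rw [he, one_mul] at h1
    refine (norm_sub_le _ _).trans ?_
    rw [norm_smul, he, mul_one, Real.norm_eq_abs]
    linarith
  have hPe : ∀ a : ℝ, P (a • e) = 0 := by
    intro a
    simp [hP, inner_smul_right, he]
  have hcl : ∀ x ∈ closure (Ω : Set (Euc n)), x ∈ Metric.ball x₀ r → g (P x) ≤ inner ℝ e x := by
    intro x hx hxb
    have h1 : x ∈ closure ((Ω : Set (Euc n)) ∩ Metric.ball x₀ r) :=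
      Metric.isOpen_ball.closure_inter ⟨hx, hxb⟩
    have h2 : IsClosed {x | g (P x) ≤ inner ℝ e x} :=
      isClosed_le (hg.continuous.comp hPc) (by fun_prop)
    exact closure_minimal (fun y hy => ((H y hy.2).1 hy.1).le) h2 h1
  refine ⟨r / 4, by positivity, fun δ hδ => ?_⟩
  -- The translations have length at most `2 * ε ≤ r / 4`. So if one of `x`, `x + v` is within `r /
  -- 4` of `x₀`, both stay in the ball where the graph describes the domain.
  set ε := min δ r / 8 with hε
  have hε0 : 0 < ε := by positivity
  have hεδ : 8 * ε ≤ δ := by rw [hε]; linarith [min_le_left δ r]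
  have hεr : 8 * ε ≤ r := by rw [hε]; linarith [min_le_right δ r]
  -- A deviation `w` of length `ε * θ` from the vertical shift lowers the height by at most `ε * θ`
  -- and raises the graph by at most `2 * L * ε * θ`. The total is `ε / 2`, less than the vertical
  -- gain `ε`.
  set θ : ℝ := 1 / (2 * (1 + 2 * L)) with hθ
  have hL : (0 : ℝ) ≤ L := L.2
  have hθ0 : 0 < θ := by positivity
  have hθ1 : (1 + 2 * L) * θ = 1 / 2 := by
    rw [hθ]
    field_simp
  have hθ2 : θ ≤ 1 / 2 := by nlinarith
  refine ⟨ε • e, ε * θ, by positivity, ?_, ?_⟩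
  · rw [norm_smul, he, mul_one, Real.norm_of_nonneg hε0.le]
    nlinarith
  · intro v hv x hx hxv
    rw [mem_closedBall_iff_norm] at hv
    set w := v - ε • e with hw
    have hvw : v = ε • e + w := by rw [hw]; abel
    have hvn : ‖v‖ ≤ 2 * ε := by
      rw [hvw]
      refine (norm_add_le _ _).trans ?_
      rw [norm_smul, he, mul_one, Real.norm_of_nonneg hε0.le]
      nlinarith
    have hb : x ∈ Metric.ball x₀ r ∧ x + v ∈ Metric.ball x₀ r := by
      simp only [mem_ball_iff_norm] at hxv ⊢
      have e1 : x + v - x₀ = (x - x₀) + v := by abel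
      have e2 : x - x₀ = (x + v - x₀) - v := by abel
      have h1 := norm_add_le (x - x₀) v
      have h2 := norm_sub_le (x + v - x₀) v
      rw [← e1] at h1
      rw [← e2] at h2
      rcases hxv with h | h <;> constructor <;> linarith
    refine (H _ hb.2).2 ?_
    change g (P (x + v)) < _
    have h1 := hcl x hx hb.1
    have h2 : P (x + v) = P x + P w := by rw [hvw, hPadd, hPadd, hPe, zero_add]
    have h3 : g (P (x + v)) ≤ g (P x) + L * (2 * (ε * θ)) := by
      have h4 := hg.dist_le_mul (P (x + v)) (P x)
      rw [Real.dist_eq, h2, dist_eq_norm, add_sub_cancel_left] at h4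
      have h5 := (abs_le.1 h4).2
      have h6 : (L : ℝ) * ‖P w‖ ≤ L * (2 * (ε * θ)) :=
        mul_le_mul_of_nonneg_left ((hPn w).trans (by linarith)) hL
      rw [h2]
      linarith
    have h7 : inner ℝ e (x + v) = inner ℝ e x + ε + inner ℝ e w := by
      rw [hvw, inner_add_right, inner_add_right, inner_smul_right, real_inner_self_eq_norm_sq, he]
      ring
    have h8 : -(ε * θ) ≤ inner ℝ e w := by
      have := abs_real_inner_le_norm e w
      rw [he, one_mul] at this
      linarith [(abs_le.1 this).1]
    rw [h7]
    have h9 : ε * ((1 + 2 * L) * θ) = ε * (1 / 2) := by rw [hθ1]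
    nlinarith

theorem exists_inwardTranslatable_ball {Ω : Opens (Euc n)} (hΩ : IsLipschitzDomain Ω) {x₀ : Euc n}
    (hx₀ : x₀ ∈ closure (Ω : Set (Euc n))) :
    ∃ ρ > 0, InwardTranslatable Ω (Metric.ball x₀ ρ) := by
  by_cases h : x₀ ∈ Ω
  · exact inwardTranslatable_of_mem h
  · refine inwardTranslatable_of_frontier hΩ ?_
    rw [Ω.isOpen.frontier_eq]
    exact ⟨hx₀, h⟩

-- Finitely many good balls cover the compact closure. The functions sum to one on a neighbourhood
-- of it, and not only on the closure itself, because a distribution supported there also sees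
-- derivatives of test functions.
open scoped Manifold ContDiff in
theorem exists_inwardTranslatable_partition {Ω : Opens (Euc n)} (hΩ : IsLipschitzDomain Ω) :
    ∃ (ι : Type) (_ : Fintype ι) (χ : ι → 𝓓((⊤ : Opens (Euc n)), ℝ)) (N : Set (Euc n)),
      IsOpen N ∧ closure (Ω : Set (Euc n)) ⊆ N ∧ (∀ x ∈ N, ∑ p, χ p x = 1) ∧
      ∀ p, InwardTranslatable Ω (tsupport (χ p)) := by
  have hK : IsCompact (closure (Ω : Set (Euc n))) := hΩ.bounded.isCompact_closure
  choose! ρ hρ hadm using fun x (hx : x ∈ closure (Ω : Set (Euc n))) =>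
    exists_inwardTranslatable_ball hΩ hx
  obtain ⟨t, ht, hcov⟩ := hK.elim_nhds_subcover (fun x => Metric.ball x (ρ x))
    fun x hx => Metric.ball_mem_nhds x (hρ x hx)
  obtain ⟨N, hN, hKN, hNW⟩ := exists_compact_between hK
    (isOpen_biUnion fun x (_ : x ∈ t) => Metric.isOpen_ball (x := x) (ε := ρ x)) hcov
  obtain ⟨f, hf⟩ := SmoothPartitionOfUnity.exists_isSubordinate 𝓘(ℝ, Euc n) hN.isClosed
    (fun x : t => Metric.ball (x : Euc n) (ρ x)) (fun x => Metric.isOpen_ball)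
    (fun x hx => by
      obtain ⟨i, hi, hxi⟩ := Set.mem_iUnion₂.1 (hNW hx)
      exact Set.mem_iUnion.2 ⟨⟨i, hi⟩, hxi⟩)
  have hc : ∀ x, HasCompactSupport (f x) := fun x =>
    (isCompact_closedBall (x : Euc n) (ρ x)).of_isClosed_subset (isClosed_tsupport _)
      ((hf x).trans Metric.ball_subset_closedBall)
  refine ⟨t, inferInstance, fun x => ⟨f x, (f x).contMDiff.contDiff, hc x, fun _ _ => trivial⟩,
    interior N, isOpen_interior, hKN, fun x hx => ?_, fun p => ?_⟩
  · have := f.sum_eq_one (interior_subset hx)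
    rwa [finsum_eq_sum_of_fintype] at this
  · exact (hadm p (ht p p.2)).mono (hf p)

end Geometry

/-! ### Approximation of kernel elements by test fields. -/

section Approximation

open TemperedDistribution LineDeriv

variable {n : ℕ} {U U' : Opens (Euc n)}

theorem restr_apply_eq_zero {T : 𝓢'(Euc n, ℂ)} (h : restr U T = 0) (S : 𝓢(Euc n, ℂ))
    (hre : ∀ x, (S x).im = 0) (hc : HasCompactSupport S) (hs : tsupport S ⊆ U) :
    (T S).re = 0 := by
  obtain ⟨ψ, rfl⟩ := exists_toSchwartz_eq S hre hc hs
  rw [← restr_apply, h]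
  rfl

theorem smulLeft_toSchwartz_apply (η : 𝓓(U', ℝ)) (S : 𝓢(Euc n, ℂ)) (x : Euc n) :
    SchwartzMap.smulLeftCLM ℂ (toSchwartz η) S x = (η x : ℂ) * S x := by
  rw [SchwartzMap.smulLeftCLM_apply_apply (SchwartzMap.hasTemperateGrowth _), smul_eq_mul,
    toSchwartz_apply]

theorem im_smulLeft_toSchwartz (η : 𝓓(U', ℝ)) (S : 𝓢(Euc n, ℂ)) (hS : ∀ x, (S x).im = 0)
    (x : Euc n) : (SchwartzMap.smulLeftCLM ℂ (toSchwartz η) S x).im = 0 := by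
  rw [smulLeft_toSchwartz_apply]
  simp [hS x]

theorem tsupport_smulLeft_toSchwartz_left (η : 𝓓(U', ℝ)) (S : 𝓢(Euc n, ℂ)) :
    tsupport (SchwartzMap.smulLeftCLM ℂ (toSchwartz η) S) ⊆ tsupport η := by
  refine closure_mono fun x hx h => hx ?_
  rw [smulLeft_toSchwartz_apply, h, Complex.ofReal_zero, zero_mul]

theorem tsupport_smulLeft_toSchwartz_right (η : 𝓓(U', ℝ)) (S : 𝓢(Euc n, ℂ)) :
    tsupport (SchwartzMap.smulLeftCLM ℂ (toSchwartz η) S) ⊆ tsupport S := by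
  refine closure_mono fun x hx h => hx ?_
  rw [smulLeft_toSchwartz_apply, h, mul_zero]

theorem hasCompactSupport_smulLeft_toSchwartz (η : 𝓓(U', ℝ)) (S : 𝓢(Euc n, ℂ)) :
    HasCompactSupport (SchwartzMap.smulLeftCLM ℂ (toSchwartz η) S) :=
  η.hasCompactSupport.of_isClosed_subset (isClosed_tsupport _)
    (tsupport_smulLeft_toSchwartz_left η S)

theorem restr_smulLeft_eq_zero {T : 𝓢'(Euc n, ℂ)} (h : restr U T = 0) (η : 𝓓(U', ℝ)) :
    restr U (smulLeftCLM ℂ (toSchwartz η) T) = 0 := by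
  ext φ
  rw [restr_apply, smulLeftCLM_apply_apply]
  refine restr_apply_eq_zero h _ (im_smulLeft_toSchwartz η _ fun x => Complex.ofReal_im _)
    (hasCompactSupport_smulLeft_toSchwartz _ _)
    ((tsupport_smulLeft_toSchwartz_right _ _).trans ?_)
  rw [tsupport_toSchwartz]
  exact φ.tsupport_subset

/-- The product of a test function with the real part of a Schwartz function. -/
def mulRe (η : 𝓓(U', ℝ)) (S : 𝓢(Euc n, ℂ)) : 𝓓(U', ℝ) :=
  ⟨fun x => η x * (S x).re, η.contDiff.mul (Complex.reCLM.contDiff.comp (S.smooth ⊤)),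
    η.hasCompactSupport.mul_right, (tsupport_mul_subset_left).trans η.tsupport_subset⟩

theorem restr_testTempered_mulRe (η : 𝓓(U', ℝ)) (S : 𝓢(Euc n, ℂ)) :
    restr U (testTempered (mulRe η S)) =
      restr U (smulLeftCLM ℂ (toSchwartz η) (S : 𝓢'(Euc n, ℂ))) := by
  ext φ
  rw [restr_testTempered_apply, restr_apply, smulLeftCLM_apply_apply]
  have h0 : ∀ a b : 𝓢(Euc n, ℂ), (a : 𝓢'(Euc n, ℂ)) b = ∫ x, b x • a x := fun a b =>
    SchwartzMap.toTemperedDistributionCLM_apply_apply volume a b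
  have h1 : ∀ x, SchwartzMap.smulLeftCLM ℂ S
      (SchwartzMap.smulLeftCLM ℂ (toSchwartz η) (toSchwartz φ)) x =
      SchwartzMap.smulLeftCLM ℂ (toSchwartz η) (toSchwartz φ) x • S x := by
    intro x
    rw [SchwartzMap.smulLeftCLM_apply_apply (SchwartzMap.hasTemperateGrowth _), smul_eq_mul,
      smul_eq_mul, mul_comm]
  have hi := (SchwartzMap.smulLeftCLM ℂ S
    (SchwartzMap.smulLeftCLM ℂ (toSchwartz η) (toSchwartz φ))).integrable (μ := volume)
  rw [h0, ← Complex.reCLM_apply]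
  simp only [← h1]
  rw [← Complex.reCLM.integral_comp_comm hi]
  refine integral_congr_ae (Filter.Eventually.of_forall fun x => ?_)
  simp only [h1, smulLeft_toSchwartz_apply, toSchwartz_apply, Complex.reCLM_apply, smul_eq_mul]
  change φ x * (η x * (S x).re) = _
  rw [← Complex.ofReal_mul, Complex.re_ofReal_mul]
  ring

variable {α : ℕ} {X Y : Type*} [NormedAddCommGroup X] [InnerProductSpace ℝ X]
  [FiniteDimensional ℝ X] [NormedAddCommGroup Y] [InnerProductSpace ℝ Y] [FiniteDimensional ℝ Y]

/-- The approximation is the sum `T'` of the mollified pieces `χ p T`, then replaced by test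
functions. Mollification commutes with `D`, so on `U` only the mollified commutators `R p` of `D`
with `χ p` survive in `D T'`. They have order `q - α + 1` and sum to zero on `U`, so `D T'` is small
in that order. The hypothesis `hmol` isolates the geometry: mollified pieces on `U` must depend only
on data on `U`, and the cutoff `η` must not alter them. -/
theorem exists_test_approx {ι : Type*} [Fintype ι] (χ : ι → 𝓓((⊤ : Opens (Euc n)), ℝ))
    (D : DiffOp n α X Y) {q : ℝ} {T : Idx X → 𝓢'(Euc n, ℂ)} (hT : ∀ i, MemSobolev q 2 (T i))
    (hD : ∀ j, restr U (D.act T j) = 0)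
    (hχ : ∀ i, restr U (∑ p, smulLeftCLM ℂ (toSchwartz (χ p)) (T i)) = restr U (T i))
    (hmol : ∀ δ > 0, ∃ (c : ι → Euc n) (κ : ∀ p, ContDiffBump (c p)) (η : 𝓓(U', ℝ)),
      (∀ p, ‖c p‖ + (κ p).rOut < δ) ∧
      (∀ p S, restr U S = 0 → restr U (mol (κ p) (smulLeftCLM ℂ (toSchwartz (χ p)) S)) = 0) ∧
      ∀ p i, restr U (smulLeftCLM ℂ (toSchwartz η)
        (mol (κ p) (smulLeftCLM ℂ (toSchwartz (χ p)) (T i)))) =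
          restr U (mol (κ p) (smulLeftCLM ℂ (toSchwartz (χ p)) (T i))))
    {ε : ℝ} (hε : 0 < ε) :
    ∃ Φ : Idx X → 𝓓(U', ℝ),
      (∀ i, ∃ S, SobBound q S ε ∧ restr U S = restr U (testTempered (Φ i)) - restr U (T i)) ∧
      ∀ j, ∃ S, SobBound (q - α + 1) S ε ∧ restr U S = restr U (testTempered (D.act Φ j)) := by
  set m : ι → 𝓢'(Euc n, ℂ) →L[ℂ] 𝓢'(Euc n, ℂ) := fun p => smulLeftCLM ℂ (toSchwartz (χ p))
    with hm
  set R : ι → Idx Y → 𝓢'(Euc n, ℂ) := fun p j =>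
    D.act (fun i => m p (T i)) j - m p (D.act T j) with hR
  have hRm : ∀ p j, MemSobolev (q - α + 1) 2 (R p j) := fun p j =>
    D.memSobolev_commutator hT _ j
  -- All the mollification errors together cost at most `ε / 2`.
  set δ₁ : ℝ := ε / (2 * (Fintype.card ι + 1)) with hδ₁
  have hδ₁0 : 0 < δ₁ := by positivity
  have hδ₁c : (Fintype.card ι : ℝ) * δ₁ ≤ ε / 2 := by
    rw [hδ₁, mul_div_assoc', div_le_div_iff₀ (by positivity) (by positivity)]
    nlinarith
  obtain ⟨δ, hδ0, hδ⟩ : ∃ δ > 0, ∀ p, (∀ i, ∀ (c : Euc n) (κ : ContDiffBump c),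
      ‖c‖ + κ.rOut < δ → SobBound q (mol κ (m p (T i)) - m p (T i)) δ₁) ∧
      ∀ j, ∀ (c : Euc n) (κ : ContDiffBump c), ‖c‖ + κ.rOut < δ →
        SobBound (q - α + 1) (mol κ (R p j) - R p j) δ₁ := by
    have key : ∀ {s : ℝ} {S : 𝓢'(Euc n, ℂ)}, MemSobolev s 2 S →
        ∀ᶠ δ in nhdsWithin (0 : ℝ) (Set.Ioi 0), ∀ (c : Euc n) (κ : ContDiffBump c),
          ‖c‖ + κ.rOut < δ → SobBound s (mol κ S - S) δ₁ := by
      intro s S hS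
      obtain ⟨δ', hδ', H⟩ := exists_sobBound_mol_sub hS hδ₁0
      filter_upwards [Ioo_mem_nhdsGT hδ'] with δ hδ c κ h
      exact H c κ (h.trans hδ.2)
    have h1 : ∀ᶠ δ in nhdsWithin (0 : ℝ) (Set.Ioi 0), ∀ p,
        (∀ i, ∀ (c : Euc n) (κ : ContDiffBump c),
          ‖c‖ + κ.rOut < δ → SobBound q (mol κ (m p (T i)) - m p (T i)) δ₁) ∧
        ∀ j, ∀ (c : Euc n) (κ : ContDiffBump c), ‖c‖ + κ.rOut < δ →
          SobBound (q - α + 1) (mol κ (R p j) - R p j) δ₁ :=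
      Filter.eventually_all.2 fun p =>
        (Filter.eventually_all.2 fun i => key (MemSobolev.smulLeft (hT i) _)).and
          (Filter.eventually_all.2 fun j => key (hRm p j))
    obtain ⟨δ, h, hδ⟩ := (h1.and self_mem_nhdsWithin).exists
    exact ⟨δ, hδ, h⟩
  obtain ⟨c, κ, η, hc, hz, hη⟩ := hmol δ hδ0
  set T' : Idx X → 𝓢'(Euc n, ℂ) := fun i => ∑ p, mol (κ p) (m p (T i)) with hT'
  have hT'm : ∀ i, MemSobolev (q + 1) 2 (T' i) := fun i =>
    memSobolev_sum _ fun p _ => memSobolev_mol _ (MemSobolev.smulLeft (hT i) _) _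
  choose f hf using fun i => memSobolev_iff_exists_sob.1 (hT'm i)
  obtain ⟨Cη, hCη, Hη⟩ := exists_sobBound_smulLeft (q + 1) (toSchwartz η)
  obtain ⟨CD, hCD, HD⟩ := D.exists_sobBound_act (q + 1)
  -- Chosen so that the error of replacing `T'` by test functions stays below `ε / 2` after the
  -- cutoff and after applying `D`. It is measured in order `q + 1`, which `D` maps to order `q - α
  -- + 1`.
  set ε' : ℝ := ε / (2 * ((1 + Cη) * (1 + CD))) with hε'
  have hε'0 : 0 < ε' := by positivity
  have hε'1 : (1 + Cη) * (1 + CD) * ε' = ε / 2 := by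
    rw [hε']
    field_simp
  have hb1 : Cη * ε' ≤ ε / 2 := by
    rw [← hε'1]
    refine mul_le_mul_of_nonneg_right ?_ hε'0.le
    nlinarith [mul_nonneg hCη hCD]
  have hb2 : CD * (Cη * ε') ≤ ε / 2 := by
    rw [← hε'1, ← mul_assoc]
    refine mul_le_mul_of_nonneg_right ?_ hε'0.le
    nlinarith [mul_nonneg hCη hCD]
  choose S hS using fun i => exists_norm_sub_bes_lt (q + 1) (f i) hε'0
  set V : Idx X → 𝓢'(Euc n, ℂ) := fun i =>
    smulLeftCLM ℂ (toSchwartz η) ((S i : 𝓢'(Euc n, ℂ)) - T' i) with hV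
  have hVb : ∀ i, SobBound (q + 1) (V i) (Cη * ε') := by
    intro i
    refine Hη _ _ ⟨bes (q + 1) (S i) - f i, ?_, ?_⟩
    · rw [map_sub, sob_bes, hf]
    · rw [norm_sub_rev]
      exact (hS i).le
  have hηT : ∀ i, restr U (smulLeftCLM ℂ (toSchwartz η) (T' i)) = restr U (T' i) := by
    intro i
    simp only [hT', map_sum]
    exact Finset.sum_congr rfl fun p _ => hη p i
  have hΦ : ∀ i, restr U (testTempered (mulRe η (S i))) = restr U (V i) + restr U (T' i) := by
    intro i
    rw [restr_testTempered_mulRe, ← hηT, ← map_add]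
    congr 1
    rw [hV]
    simp only
    rw [← map_add, sub_add_cancel]
  refine ⟨fun i => mulRe η (S i), fun i => ?_, fun j => ?_⟩
  · refine ⟨V i + ∑ p, (mol (κ p) (m p (T i)) - m p (T i)), ?_, ?_⟩
    · refine (((hVb i).order_mono (by linarith)).add (SobBound.sum Finset.univ fun p _ =>
        (hδ p).1 i (c p) (κ p) (hc p))).mono ?_
      rw [Finset.sum_const, Finset.card_univ, nsmul_eq_mul]
      linarith
    · rw [hΦ, ← hχ i, Finset.sum_sub_distrib, map_add, map_sub, add_sub_assoc]
  · have hB : restr U (D.act T' j) = restr U (∑ p, (mol (κ p) (R p j) - R p j)) := by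
      have h1 : D.act T' j = ∑ p, mol (κ p) (D.act (fun i => m p (T i)) j) := by
        have : T' = ∑ p, fun i => mol (κ p) (m p (T i)) := by
          ext1 i
          simp only [hT', Finset.sum_apply]
        rw [this, map_sum, Finset.sum_apply]
        exact Finset.sum_congr rfl fun p _ => D.act_mol (κ p) _ j
      -- On `U` the terms `χ p (D T)` vanish, and the remaining terms add up to `D (∑ χ p T) = D T =
      -- 0`.
      have h2 : ∑ p, restr U (R p j) = 0 := by
        have h3 : ∀ p, restr U (R p j) = restr U (D.act (fun i => m p (T i)) j) := by
          intro p
          rw [hR]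
          simp only
          rw [map_sub, hm]
          simp only
          rw [restr_smulLeft_eq_zero (hD j), sub_zero]
        simp only [h3]
        rw [← map_sum, ← Finset.sum_apply, ← map_sum, DiffOp.restr_act]
        have h4 : (fun i => restr U ((∑ p, fun i => m p (T i) : Idx X → 𝓢'(Euc n, ℂ)) i)) =
            fun i => restr U (T i) := by
          ext1 i
          rw [Finset.sum_apply]
          exact hχ i
        rw [h4, ← DiffOp.restr_act, hD]
      have h5 : ∀ p, restr U (mol (κ p) (D.act (fun i => m p (T i)) j)) =
          restr U (mol (κ p) (R p j)) := by
        intro p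
        rw [hR]
        simp only
        rw [map_sub (mol (κ p)), map_sub (restr U), hz p _ (hD j), sub_zero]
      rw [h1, map_sum, Finset.sum_sub_distrib, map_sub, map_sum, map_sum, h2, sub_zero]
      exact Finset.sum_congr rfl fun p _ => h5 p
    refine ⟨D.act V j + ∑ p, (mol (κ p) (R p j) - R p j), ?_, ?_⟩
    · have h1 := HD V (Cη * ε') (by positivity) hVb j
      refine ((h1.order_mono (by linarith)).add (SobBound.sum Finset.univ fun p _ =>
        (hδ p).2 j (c p) (κ p) (hc p))).mono ?_
      rw [Finset.sum_const, Finset.card_univ, nsmul_eq_mul]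
      linarith
    · rw [D.map_act testTempered (fun i φ => testTempered_pd φ i), DiffOp.restr_act]
      simp only [hΦ]
      rw [map_add, ← hB, DiffOp.restr_act, DiffOp.restr_act]
      change _ = D.act ((fun i => restr U (V i)) + fun i => restr U (T' i)) j
      rw [map_add]
      rfl

end Approximation

/-! ### The approximation theorem on a Lipschitz domain, for restrictions and for supported
distributions. -/

section DomainApproximation

open TemperedDistribution LineDeriv

variable {n : ℕ} {U U' : Opens (Euc n)}

open scoped Manifold ContDiff in
theorem exists_test_eq_one {K : Set (Euc n)} (hK : IsCompact K) (hKU : K ⊆ U) :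
    ∃ (η : 𝓓(U, ℝ)) (N : Set (Euc n)), IsOpen N ∧ K ⊆ N ∧ ∀ x ∈ N, η x = 1 := by
  obtain ⟨L, hL, hKL, hLU⟩ := exists_compact_between hK U.isOpen hKU
  obtain ⟨f, h1, h0, -⟩ := exists_contMDiffMap_one_nhds_of_subset_interior (n := ⊤)
    𝓘(ℝ, Euc n) hK.isClosed hKL
  have hs : tsupport f ⊆ L := closure_minimal
    (fun x hx => by_contra fun h => hx (h0 x h)) hL.isClosed
  obtain ⟨N, hN, hKN, hN1⟩ := mem_nhdsSet_iff_exists.1 h1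
  exact ⟨⟨f, f.contMDiff.contDiff, hL.of_isClosed_subset (isClosed_tsupport _) hs,
    hs.trans hLU⟩, N, hN, hKN, hN1⟩

theorem smulLeft_toSchwartz_eq_self {η : 𝓓(U', ℝ)} {S : 𝓢(Euc n, ℂ)}
    (h : ∀ x ∈ tsupport S, η x = 1) : SchwartzMap.smulLeftCLM ℂ (toSchwartz η) S = S := by
  ext x
  rw [smulLeft_toSchwartz_apply]
  by_cases hx : x ∈ tsupport S
  · rw [h x hx, Complex.ofReal_one, one_mul]
  · rw [image_eq_zero_of_notMem_tsupport hx, mul_zero]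

theorem sum_smulLeft_toSchwartz {ι : Type*} [Fintype ι] (χ : ι → 𝓓(U', ℝ)) (S : 𝓢(Euc n, ℂ)) :
    ∑ p, SchwartzMap.smulLeftCLM ℂ (toSchwartz (χ p)) S =
      SchwartzMap.smulLeftCLM ℂ (toSchwartz (∑ p, χ p)) S := by
  ext x
  rw [sum_apply, smulLeft_toSchwartz_apply]
  simp only [smulLeft_toSchwartz_apply]
  rw [← Finset.sum_mul, sum_apply, Complex.ofReal_sum]

theorem sum_smulLeft_apply {ι : Type*} [Fintype ι] (χ : ι → 𝓓(U', ℝ)) (T : 𝓢'(Euc n, ℂ))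
    (S : 𝓢(Euc n, ℂ)) : (∑ p, smulLeftCLM ℂ (toSchwartz (χ p)) T) S =
      T (SchwartzMap.smulLeftCLM ℂ (toSchwartz (∑ p, χ p)) S) := by
  rw [sum_apply, ← sum_smulLeft_toSchwartz, map_sum]
  rfl

variable {α : ℕ} {X Y : Type*} [NormedAddCommGroup X] [InnerProductSpace ℝ X]
  [FiniteDimensional ℝ X] [NormedAddCommGroup Y] [InnerProductSpace ℝ Y] [FiniteDimensional ℝ Y]

theorem sobolevNorm_vec_restr_le {s c : ℝ} {u : Idx X → 𝓓'(U, ℝ)}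
    (h : ∀ i, ∃ S, SobBound s S c ∧ restr U S = u i) :
    sobolevNorm U s (vec u) ≤ Real.sqrt (Module.finrank ℝ X) * |c| := by
  choose S hS hu using h
  choose f hf hc using hS
  have h1 : vec u = rho U s (WithLp.toLp 2 f) := by
    rw [rho_eq]
    congr 1
    ext1 i
    rw [← hu, ← hf]
  rw [h1]
  refine (sobolevNorm_rho_le _ _ _).trans ?_
  rw [PiLp.norm_eq_of_L2, ← Real.sqrt_sq (abs_nonneg c), ← Real.sqrt_mul (Nat.cast_nonneg _)]
  refine Real.sqrt_le_sqrt ?_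
  calc ∑ i, ‖f i‖ ^ 2 ≤ ∑ _i : Idx X, |c| ^ 2 := Finset.sum_le_sum fun i _ =>
        pow_le_pow_left₀ (norm_nonneg _) ((hc i).trans (le_abs_self c)) 2
    _ = _ := by simp

theorem exists_smoothField_approx_of_test {D : DiffOp n α X Y} {q : ℝ}
    {T : Idx X → 𝓢'(Euc n, ℂ)} (h : ∀ ε > 0, ∃ Φ : Idx X → 𝓓(U', ℝ),
      (∀ i, ∃ S, SobBound q S ε ∧ restr U S = restr U (testTempered (Φ i)) - restr U (T i)) ∧
      ∀ j, ∃ S, SobBound (q - α + 1) S ε ∧ restr U S = restr U (testTempered (D.act Φ j)))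
    {ε : ℝ} (hε : 0 < ε) :
    ∃ Φ : Idx X → 𝓓(U', ℝ),
      sobolevNorm U q (smoothField U Φ - vec fun i => restr U (T i)) ≤ ε ∧
      sobolevNorm U (q - α + 1) (smoothField U (D.act Φ)) ≤ ε := by
  set a := Real.sqrt (Module.finrank ℝ X)
  set b := Real.sqrt (Module.finrank ℝ Y)
  have ha : 0 ≤ a := Real.sqrt_nonneg _
  have hb : 0 ≤ b := Real.sqrt_nonneg _
  have hε' : 0 < ε / (1 + a + b) := by positivity
  have h1 : (1 + a + b) * (ε / (1 + a + b)) = ε := by field_simp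
  obtain ⟨Φ, hΦ, hDΦ⟩ := h _ hε'
  refine ⟨Φ, ?_, ?_⟩
  · rw [smoothField_eq, ← map_sub]
    refine (sobolevNorm_vec_restr_le hΦ).trans ?_
    rw [abs_of_pos hε']
    nlinarith [mul_nonneg hb hε'.le]
  · rw [smoothField_eq]
    refine (sobolevNorm_vec_restr_le hDΦ).trans ?_
    rw [abs_of_pos hε']
    nlinarith [mul_nonneg ha hε'.le]

/-- The extension of `u` solves the equation only inside the domain, so its pieces are translated
outwards: their values in the domain then come from values inside it. -/
theorem exists_smoothField_approx {Ω : Opens (Euc n)} (hΩ : IsLipschitzDomain Ω)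
    (D : DiffOp n α X Y) {q : ℝ} {u : 𝓓'(Ω, X)} (hu : u ∈ sobolev X Ω q)
    (hDu : D.onDist Ω u = 0) {ε : ℝ} (hε : 0 < ε) :
    ∃ Φ : Idx X → 𝓓((⊤ : Opens (Euc n)), ℝ), sobolevNorm Ω q (smoothField Ω Φ - u) ≤ ε ∧
      sobolevNorm Ω (q - α + 1) (smoothField Ω (D.act Φ)) ≤ ε := by
  obtain ⟨g, rfl⟩ := mem_sobolev_iff_exists_rho.1 hu
  obtain ⟨ι, _, χ, N, hN, hΩN, hχ, hin⟩ := exists_inwardTranslatable_partition hΩ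
  rw [rho_eq] at hDu ⊢
  have hone : ∀ φ : 𝓓(Ω, ℝ),
      SchwartzMap.smulLeftCLM ℂ (toSchwartz (∑ p, χ p)) (toSchwartz φ) = toSchwartz φ := by
    intro φ
    refine smulLeft_toSchwartz_eq_self fun x hx => ?_
    rw [tsupport_toSchwartz] at hx
    rw [sum_apply]
    exact hχ x (hΩN (subset_closure (φ.tsupport_subset hx)))
  refine exists_smoothField_approx_of_test (T := fun i => sob q (g i)) (fun ε hε => ?_) hε
  refine exists_test_approx χ D (fun i => memSobolev_iff_exists_sob.2 ⟨_, rfl⟩) ?_ ?_ ?_ hε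
  · intro j
    rw [DiffOp.onDist_restr] at hDu
    have := congrArg (component (stdOrthonormalBasis ℝ Y j)) hDu
    rwa [component_vec, map_zero] at this
  · intro i
    ext φ
    rw [restr_apply, sum_smulLeft_apply, hone, restr_apply]
  · intro δ hδ
    choose c r hr hc H using fun p => hin p δ hδ
    -- With centre `-c p` the transpose moves test functions inwards, so on the support of `χ p`
    -- they remain test functions on the domain. The cutoff `∑ p, χ p` is one there.
    refine ⟨fun p => -c p, fun p => ⟨r p / 2, r p, half_pos (hr p), half_lt_self (hr p)⟩,
      ∑ p, χ p, fun p => by simpa using hc p, fun p S hS => ?_, fun p i => ?_⟩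
    · ext φ
      rw [restr_apply, mol_apply, smulLeftCLM_apply_apply]
      refine restr_apply_eq_zero hS _ (im_smulLeft_toSchwartz _ _
        (im_molT_toSchwartz _ _ fun x => Complex.ofReal_im _))
        (hasCompactSupport_smulLeft_toSchwartz _ _) fun x hx => ?_
      obtain ⟨v, hv, hxv⟩ := tsupport_molT_subset _ _ (hasCompactSupport_toSchwartz φ)
        (tsupport_smulLeft_toSchwartz_right _ _ hx)
      rw [tsupport_toSchwartz] at hxv
      have := H p (-v) (by
        rw [mem_closedBall_iff_norm] at hv ⊢
        rwa [← norm_neg, neg_sub', neg_neg]) (x + v) (subset_closure (φ.tsupport_subset hxv)) (Or.inr (by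
          rw [add_neg_cancel_right]
          exact tsupport_smulLeft_toSchwartz_left _ _ hx))
      rwa [add_neg_cancel_right] at this
    · ext φ
      rw [restr_apply, smulLeftCLM_apply_apply, hone, restr_apply]

/-- Here the equation holds on the whole space, and the pieces are translated inwards so that their
supports become compact subsets of the open domain. -/
theorem exists_smoothField_approx_zero {Ω : Opens (Euc n)} (hΩ : IsLipschitzDomain Ω)
    (D : DiffOp n α X Y) {q : ℝ} {u : 𝓓'((⊤ : Opens (Euc n)), X)} (hu : u ∈ sobolevZero X Ω q)
    (hDu : D.onDist ⊤ u = 0) {ε : ℝ} (hε : 0 < ε) :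
    ∃ Φ : Idx X → 𝓓(Ω, ℝ), sobolevNorm ⊤ q (smoothField ⊤ Φ - u) ≤ ε ∧
      sobolevNorm ⊤ (q - α + 1) (smoothField ⊤ (D.act Φ)) ≤ ε := by
  obtain ⟨hu, hsupp⟩ := hu
  obtain ⟨g, rfl⟩ := mem_sobolev_iff_exists_rho.1 hu
  obtain ⟨ι, _, χ, N, hN, hΩN, hχ, hin⟩ := exists_inwardTranslatable_partition hΩ
  have hsupp' : ∀ (i : Idx X) (S : 𝓢(Euc n, ℂ)), (∀ x, (S x).im = 0) → HasCompactSupport S →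
      Disjoint (tsupport S) (closure (Ω : Set (Euc n))) → (sob q (g i) S).re = 0 := by
    intro i S hre hc hd
    obtain ⟨ψ, rfl⟩ := exists_toSchwartz_eq (U := ⊤) S hre hc fun _ _ => trivial
    have h1 : rho ⊤ q g ψ = 0 := hsupp ψ (by
      rw [tsupport_toSchwartz] at hd
      exact Set.disjoint_left.1 hd)
    have h2 := component_apply (stdOrthonormalBasis ℝ X i) (rho ⊤ q g) ψ
    rw [h1, inner_zero_right, rho_eq, component_vec] at h2
    exact h2
  rw [rho_eq] at hDu ⊢
  refine exists_smoothField_approx_of_test (T := fun i => sob q (g i)) (fun ε hε => ?_) hε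
  refine exists_test_approx χ D (fun i => memSobolev_iff_exists_sob.2 ⟨_, rfl⟩) ?_ ?_ ?_ hε
  · intro j
    rw [DiffOp.onDist_restr] at hDu
    have := congrArg (component (stdOrthonormalBasis ℝ Y j)) hDu
    rwa [component_vec, map_zero] at this
  · intro i
    ext φ
    rw [restr_apply, sum_smulLeft_apply, restr_apply, ← sub_eq_zero, ← Complex.sub_re, ← map_sub]
    have hc : HasCompactSupport (SchwartzMap.smulLeftCLM ℂ (toSchwartz (∑ p, χ p)) (toSchwartz φ)
        - toSchwartz φ) :=
      (hasCompactSupport_smulLeft_toSchwartz _ _).sub (hasCompactSupport_toSchwartz φ)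
    refine hsupp' i _ (fun x => ?_) hc ?_
    · rw [sub_apply, Complex.sub_im, im_smulLeft_toSchwartz _ _ fun x => Complex.ofReal_im _]
      simp [toSchwartz_apply]
    · rw [Set.disjoint_right]
      intro x hx hx'
      refine closure_minimal (s := Function.support _) (t := Nᶜ) (fun y hy hyN => hy ?_)
        hN.isClosed_compl hx' (hΩN hx)
      rw [sub_apply, smulLeft_toSchwartz_apply, sum_apply, hχ y hyN]
      simp
  · intro δ hδ
    choose c r hr hc H using fun p => hin p δ hδ
    let κ : ∀ p, ContDiffBump (c p) := fun p =>
      ⟨r p / 2, r p, half_pos (hr p), half_lt_self (hr p)⟩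
    -- `K` contains the supports of all translated and mollified pieces. It is a compact subset of
    -- the domain, so a cutoff equal to one near `K` changes none of them.
    set K : Set (Euc n) := ⋃ p, (fun z : Euc n × Euc n => z.1 + z.2) ''
      ((closure (Ω : Set (Euc n)) ∩ tsupport (χ p)) ×ˢ Metric.closedBall (c p) (r p)) with hK
    have hKc : IsCompact K := isCompact_iUnion fun p =>
      (((χ p).hasCompactSupport.inter_left isClosed_closure).prod
        (isCompact_closedBall _ _)).image (by fun_prop)
    have hKΩ : K ⊆ Ω := by
      rintro y hy
      obtain ⟨p, ⟨x, v⟩, ⟨⟨hx, hxχ⟩, hv⟩, rfl⟩ := Set.mem_iUnion.1 hy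
      exact H p v hv x hx (Or.inl hxχ)
    obtain ⟨η, N', hN', hKN', hη⟩ := exists_test_eq_one hKc hKΩ
    refine ⟨c, κ, η, hc, fun p S hS => ?_, fun p i => ?_⟩
    · ext φ
      rw [restr_apply, mol_apply, smulLeftCLM_apply_apply]
      exact restr_apply_eq_zero hS _ (im_smulLeft_toSchwartz _ _
        (im_molT_toSchwartz _ _ fun x => Complex.ofReal_im _))
        (hasCompactSupport_smulLeft_toSchwartz _ _) fun x hx => trivial
    · ext φ
      set ψ : 𝓢(Euc n, ℂ) :=
        SchwartzMap.smulLeftCLM ℂ (toSchwartz η) (toSchwartz φ) - toSchwartz φ with hψ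
      have hψc : HasCompactSupport ψ :=
        (hasCompactSupport_smulLeft_toSchwartz _ _).sub (hasCompactSupport_toSchwartz φ)
      have hψN : tsupport ψ ⊆ N'ᶜ := by
        refine closure_minimal (fun y hy hyN => hy ?_) hN'.isClosed_compl
        rw [hψ, sub_apply, smulLeft_toSchwartz_apply, hη y hyN]
        simp
      have hψr : ∀ x, (ψ x).im = 0 := by
        intro x
        rw [hψ, sub_apply, Complex.sub_im, im_smulLeft_toSchwartz _ _ fun x => Complex.ofReal_im _]
        simp [toSchwartz_apply]
      rw [restr_apply, restr_apply, smulLeftCLM_apply_apply, ← sub_eq_zero, ← Complex.sub_re,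
        ← map_sub, ← hψ, mol_apply, smulLeftCLM_apply_apply]
      refine hsupp' i _ (im_smulLeft_toSchwartz _ _ (im_molT_toSchwartz _ _ hψr))
        (hasCompactSupport_smulLeft_toSchwartz _ _) ?_
      rw [Set.disjoint_left]
      intro x hx hxΩ
      obtain ⟨v, hv, hxv⟩ := tsupport_molT_subset _ _ hψc
        (tsupport_smulLeft_toSchwartz_right _ _ hx)
      exact hψN hxv (hKN' (Set.mem_iUnion.2 ⟨p, (x, v),
        ⟨⟨hxΩ, tsupport_smulLeft_toSchwartz_left _ _ hx⟩, hv⟩, rfl⟩))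

end DomainApproximation

/-- A version of `exists_lift_norm_le` on the subspace where two continuous maps agree. -/
theorem exists_lift_norm_le_of_eq {E G Y Y' : Type*} [NormedAddCommGroup E] [NormedSpace ℝ E]
    [CompleteSpace E] [NormedAddCommGroup G] [NormedSpace ℝ G] [CompleteSpace G]
    [AddCommGroup Y] [Module ℝ Y] [TopologicalSpace Y] [T2Space Y]
    [AddCommGroup Y'] [Module ℝ Y'] [TopologicalSpace Y'] [T2Space Y']
    (L : E →ₗ[ℝ] Y) (M : G →ₗ[ℝ] Y) (A B : G →ₗ[ℝ] Y') (hL : Continuous L) (hM : Continuous M)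
    (hA : Continuous A) (hB : Continuous B) (h : ∀ y, A y = B y → ∃ x, L x = M y) :
    ∃ C : ℝ, 0 ≤ C ∧ ∀ y, A y = B y → ∃ x, L x = M y ∧ ‖x‖ ≤ C * ‖y‖ := by
  let Z : Submodule ℝ G := LinearMap.eqLocus A B
  have hZ : IsClosed (Z : Set G) := isClosed_eq hA hB
  have : CompleteSpace Z := hZ.completeSpace_coe
  obtain ⟨C, hC, H⟩ := exists_lift_norm_le L (M ∘ₗ Z.subtype) hL
    (hM.comp continuous_subtype_val) fun y => h y y.2
  exact ⟨C, hC, fun y hy => H ⟨y, hy⟩⟩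

/-! ### Closed scales of Sobolev spaces and scales in duality. -/

section Scales

variable {n α : ℕ} {U U' : Opens (Euc n)} {X Y : Type*} [NormedAddCommGroup X]
  [InnerProductSpace ℝ X] [FiniteDimensional ℝ X] [NormedAddCommGroup Y] [InnerProductSpace ℝ Y]
  [FiniteDimensional ℝ Y]

/-- A decreasing scale of closed subspaces of the spaces `H^s(U) ⊗ X`. -/
structure IsClosedScale (F : ℝ → Submodule ℝ 𝓓'(U, X)) : Prop where
  le_sobolev : ∀ s, F s ≤ sobolev X U s
  anti : ∀ {s t : ℝ}, t ≤ s → F s ≤ F t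
  isClosed : ∀ s, IsClosed {g : VTwo n X | rho U s g ∈ F s}

/-- The spaces `F s` and `G (-s)` are in duality through smooth fields on `U'`, which are dense in
`F s`. -/
structure IsDualScale (F : ℝ → Submodule ℝ 𝓓'(U, X)) (G : ℝ → Submodule ℝ 𝓓'(U', X)) : Prop
    extends IsClosedScale F where
  smooth_mem : ∀ s (Φ : Idx X → 𝓓(U', ℝ)), smoothField U Φ ∈ F s
  dense : ∀ s, ∀ u ∈ F s, ∀ ε > 0, ∃ Φ : Idx X → 𝓓(U', ℝ),
    sobolevNorm U s (smoothField U Φ - u) ≤ ε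
  pair_le : ∀ s, ∀ w ∈ G (-s), ∀ Φ : Idx X → 𝓓(U', ℝ),
    |pair w Φ| ≤ sobolevNorm U' (-s) w * sobolevNorm U s (smoothField U Φ)
  exists_pair_eq : ∀ s C, 0 ≤ C → ∀ L : (Idx X → 𝓓(U', ℝ)) →ₗ[ℝ] ℝ,
    (∀ Φ, L Φ ≤ C * sobolevNorm U s (smoothField U Φ)) →
    ∃ w ∈ G (-s), sobolevNorm U' (-s) w ≤ C ∧ ∀ Φ, pair w Φ = L Φ

theorem DiffOp.exists_sobolevNorm_onDist_le (D : DiffOp n α X Y) (U : Opens (Euc n)) (s : ℝ) :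
    ∃ C : ℝ, 0 ≤ C ∧ ∀ u ∈ sobolev X U s,
      sobolevNorm U (s - α) (D.onDist U u) ≤ C * sobolevNorm U s u := by
  obtain ⟨C, hC, H⟩ := D.exists_sobBound_act s
  refine ⟨Real.sqrt (Module.finrank ℝ Y) * C, by positivity, fun u hu => ?_⟩
  obtain ⟨g, rfl, hg⟩ := exists_norm_eq_sobolevNorm hu
  rw [← hg, rho_eq, DiffOp.onDist_restr]
  have h := H (fun i => sob s (g i)) ‖g‖ (norm_nonneg g)
    fun i => ⟨g i, rfl, PiLp.norm_apply_le g i⟩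
  refine (sobolevNorm_vec_restr_le (c := C * ‖g‖) fun j => ⟨_, h j, rfl⟩).trans (le_of_eq ?_)
  rw [abs_of_nonneg (by positivity), mul_assoc]

/-- The derivatives are moved onto the fixed test function, so continuity holds without regard to
orders. -/
theorem DiffOp.continuous_onDist_rho_apply (D : DiffOp n α X Y) (U : Opens (Euc n)) (s : ℝ)
    (φ : 𝓓(U, ℝ)) : Continuous fun g : VTwo n X => D.onDist U (rho U s g) φ := by
  simp only [rho_eq, DiffOp.onDist_vec, vec_apply, DiffOp.act_apply, sum_apply, smul_apply,
    iterPd_apply_apply]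
  refine continuous_finsetSum _ fun j _ => Continuous.smul ?_ continuous_const
  refine continuous_finsetSum _ fun k _ => continuous_finsetSum _ fun I _ =>
    continuous_finsetSum _ fun i _ => ?_
  have hc : Continuous fun g : VTwo n X => restr U (sob s (g i)) (iterPd I φ) :=
    (continuous_restr_sob_apply U s _).comp (PiLp.continuous_apply 2 _ i)
  simp only [smul_eq_mul]
  exact continuous_const.mul (continuous_const.mul hc)

/-- A distribution as a function on test functions. -/
def evalL (U : Opens (Euc n)) (X : Type*) [NormedAddCommGroup X] [InnerProductSpace ℝ X] :
    𝓓'(U, X) →ₗ[ℝ] (𝓓(U, ℝ) → X) where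
  toFun u φ := u φ
  map_add' _ _ := rfl
  map_smul' _ _ := rfl

theorem evalL_injective : Function.Injective (evalL U X) := fun u v h => by
  ext φ
  exact congrFun h φ

theorem continuous_evalL_rho (U : Opens (Euc n)) (s : ℝ) :
    Continuous fun g : VTwo n X => evalL U X (rho U s g) :=
  continuous_pi fun φ => continuous_rho_apply U s φ

theorem DiffOp.continuous_evalL_onDist_rho (D : DiffOp n α X Y) (U : Opens (Euc n)) (s : ℝ) :
    Continuous fun g : VTwo n X => evalL U Y (D.onDist U (rho U s g)) :=
  continuous_pi fun φ => D.continuous_onDist_rho_apply U s φ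

/-- The closed subspace of parameters of the elements of `F s`. -/
def params (F : ℝ → Submodule ℝ 𝓓'(U, X)) (s : ℝ) : Submodule ℝ (VTwo n X) :=
  (F s).comap (rho U s)

theorem IsClosedScale.completeSpace_params {F : ℝ → Submodule ℝ 𝓓'(U, X)} (hF : IsClosedScale F)
    (s : ℝ) : CompleteSpace (params F s) :=
  (show IsClosed (params F s : Set (VTwo n X)) from hF.isClosed s).completeSpace_coe

theorem IsClosedScale.exists_params {F : ℝ → Submodule ℝ 𝓓'(U, X)} (hF : IsClosedScale F)
    {s : ℝ} {u : 𝓓'(U, X)} (hu : u ∈ F s) :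
    ∃ g : params F s, rho U s g = u ∧ ‖g‖ = sobolevNorm U s u := by
  obtain ⟨g, rfl, hg⟩ := exists_norm_eq_sobolevNorm (hF.le_sobolev s hu)
  exact ⟨⟨g, hu⟩, rfl, hg⟩

end Scales

/-! ### Consequences of uniform cohomology: regular decomposition and regular potentials. -/

section Complex

variable {n α₁ α₂ α₃ : ℕ} {U U' : Opens (Euc n)} {X₁ X₂ X₃ X₄ : Type*}
  [NormedAddCommGroup X₁] [InnerProductSpace ℝ X₁] [FiniteDimensional ℝ X₁]
  [NormedAddCommGroup X₂] [InnerProductSpace ℝ X₂] [FiniteDimensional ℝ X₂]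
  [NormedAddCommGroup X₃] [InnerProductSpace ℝ X₃] [FiniteDimensional ℝ X₃]
  [NormedAddCommGroup X₄] [InnerProductSpace ℝ X₄] [FiniteDimensional ℝ X₄]
  {F₁ : ℝ → Submodule ℝ 𝓓'(U, X₁)} {F₂ : ℝ → Submodule ℝ 𝓓'(U, X₂)}
  {F₃ : ℝ → Submodule ℝ 𝓓'(U, X₃)}
  {D₁ : DiffOp n α₁ X₁ X₂} {D₂ : DiffOp n α₂ X₂ X₃} {D₃ : DiffOp n α₃ X₃ X₄}

theorem IsHilbertScale.exists_shift
    (h : IsHilbertScale α₁ α₂ (D₁.onDist U) (D₂.onDist U) (D₃.onDist U) F₁ F₂ F₃) :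
    ∃ (H₂ : Submodule ℝ 𝓓'(U, X₂)) (H₃ : Submodule ℝ 𝓓'(U, X₃)), FiniteDimensional ℝ H₂ ∧
      ∀ t : ℝ, (F₂ t ⊓ LinearMap.ker (D₂.onDist U) = (F₁ (t + α₁)).map (D₁.onDist U) ⊔ H₂ ∧
          Disjoint ((F₁ (t + α₁)).map (D₁.onDist U)) H₂) ∧
        (F₃ (t - α₂) ⊓ LinearMap.ker (D₃.onDist U) = (F₂ t).map (D₂.onDist U) ⊔ H₃ ∧
          Disjoint ((F₂ t).map (D₂.onDist U)) H₃) := by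
  obtain ⟨H₂, H₃, h2, -, H⟩ := h
  refine ⟨H₂, H₃, h2, fun t => ?_⟩
  have := H (t + α₁)
  rwa [add_sub_cancel_right] at this

section Basic

variable (h : IsHilbertScale α₁ α₂ (D₁.onDist U) (D₂.onDist U) (D₃.onDist U) F₁ F₂ F₃)
include h

theorem IsHilbertScale.onDist_mem {t : ℝ} {b : 𝓓'(U, X₁)} (hb : b ∈ F₁ (t + α₁)) :
    D₁.onDist U b ∈ F₂ t ∧ D₂.onDist U (D₁.onDist U b) = 0 := by
  obtain ⟨H₂, H₃, -, H⟩ := h.exists_shift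
  exact (H t).1.1.ge (Submodule.mem_sup_left (Submodule.mem_map_of_mem hb))

theorem IsHilbertScale.onDist_mem' {t : ℝ} {a : 𝓓'(U, X₂)} (ha : a ∈ F₂ t) :
    D₂.onDist U a ∈ F₃ (t - α₂) ∧ D₃.onDist U (D₂.onDist U a) = 0 := by
  obtain ⟨H₂, H₃, -, H⟩ := h.exists_shift
  exact (H t).2.1.ge (Submodule.mem_sup_left (Submodule.mem_map_of_mem ha))

/-- Being closed of order `t`, `D₁ b` has a potential of order `t + α₁` up to an element of `H₂`.
That element lies in the image of `D₁` at the lower order, so directness of the sum there kills it;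
the independence of `H₂` from the order is what makes this work. -/
theorem IsHilbertScale.exists_regular_potential {q t : ℝ} {b : 𝓓'(U, X₁)}
    (anti : ∀ {s t : ℝ}, t ≤ s → F₁ s ≤ F₁ t) (hb : b ∈ F₁ q)
    (hD : D₁.onDist U b ∈ F₂ t) (hqt : q ≤ t + α₁) :
    ∃ b' ∈ F₁ (t + α₁), D₁.onDist U b' = D₁.onDist U b := by
  obtain ⟨H₂, H₃, -, H⟩ := h.exists_shift
  have hbq : b ∈ F₁ (q - α₁ + α₁) := by rwa [sub_add_cancel]
  have h1 : D₁.onDist U b ∈ (F₁ (t + α₁)).map (D₁.onDist U) ⊔ H₂ :=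
    (H t).1.1.le ⟨hD, (h.onDist_mem hbq).2⟩
  obtain ⟨_, ⟨b', hb', rfl⟩, k, hk, he⟩ := Submodule.mem_sup.1 h1
  refine ⟨b', hb', ?_⟩
  have h2 : k = D₁.onDist U (b - b') := by rw [map_sub, ← he, add_sub_cancel_left]
  have h3 : k = 0 := Submodule.disjoint_def.1 (H (q - α₁)).1.2 k
    (h2 ▸ Submodule.mem_map_of_mem (by
      rw [sub_add_cancel]
      exact Submodule.sub_mem _ hb (anti hqt hb'))) hk
  rw [← he, h3, add_zero]

/-- The cohomology of `D₃` at the high order is combined with directness at the low order. The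
component in `H₂` has every order, hence is absorbed in the regular summand. -/
theorem IsHilbertScale.space_eq (anti : ∀ {s t : ℝ}, t ≤ s → F₂ s ≤ F₂ t) {s₁ s₂ : ℝ}
    (hs : s₁ ≤ s₂ + α₂) :
    F₂ s₁ ⊓ (F₃ s₂).comap (D₂.onDist U) =
      F₂ (s₂ + α₂) ⊔ (F₁ (s₁ + α₁)).map (D₁.onDist U) := by
  obtain ⟨H₂, H₃, -, H⟩ := h.exists_shift
  apply le_antisymm
  · rintro u ⟨hu, hDu⟩
    change D₂.onDist U u ∈ F₃ s₂ at hDu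
    have h1 : D₂.onDist U u ∈ (F₂ (s₂ + α₂)).map (D₂.onDist U) ⊔ H₃ := by
      rw [← (H (s₂ + α₂)).2.1, add_sub_cancel_right]
      exact ⟨hDu, (h.onDist_mem' hu).2⟩
    obtain ⟨_, ⟨a, ha, rfl⟩, k, hk, he⟩ := Submodule.mem_sup.1 h1
    have hua : u - a ∈ F₂ s₁ := Submodule.sub_mem _ hu (anti hs ha)
    have h2 : k = D₂.onDist U (u - a) := by rw [map_sub, ← he, add_sub_cancel_left]
    have h3 : k = 0 := Submodule.disjoint_def.1 (H s₁).2.2 k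
      (h2 ▸ Submodule.mem_map_of_mem hua) hk
    have h4 : u - a ∈ (F₁ (s₁ + α₁)).map (D₁.onDist U) ⊔ H₂ :=
      (H s₁).1.1.le ⟨hua, h2.symm.trans h3⟩
    obtain ⟨y, hy, z, hz, hyz⟩ := Submodule.mem_sup.1 h4
    have hz' : z ∈ F₂ (s₂ + α₂) := ((H (s₂ + α₂)).1.1.ge (Submodule.mem_sup_right hz)).1
    have : u = (a + z) + y := by
      rw [add_assoc, add_comm z y, hyz]
      abel
    rw [this]
    exact Submodule.add_mem_sup (Submodule.add_mem _ ha hz') hy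
  · refine sup_le (fun a ha => ⟨anti hs ha, ?_⟩) ?_
    · have := (h.onDist_mem' ha).1
      rwa [add_sub_cancel_right] at this
    · rintro _ ⟨b, hb, rfl⟩
      refine ⟨(h.onDist_mem hb).1, ?_⟩
      change D₂.onDist U (D₁.onDist U b) ∈ F₃ s₂
      rw [(h.onDist_mem hb).2]
      exact Submodule.zero_mem _

theorem IsHilbertScale.exists_bounded_decomposition (hF₁ : IsClosedScale F₁)
    (hF₂ : IsClosedScale F₂) (hF₃ : IsClosedScale F₃) {s₁ s₂ : ℝ} (hs : s₁ ≤ s₂ + α₂) :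
    ∃ C : ℝ, 0 ≤ C ∧ ∀ u ∈ F₂ s₁ ⊓ (F₃ s₂).comap (D₂.onDist U),
      ∃ a ∈ F₂ (s₂ + α₂), ∃ b ∈ F₁ (s₁ + α₁), u = a + D₁.onDist U b ∧
        sobolevNorm U (s₂ + α₂) a ≤ C * D₂.graphNorm U s₁ s₂ u ∧
        sobolevNorm U (s₁ + α₁) b ≤ C * D₂.graphNorm U s₁ s₂ u := by
  have := hF₁.completeSpace_params (s₁ + α₁)
  have := hF₂.completeSpace_params (s₂ + α₂)
  have := hF₂.completeSpace_params s₁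
  have := hF₃.completeSpace_params s₂
  -- Pairs of parameters on which `A` and `B` agree represent `u` together with `D₂ u`. They form a
  -- Banach space that carries the graph norm, to which the open mapping theorem applies.
  let A : (params F₂ s₁ × params F₃ s₂) →ₗ[ℝ] (𝓓(U, ℝ) → X₃) :=
    evalL U X₃ ∘ₗ D₂.onDist U ∘ₗ rho U s₁ ∘ₗ (params F₂ s₁).subtype ∘ₗ LinearMap.fst ℝ _ _
  let B : (params F₂ s₁ × params F₃ s₂) →ₗ[ℝ] (𝓓(U, ℝ) → X₃) :=
    evalL U X₃ ∘ₗ rho U s₂ ∘ₗ (params F₃ s₂).subtype ∘ₗ LinearMap.snd ℝ _ _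
  have hA : Continuous A := (D₂.continuous_evalL_onDist_rho U s₁).comp
    (continuous_subtype_val.comp continuous_fst)
  have hB : Continuous B := (continuous_evalL_rho U s₂).comp
    (continuous_subtype_val.comp continuous_snd)
  let L : (params F₂ (s₂ + α₂) × params F₁ (s₁ + α₁)) →ₗ[ℝ] (𝓓(U, ℝ) → X₂) :=
    evalL U X₂ ∘ₗ (rho U (s₂ + α₂) ∘ₗ (params F₂ (s₂ + α₂)).subtype ∘ₗ LinearMap.fst ℝ _ _ +
      D₁.onDist U ∘ₗ rho U (s₁ + α₁) ∘ₗ (params F₁ (s₁ + α₁)).subtype ∘ₗ LinearMap.snd ℝ _ _)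
  let M : (params F₂ s₁ × params F₃ s₂) →ₗ[ℝ] (𝓓(U, ℝ) → X₂) :=
    evalL U X₂ ∘ₗ rho U s₁ ∘ₗ (params F₂ s₁).subtype ∘ₗ LinearMap.fst ℝ _ _
  have hL : Continuous L :=
    ((continuous_evalL_rho U (s₂ + α₂)).comp (continuous_subtype_val.comp continuous_fst)).add
      ((D₁.continuous_evalL_onDist_rho U (s₁ + α₁)).comp
        (continuous_subtype_val.comp continuous_snd))
  have hM : Continuous M := (continuous_evalL_rho U s₁).comp
    (continuous_subtype_val.comp continuous_fst)
  obtain ⟨C, hC, H⟩ := exists_lift_norm_le_of_eq L M A B hL hM hA hB (by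
    rintro ⟨g, k⟩ hgk
    have hgk' : D₂.onDist U (rho U s₁ g) = rho U s₂ k := evalL_injective hgk
    have hu : rho U s₁ g ∈ F₂ s₁ ⊓ (F₃ s₂).comap (D₂.onDist U) := by
      refine ⟨g.2, ?_⟩
      change D₂.onDist U (rho U s₁ g) ∈ F₃ s₂
      rw [hgk']
      exact k.2
    rw [h.space_eq hF₂.anti hs] at hu
    obtain ⟨a, ha, _, ⟨b, hb, rfl⟩, he⟩ := Submodule.mem_sup.1 hu
    obtain ⟨ga, hga, -⟩ := hF₂.exists_params ha
    obtain ⟨gb, hgb, -⟩ := hF₁.exists_params hb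
    refine ⟨(ga, gb), ?_⟩
    change evalL U X₂ (rho U (s₂ + α₂) ga + D₁.onDist U (rho U (s₁ + α₁) gb)) =
      evalL U X₂ (rho U s₁ g)
    rw [hga, hgb, he])
  refine ⟨C, hC, fun u hu => ?_⟩
  obtain ⟨g, hg, hgn⟩ := hF₂.exists_params hu.1
  obtain ⟨k, hk, hkn⟩ := hF₃.exists_params (s := s₂) (u := D₂.onDist U u) hu.2
  obtain ⟨⟨ga, gb⟩, he, hn⟩ := H (g, k) (by
    change evalL U X₃ (D₂.onDist U (rho U s₁ g)) = evalL U X₃ (rho U s₂ k)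
    rw [hg, hk])
  have he' : rho U (s₂ + α₂) ga + D₁.onDist U (rho U (s₁ + α₁) gb) = rho U s₁ g :=
    evalL_injective he
  have hb : ‖(ga, gb)‖ ≤ C * D₂.graphNorm U s₁ s₂ u := by
    refine hn.trans (mul_le_mul_of_nonneg_left ?_ hC)
    change max ‖g‖ ‖k‖ ≤ sobolevNorm U s₁ u + sobolevNorm U s₂ (D₂.onDist U u)
    rw [← hgn, ← hkn]
    exact max_le_add_of_nonneg (norm_nonneg g) (norm_nonneg k)
  exact ⟨_, ga.2, _, gb.2, by rw [← hg, he'], (sobolevNorm_rho_le U _ _).trans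
    ((le_max_left _ _).trans hb), (sobolevNorm_rho_le U _ _).trans ((le_max_right _ _).trans hb)⟩

/-- The open mapping theorem bounds a decomposition of closed elements into an image of `D₁` and an
element of `H₂`. For an exact element the second component is zero by directness, so the first one
is a bounded potential. -/
theorem IsHilbertScale.exists_bounded_potential (hF₁ : IsClosedScale F₁)
    (hF₂ : IsClosedScale F₂) (q t : ℝ) (hqt : q ≤ t + α₁) :
    ∃ C : ℝ, 0 ≤ C ∧ ∀ b ∈ F₁ q, D₁.onDist U b ∈ F₂ t →
      ∃ b' ∈ F₁ (t + α₁), D₁.onDist U b' = D₁.onDist U b ∧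
        sobolevNorm U (t + α₁) b' ≤ C * sobolevNorm U t (D₁.onDist U b) := by
  obtain ⟨H₂, H₃, hfin, HH⟩ := h.exists_shift
  have := hF₁.completeSpace_params (t + α₁)
  have := hF₂.completeSpace_params t
  let A : params F₂ t →ₗ[ℝ] (𝓓(U, ℝ) → X₃) :=
    evalL U X₃ ∘ₗ D₂.onDist U ∘ₗ rho U t ∘ₗ (params F₂ t).subtype
  have hA : Continuous A := (D₂.continuous_evalL_onDist_rho U t).comp continuous_subtype_val
  -- Coordinates give the finite-dimensional space `H₂` a norm.
  let eH : H₂ ≃ₗ[ℝ] (Fin (Module.finrank ℝ H₂) → ℝ) := (Module.finBasis ℝ H₂).equivFun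
  let LH : (Fin (Module.finrank ℝ H₂) → ℝ) →ₗ[ℝ] (𝓓(U, ℝ) → X₂) :=
    evalL U X₂ ∘ₗ H₂.subtype ∘ₗ eH.symm.toLinearMap
  let L : (params F₁ (t + α₁) × (Fin (Module.finrank ℝ H₂) → ℝ)) →ₗ[ℝ] (𝓓(U, ℝ) → X₂) :=
    (evalL U X₂ ∘ₗ D₁.onDist U ∘ₗ rho U (t + α₁) ∘ₗ (params F₁ (t + α₁)).subtype) ∘ₗ
      LinearMap.fst ℝ _ _ + LH ∘ₗ LinearMap.snd ℝ _ _
  let M : params F₂ t →ₗ[ℝ] (𝓓(U, ℝ) → X₂) := evalL U X₂ ∘ₗ rho U t ∘ₗ (params F₂ t).subtype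
  have hL : Continuous L :=
    ((D₁.continuous_evalL_onDist_rho U (t + α₁)).comp
        (continuous_subtype_val.comp continuous_fst)).add
      (LH.continuous_of_finiteDimensional.comp continuous_snd)
  have hM : Continuous M := (continuous_evalL_rho U t).comp continuous_subtype_val
  obtain ⟨C, hC, H⟩ := exists_lift_norm_le_of_eq L M A 0 hL hM hA continuous_const (by
    intro g hg
    have hg' : D₂.onDist U (rho U t g) = 0 := evalL_injective (hg.trans (map_zero _).symm)
    have hu : rho U t g ∈ F₂ t ⊓ LinearMap.ker (D₂.onDist U) := ⟨g.2, hg'⟩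
    rw [(HH t).1.1] at hu
    obtain ⟨_, ⟨b, hb, rfl⟩, k, hk, he⟩ := Submodule.mem_sup.1 hu
    obtain ⟨gb, hgb, -⟩ := hF₁.exists_params hb
    refine ⟨(gb, eH ⟨k, hk⟩), ?_⟩
    change evalL U X₂ (D₁.onDist U (rho U (t + α₁) gb)) +
      evalL U X₂ (eH.symm (eH ⟨k, hk⟩) : H₂) = evalL U X₂ (rho U t g)
    rw [LinearEquiv.symm_apply_apply, hgb, ← map_add, he])
  refine ⟨C, hC, fun b hb hDb => ?_⟩
  obtain ⟨b₀, hb₀, hbb⟩ := h.exists_regular_potential hF₁.anti hb hDb hqt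
  obtain ⟨g, hg, hgn⟩ := hF₂.exists_params hDb
  obtain ⟨⟨gb, x⟩, he, hn⟩ := H g (by
    change evalL U X₃ (D₂.onDist U (rho U t g)) = 0
    rw [hg, ← hbb, (h.onDist_mem hb₀).2, map_zero])
  have he' : D₁.onDist U (rho U (t + α₁) gb) + (eH.symm x : H₂) = D₁.onDist U b := by
    rw [← hg]
    apply evalL_injective
    rw [map_add]
    exact he
  have hgb : rho U (t + α₁) gb ∈ F₁ (t + α₁) := gb.2
  have hd : b₀ - rho U (t + α₁) gb ∈ F₁ (t + α₁) := Submodule.sub_mem _ hb₀ hgb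
  have hm : D₁.onDist U (b₀ - rho U (t + α₁) gb) ∈ (F₁ (t + α₁)).map (D₁.onDist U) :=
    Submodule.mem_map_of_mem hd
  rw [map_sub, hbb, ← he', add_sub_cancel_left] at hm
  have hx : ((eH.symm x : H₂) : 𝓓'(U, X₂)) = 0 :=
    Submodule.disjoint_def.1 (HH t).1.2 _ hm (eH.symm x).2
  rw [hx, add_zero] at he'
  have h0 : sobolevNorm U (t + α₁) (rho U (t + α₁) (gb : VTwo n X₁)) ≤ ‖gb‖ :=
    sobolevNorm_rho_le U _ _
  have h1 : ‖gb‖ ≤ ‖(gb, x)‖ := norm_fst_le (gb, x)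
  rw [hgn] at hn
  exact ⟨rho U (t + α₁) gb, hgb, he', h0.trans (h1.trans hn)⟩

end Basic
end Complex

/-! ### Seminorm properties of Sobolev and graph norms. -/

section Norms

variable {n α : ℕ} {U : Opens (Euc n)} {X Y : Type*} [NormedAddCommGroup X]
  [InnerProductSpace ℝ X] [FiniteDimensional ℝ X] [NormedAddCommGroup Y] [InnerProductSpace ℝ Y]
  [FiniteDimensional ℝ Y]

theorem sobolevNorm_neg {s : ℝ} {u : 𝓓'(U, X)} (hu : u ∈ sobolev X U s) :
    sobolevNorm U s (-u) = sobolevNorm U s u := by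
  have h : ∀ v ∈ sobolev X U s, sobolevNorm U s (-v) ≤ sobolevNorm U s v := by
    intro v hv
    have := sobolevNorm_smul_le hv (-1)
    rwa [neg_one_smul, abs_neg, abs_one, one_mul] at this
  refine le_antisymm (h u hu) ?_
  have := h (-u) (neg_mem hu)
  rwa [neg_neg] at this

theorem sobolevNorm_sub_le {s : ℝ} {u v : 𝓓'(U, X)}
    (hu : u ∈ sobolev X U s) (hv : v ∈ sobolev X U s) :
    sobolevNorm U s (u - v) ≤ sobolevNorm U s u + sobolevNorm U s v := by
  rw [sub_eq_add_neg, ← sobolevNorm_neg hv]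
  exact sobolevNorm_add_le hu (neg_mem hv)

theorem sobolevNorm_sub_comm {s : ℝ} {u v : 𝓓'(U, X)}
    (hu : u ∈ sobolev X U s) (hv : v ∈ sobolev X U s) :
    sobolevNorm U s (u - v) = sobolevNorm U s (v - u) := by
  rw [← sobolevNorm_neg (sub_mem hu hv), neg_sub]

theorem DiffOp.graphNorm_nonneg (D : DiffOp n α X Y) (s₁ s₂ : ℝ) (u : 𝓓'(U, X)) :
    0 ≤ D.graphNorm U s₁ s₂ u :=
  add_nonneg (sobolevNorm_nonneg _ _ _) (sobolevNorm_nonneg _ _ _)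

theorem DiffOp.graphNorm_zero (D : DiffOp n α X Y) (s₁ s₂ : ℝ) :
    D.graphNorm U s₁ s₂ (0 : 𝓓'(U, X)) = 0 := by
  rw [DiffOp.graphNorm, map_zero, sobolevNorm_zero, sobolevNorm_zero, add_zero]

theorem DiffOp.graphNorm_add_le (D : DiffOp n α X Y) {s₁ s₂ : ℝ} {u v : 𝓓'(U, X)}
    (hu : u ∈ D.space U s₁ s₂) (hv : v ∈ D.space U s₁ s₂) :
    D.graphNorm U s₁ s₂ (u + v) ≤ D.graphNorm U s₁ s₂ u + D.graphNorm U s₁ s₂ v := by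
  have h1 := sobolevNorm_add_le hu.1 hv.1
  have h2 := sobolevNorm_add_le (s := s₂) (u := D.onDist U u) (v := D.onDist U v) hu.2 hv.2
  simp only [DiffOp.graphNorm, map_add]
  linarith

theorem DiffOp.graphNorm_smul_le (D : DiffOp n α X Y) {s₁ s₂ : ℝ} {u : 𝓓'(U, X)}
    (hu : u ∈ D.space U s₁ s₂) (c : ℝ) :
    D.graphNorm U s₁ s₂ (c • u) ≤ |c| * D.graphNorm U s₁ s₂ u := by
  have h1 := sobolevNorm_smul_le hu.1 c
  have h2 := sobolevNorm_smul_le (s := s₂) (u := D.onDist U u) hu.2 c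
  simp only [DiffOp.graphNorm, map_smul]
  linarith

theorem pair_ext {w w' : 𝓓'(U, X)} (h : ∀ Φ : Idx X → 𝓓(U, ℝ), pair w Φ = pair w' Φ) :
    w = w' := by
  have hs : ∀ (w : 𝓓'(U, X)) i φ, pair w (Pi.single i φ) =
      component (stdOrthonormalBasis ℝ X i) w φ := by
    intro w i φ
    rw [pair, Finset.sum_eq_single i]
    · rw [Pi.single_eq_same]
    · intro j _ hj
      rw [Pi.single_eq_of_ne hj, map_zero]
    · simp
  rw [← vec_component w, ← vec_component w']
  congr 1
  ext1 i
  ext φ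
  rw [← hs, ← hs, h]

end Norms

/-! ### Regular approximation in the kernel, and boundedness of the pairing. -/

section Duality

variable {n α₁ α₂ α₃ : ℕ} {U U' : Opens (Euc n)} {X₁ X₂ X₃ X₄ : Type*}
  [NormedAddCommGroup X₁] [InnerProductSpace ℝ X₁] [FiniteDimensional ℝ X₁]
  [NormedAddCommGroup X₂] [InnerProductSpace ℝ X₂] [FiniteDimensional ℝ X₂]
  [NormedAddCommGroup X₃] [InnerProductSpace ℝ X₃] [FiniteDimensional ℝ X₃]
  [NormedAddCommGroup X₄] [InnerProductSpace ℝ X₄] [FiniteDimensional ℝ X₄]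
  {F₁ : ℝ → Submodule ℝ 𝓓'(U, X₁)} {F₂ : ℝ → Submodule ℝ 𝓓'(U, X₂)}
  {F₃ : ℝ → Submodule ℝ 𝓓'(U, X₃)} {G₁ : ℝ → Submodule ℝ 𝓓'(U', X₁)}
  {G₂ : ℝ → Submodule ℝ 𝓓'(U', X₂)}
  {D₁ : DiffOp n α₁ X₁ X₂} {D₂ : DiffOp n α₂ X₂ X₃} {D₃ : DiffOp n α₃ X₃ X₄}
  (h : IsHilbertScale α₁ α₂ (D₁.onDist U) (D₂.onDist U) (D₃.onDist U) F₁ F₂ F₃)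
  (hF₁ : IsDualScale F₁ G₁) (hF₂ : IsDualScale F₂ G₂) (hF₃ : IsClosedScale F₃)
  (hreg : ∀ q, ∀ u ∈ F₁ q, D₁.onDist U u = 0 → ∀ ε > 0, ∃ Φ : Idx X₁ → 𝓓(U', ℝ),
    sobolevNorm U q (smoothField U Φ - u) ≤ ε ∧
      sobolevNorm U (q - α₁ + 1) (smoothField U (D₁.act Φ)) ≤ ε)

include h hF₁ hF₂

-- A smooth approximation `Φ` has `D₁ Φ` small in order `q - α₁ + 1`, so `D₁ Φ` has a small
-- potential of order `q + 1`. Subtracting that potential from `Φ` restores the equation.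
include hreg in
theorem exists_kernel_approx_succ {q : ℝ} {u : 𝓓'(U, X₁)} (hu : u ∈ F₁ q)
    (hDu : D₁.onDist U u = 0) {ε : ℝ} (hε : 0 < ε) :
    ∃ v ∈ F₁ (q + 1), D₁.onDist U v = 0 ∧ sobolevNorm U q (v - u) ≤ ε := by
  have hq : q - α₁ + 1 + α₁ = q + 1 := by ring
  obtain ⟨C, hC, H⟩ := h.exists_bounded_potential hF₁.toIsClosedScale hF₂.toIsClosedScale
    (q + 1) (q - α₁ + 1) hq.ge
  have hε' : 0 < ε / (1 + C) := by positivity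
  obtain ⟨Φ, hΦ, hDΦ⟩ := hreg q u hu hDu _ hε'
  rw [← D₁.onDist_smoothField] at hDΦ
  have hsm := hF₁.smooth_mem (q + 1) Φ
  obtain ⟨b, hb, hDb, hbn⟩ := H _ hsm (h.onDist_mem (by rw [hq]; exact hsm)).1
  rw [hq] at hb hbn
  refine ⟨smoothField U Φ - b, Submodule.sub_mem _ hsm hb, ?_, ?_⟩
  · rw [map_sub, hDb, sub_self]
  · have h1 : smoothField U Φ - b - u = (smoothField U Φ - u) - b := by abel
    have hb' := hF₁.le_sobolev _ hb
    rw [h1]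
    have h2 := sobolevNorm_sub_le
      (Submodule.sub_mem _ (smoothField_mem_sobolev U q Φ) (hF₁.le_sobolev _ hu))
      (sobolev_anti (by linarith : q ≤ q + 1) hb')
    have h3 := sobolevNorm_anti (by linarith : q ≤ q + 1) hb'
    have h4 : (1 + C) * (ε / (1 + C)) = ε := by field_simp
    have h5 := mul_le_mul_of_nonneg_left hDΦ hC
    linarith

-- Orders are gained one by one, with half of the tolerance kept for the last step. The error stays
-- measured in the original order.
include hreg in
theorem exists_kernel_approx {q r : ℝ} {u : 𝓓'(U, X₁)} (hu : u ∈ F₁ q)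
    (hDu : D₁.onDist U u = 0) {ε : ℝ} (hε : 0 < ε) :
    ∃ v ∈ F₁ r, D₁.onDist U v = 0 ∧ sobolevNorm U q (v - u) ≤ ε := by
  have key : ∀ (k : ℕ) (ε : ℝ), 0 < ε →
      ∃ v ∈ F₁ (q + k), D₁.onDist U v = 0 ∧ sobolevNorm U q (v - u) ≤ ε := by
    intro k
    induction k with
    | zero =>
      intro ε hε
      refine ⟨u, by simpa using hu, hDu, ?_⟩
      rw [sub_self, sobolevNorm_zero]
      exact hε.le
    | succ k ih =>
      intro ε hε
      obtain ⟨v, hv, hDv, hvu⟩ := ih (ε / 2) (half_pos hε)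
      obtain ⟨w, hw, hDw, hwv⟩ := exists_kernel_approx_succ h hF₁ hF₂ hreg hv hDv (half_pos hε)
      have hqk : q ≤ q + k := by linarith [k.cast_nonneg (α := ℝ)]
      have hwk := hF₁.anti (by linarith : q + k ≤ q + k + 1) hw
      refine ⟨w, by rwa [Nat.cast_succ, ← add_assoc], hDw, ?_⟩
      have h1 : w - u = (w - v) + (v - u) := by abel
      have h2 := hF₁.le_sobolev _ (Submodule.sub_mem _ hwk hv)
      have h3 := sobolevNorm_add_le (sobolev_anti hqk h2)
        (hF₁.le_sobolev q (Submodule.sub_mem _ (hF₁.anti hqk hv) hu))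
      have h4 := sobolevNorm_anti hqk h2
      rw [h1]
      linarith
  obtain ⟨k, hk⟩ := exists_nat_ge (r - q)
  obtain ⟨v, hv, hDv, hvu⟩ := key k ε hε
  exact ⟨v, hF₁.anti (by linarith) hv, hDv, hvu⟩

variable {s₁ s₂ : ℝ} (hs : s₁ ≤ s₂ + α₂)
include hs

-- In `Φ = a + D₁ b` the operator has to be moved from the potential onto `w`. This needs smooth
-- fields `Φb` that approach `b` in order `s₁ + α₁` while `D₁ Φb` approaches `D₁ b` in the higher
-- order `s₂ + α₂`; regular potentials and kernel approximation provide them.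
include hF₃ hreg in
theorem exists_abs_pair_le : ∃ K : ℝ, 0 ≤ K ∧ ∀ w ∈ G₂ (-(s₂ + α₂)),
    D₁.adjoint.onDist U' w ∈ G₁ (-(s₁ + α₁)) → ∀ Φ : Idx X₂ → 𝓓(U', ℝ),
      |pair w Φ| ≤ K * D₁.adjoint.graphNorm U' (-(s₂ + α₂)) (-(s₁ + α₁)) w *
        D₂.graphNorm U s₁ s₂ (smoothField U Φ) := by
  set t := s₂ + α₂ with ht
  obtain ⟨C, hC, Hdec⟩ := h.exists_bounded_decomposition hF₁.toIsClosedScale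
    hF₂.toIsClosedScale hF₃ hs
  obtain ⟨CD, hCD, HD⟩ := D₁.exists_sobolevNorm_onDist_le U (t + α₁)
  rw [add_sub_cancel_right] at HD
  refine ⟨C, hC, fun w hw hDw Φ => ?_⟩
  have hts : s₁ + α₁ ≤ t + α₁ := by linarith
  have hΦt := hF₂.smooth_mem t Φ
  have hΦV : smoothField U Φ ∈ F₂ s₁ ⊓ (F₃ s₂).comap (D₂.onDist U) := by
    rw [h.space_eq hF₂.anti hs]
    exact Submodule.mem_sup_left hΦt
  obtain ⟨a, ha, b, hb, he, han, hbn⟩ := Hdec _ hΦV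
  have hDb : D₁.onDist U b ∈ F₂ t := by
    have : D₁.onDist U b = smoothField U Φ - a := by rw [he, add_sub_cancel_left]
    rw [this]
    exact Submodule.sub_mem _ hΦt ha
  obtain ⟨b', hb', hbb'⟩ := h.exists_regular_potential hF₁.anti hb hDb hts
  set P := sobolevNorm U' (-t) w
  set Q := sobolevNorm U' (-(s₁ + α₁)) (D₁.adjoint.onDist U' w)
  set N := D₂.graphNorm U s₁ s₂ (smoothField U Φ)
  have hP : 0 ≤ P := sobolevNorm_nonneg _ _ _
  have hQ : 0 ≤ Q := sobolevNorm_nonneg _ _ _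
  have key : ∀ ε > 0, |pair w Φ| ≤ C * (P + Q) * N + ε * (P * (2 + CD) + 2 * Q) := by
    intro ε hε
    -- `b' + c` is within `ε` of `b` in the low order, has the same image under `D₁`, and is of
    -- order `t + α₁`.
    obtain ⟨c, hc, hDc, hcn⟩ := exists_kernel_approx h hF₁ hF₂ hreg (r := t + α₁)
      (Submodule.sub_mem _ hb (hF₁.anti hts hb')) (by rw [map_sub, hbb', sub_self]) hε
    have hbc : b' + c ∈ F₁ (t + α₁) := Submodule.add_mem _ hb' hc
    obtain ⟨Φa, hΦa⟩ := hF₂.dense t a ha ε hε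
    obtain ⟨Φb, hΦb⟩ := hF₁.dense (t + α₁) (b' + c) hbc ε hε
    have hsa := smoothField_mem_sobolev U t Φa
    have hsb := smoothField_mem_sobolev U (t + α₁) Φb
    have ha' := hF₂.le_sobolev t ha
    have hbc' := hF₁.le_sobolev _ hbc
    have hb0 := hF₁.le_sobolev _ hb
    have h1 : smoothField U (Φ - Φa - D₁.act Φb) =
        (a - smoothField U Φa) + D₁.onDist U (b' + c - smoothField U Φb) := by
      rw [map_sub, map_sub, ← D₁.onDist_smoothField, he, map_sub, map_add, hbb', hDc]
      abel
    have h2 : sobolevNorm U t (smoothField U (Φ - Φa - D₁.act Φb)) ≤ ε + CD * ε := by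
      rw [h1]
      have hm := h.onDist_mem (Submodule.sub_mem _ hbc (hF₁.smooth_mem (t + α₁) Φb))
      refine (sobolevNorm_add_le (Submodule.sub_mem _ ha' hsa)
        (hF₂.le_sobolev _ hm.1)).trans (add_le_add ?_ ?_)
      · rwa [sobolevNorm_sub_comm ha' hsa]
      · refine (HD _ (Submodule.sub_mem _ hbc' hsb)).trans (mul_le_mul_of_nonneg_left ?_ hCD)
        rwa [sobolevNorm_sub_comm hbc' hsb]
    have h3 : sobolevNorm U t (smoothField U Φa) ≤ C * N + ε := by
      have := sobolevNorm_add_le ha' (Submodule.sub_mem _ hsa ha')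
      rw [add_sub_cancel] at this
      linarith
    have h4 : sobolevNorm U (s₁ + α₁) (smoothField U Φb) ≤ C * N + 2 * ε := by
      have e : smoothField U Φb =
          b + ((c - (b - b')) + (smoothField U Φb - (b' + c))) := by abel
      have m1 := Submodule.sub_mem _ (sobolev_anti hts (hF₁.le_sobolev _ hc))
        (Submodule.sub_mem _ hb0 (sobolev_anti hts (hF₁.le_sobolev _ hb')))
      have m2 := Submodule.sub_mem _ hsb hbc'
      have i1 := sobolevNorm_add_le hb0 (Submodule.add_mem _ m1 (sobolev_anti hts m2))
      have i2 := sobolevNorm_add_le m1 (sobolev_anti hts m2)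
      have i3 := sobolevNorm_anti hts m2
      rw [← e] at i1
      linarith
    -- The first term is small in order `t`; the second and third are controlled by the norms of `w`
    -- and of `D₁* w` respectively.
    have h5 : pair w Φ = pair w (Φ - Φa - D₁.act Φb) + pair w Φa +
        pair (D₁.adjoint.onDist U' w) Φb := by
      rw [D₁.pair_adjoint]
      change pairL w Φ = pairL w _ + pairL w _ + pairL w _
      rw [← map_add, ← map_add]
      congr 1
      abel
    have p1 := (hF₂.pair_le t w hw (Φ - Φa - D₁.act Φb)).trans
      (mul_le_mul_of_nonneg_left h2 hP)
    have p2 := (hF₂.pair_le t w hw Φa).trans (mul_le_mul_of_nonneg_left h3 hP)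
    have p3 := (hF₁.pair_le (s₁ + α₁) _ hDw Φb).trans (mul_le_mul_of_nonneg_left h4 hQ)
    rw [h5]
    refine (abs_add_three _ _ _).trans ?_
    calc _ ≤ P * (ε + CD * ε) + P * (C * N + ε) + Q * (C * N + 2 * ε) := by
          exact add_le_add (add_le_add p1 p2) p3
      _ = _ := by ring
  set R := P * (2 + CD) + 2 * Q
  have hR : 0 ≤ R := by positivity
  change |pair w Φ| ≤ C * (P + Q) * N
  refine le_of_forall_pos_le_add fun δ hδ => (key (δ / (1 + R)) (by positivity)).trans ?_
  have h6 : (δ / (1 + R)) * (1 + R) = δ := by field_simp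
  have h7 : 0 < δ / (1 + R) := by positivity
  nlinarith

/-- Both summands of the decomposition map continuously into the graph space. For the second one
only the first term of the graph norm survives, as `D₂ D₁` vanishes. -/
theorem exists_graphNorm_le : ∃ K : ℝ, 0 ≤ K ∧
    (∀ x ∈ F₂ (s₂ + α₂), D₂.graphNorm U s₁ s₂ x ≤ K * sobolevNorm U (s₂ + α₂) x) ∧
    ∀ y ∈ F₁ (s₁ + α₁),
      D₂.graphNorm U s₁ s₂ (D₁.onDist U y) ≤ K * sobolevNorm U (s₁ + α₁) y := by
  obtain ⟨C₂, hC₂, H₂⟩ := D₂.exists_sobolevNorm_onDist_le U (s₂ + α₂)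
  obtain ⟨C₁, hC₁, H₁⟩ := D₁.exists_sobolevNorm_onDist_le U (s₁ + α₁)
  rw [add_sub_cancel_right] at H₁ H₂
  refine ⟨1 + C₂ + C₁, by positivity, fun x hx => ?_, fun y hy => ?_⟩
  · have h1 := sobolevNorm_anti hs (hF₂.le_sobolev _ hx)
    have h2 := H₂ x (hF₂.le_sobolev _ hx)
    have h3 := mul_nonneg hC₁ (sobolevNorm_nonneg U (s₂ + α₂) x)
    rw [DiffOp.graphNorm]
    linarith
  · have h1 := H₁ y (hF₁.le_sobolev _ hy)
    have h2 := mul_nonneg hC₂ (sobolevNorm_nonneg U (s₁ + α₁) y)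
    have h3 := sobolevNorm_nonneg U (s₁ + α₁) y
    rw [DiffOp.graphNorm, (h.onDist_mem hy).2, sobolevNorm_zero]
    linarith

-- Each summand of the regular decomposition is approximated in its own norm, which dominates the
-- graph norm.
include hF₃ in
theorem exists_graphNorm_smoothField_sub_le {u : 𝓓'(U, X₂)}
    (hu : u ∈ F₂ s₁ ⊓ (F₃ s₂).comap (D₂.onDist U)) {ε : ℝ} (hε : 0 < ε) :
    ∃ Φ : Idx X₂ → 𝓓(U', ℝ), D₂.graphNorm U s₁ s₂ (smoothField U Φ - u) ≤ ε := by
  obtain ⟨K, hK, Ha, Hb⟩ := exists_graphNorm_le h hF₁ hF₂ hs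
  have hV := h.space_eq hF₂.anti hs
  have hVs : F₂ s₁ ⊓ (F₃ s₂).comap (D₂.onDist U) ≤ D₂.space U s₁ s₂ :=
    inf_le_inf (hF₂.le_sobolev _) (Submodule.comap_mono (hF₃.le_sobolev _))
  rw [hV] at hu hVs
  obtain ⟨a, ha, _, ⟨b, hb, rfl⟩, rfl⟩ := Submodule.mem_sup.1 hu
  have hε' : 0 < ε / (2 * (1 + K)) := by positivity
  obtain ⟨Φa, hΦa⟩ := hF₂.dense _ a ha _ hε'
  obtain ⟨Φb, hΦb⟩ := hF₁.dense _ b hb _ hε'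
  have hma := Submodule.sub_mem _ (hF₂.smooth_mem (s₂ + α₂) Φa) ha
  have hmb := Submodule.sub_mem _ (hF₁.smooth_mem (s₁ + α₁) Φb) hb
  refine ⟨Φa + D₁.act Φb, ?_⟩
  have e : smoothField U (Φa + D₁.act Φb) - (a + D₁.onDist U b) =
      (smoothField U Φa - a) + D₁.onDist U (smoothField U Φb - b) := by
    rw [map_add, ← D₁.onDist_smoothField, map_sub]
    abel
  rw [e]
  have h1 := D₂.graphNorm_add_le (hVs (Submodule.mem_sup_left hma))
    (hVs (Submodule.mem_sup_right (Submodule.mem_map_of_mem hmb)))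
  have h2 := (Ha _ hma).trans (mul_le_mul_of_nonneg_left hΦa hK)
  have h3 := (Hb _ hmb).trans (mul_le_mul_of_nonneg_left hΦb hK)
  have h4 : 2 * (1 + K) * (ε / (2 * (1 + K))) = ε := by field_simp
  nlinarith

end Duality

/-! ### The dual norm of a seminormed space. -/

section DualNorm

variable {E : Type*} [AddCommGroup E] [Module ℝ E] {V : Submodule ℝ E} {N : E → ℝ}

theorem dualNorm_nonneg (l : Module.Dual ℝ V) : 0 ≤ dualNorm V N l :=
  Real.sInf_nonneg fun _ h => h.1

theorem dualNorm_le {l : Module.Dual ℝ V} {C : ℝ} (hC : 0 ≤ C) (h : ∀ v : V, |l v| ≤ C * N v) :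
    dualNorm V N l ≤ C :=
  csInf_le ⟨0, fun _ h => h.1⟩ ⟨hC, h⟩

theorem abs_apply_le_dualNorm (hN : ∀ v ∈ V, 0 ≤ N v) {l : Module.Dual ℝ V}
    (hl : l ∈ boundedDual V N) (v : V) : |l v| ≤ dualNorm V N l * N v := by
  obtain ⟨C, hC⟩ := hl
  have hne : {C : ℝ | 0 ≤ C ∧ ∀ v : V, |l v| ≤ C * N v}.Nonempty :=
    ⟨|C|, abs_nonneg C, fun v => (hC v).trans
      (mul_le_mul_of_nonneg_right (le_abs_self C) (hN v v.2))⟩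
  rcases (hN v v.2).eq_or_lt with h0 | h0
  · have := hC v
    rw [← h0, mul_zero] at this ⊢
    exact this
  · rw [← div_le_iff₀ h0]
    exact le_csInf hne fun C' hC' => (div_le_iff₀ h0).2 (hC'.2 v)

end DualNorm

/-! ### An abstract criterion for duality through smooth fields. -/

section Abstract

variable {n : ℕ} {U U' : Opens (Euc n)} {X : Type*} [NormedAddCommGroup X]
  [InnerProductSpace ℝ X] [FiniteDimensional ℝ X]

/-- A seminormed space `V` of distributions in which smooth fields are dense has the dual `W` if
the pairing with elements of `W` is bounded and represents all bounded functionals on smooth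
fields. -/
theorem isDual_of_pairing {V : Submodule ℝ 𝓓'(U, X)} {N : 𝓓'(U, X) → ℝ}
    {W : Submodule ℝ 𝓓'(U', X)} {M : 𝓓'(U', X) → ℝ}
    (N_nonneg : ∀ v, 0 ≤ N v) (N_zero : N 0 = 0)
    (N_add : ∀ u ∈ V, ∀ v ∈ V, N (u + v) ≤ N u + N v)
    (N_smul : ∀ u ∈ V, ∀ c : ℝ, N (c • u) ≤ |c| * N u)
    (M_nonneg : ∀ w, 0 ≤ M w) (M_zero : M 0 = 0)
    (hsm : ∀ Φ : Idx X → 𝓓(U', ℝ), smoothField U Φ ∈ V)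
    (hdense : ∀ v ∈ V, ∀ ε > 0, ∃ Φ : Idx X → 𝓓(U', ℝ), N (smoothField U Φ - v) ≤ ε)
    {K : ℝ} (hK : 0 ≤ K)
    (hpair : ∀ w ∈ W, ∀ Φ : Idx X → 𝓓(U', ℝ), |pair w Φ| ≤ K * M w * N (smoothField U Φ))
    {K' : ℝ} (hK' : 0 ≤ K')
    (hrep : ∀ C, 0 ≤ C → ∀ L : (Idx X → 𝓓(U', ℝ)) →ₗ[ℝ] ℝ,
      (∀ Φ, L Φ ≤ C * N (smoothField U Φ)) → ∃ w ∈ W, M w ≤ K' * C ∧ ∀ Φ, pair w Φ = L Φ) :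
    IsDual V N W M := by
  let S : (Idx X → 𝓓(U', ℝ)) →ₗ[ℝ] V := (smoothField U).codRestrict V hsm
  have N_hom : ∀ c : ℝ, 0 < c → ∀ v : V, N (c • (v : 𝓓'(U, X))) = c * N v := by
    intro c hc v
    refine le_antisymm ((N_smul v v.2 c).trans_eq (by rw [abs_of_pos hc])) ?_
    have h := N_smul (c • (v : 𝓓'(U, X))) (V.smul_mem c v.2) c⁻¹
    rw [smul_smul, inv_mul_cancel₀ hc.ne', one_smul, abs_of_pos (inv_pos.2 hc)] at h
    rwa [le_inv_mul_iff₀ hc] at h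
  have hbound := fun l : boundedDual V N =>
    abs_apply_le_dualNorm (fun v _ => N_nonneg v) l.2
  have hex : ∀ l : boundedDual V N, ∃ w : W, M w ≤ K' * dualNorm V N (l : Module.Dual ℝ V) ∧
      ∀ Φ, pair (w : 𝓓'(U', X)) Φ = (l : Module.Dual ℝ V) (S Φ) := by
    intro l
    obtain ⟨w, hw, hM, h⟩ := hrep _ (dualNorm_nonneg (N := N) (l : Module.Dual ℝ V))
      ((l : Module.Dual ℝ V) ∘ₗ S) fun Φ => (le_abs_self _).trans (hbound l (S Φ))
    exact ⟨⟨w, hw⟩, hM, h⟩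
  choose T hTM hT using hex
  let T' : boundedDual V N →ₗ[ℝ] W :=
    { toFun := T
      map_add' := fun l m => by
        refine Subtype.ext (pair_ext fun Φ => ?_)
        rw [Submodule.coe_add, pair_add_left, hT, hT, hT]
        rfl
      map_smul' := fun c l => by
        refine Subtype.ext (pair_ext fun Φ => ?_)
        rw [Submodule.coe_smul, pair_smul_left, hT, hT]
        rfl }
  -- The estimate of the pairing passes from smooth fields to all of `V` by density. It yields both
  -- injectivity and the lower bound for the norm of the image.
  have hle : ∀ l : boundedDual V N,
      ∀ v : V, |(l : Module.Dual ℝ V) v| ≤ K * M (T l) * N v := by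
    intro l v
    have hc : 0 ≤ K * M (T l) := mul_nonneg hK (M_nonneg _)
    set c := K * M (T l)
    set d := dualNorm V N (l : Module.Dual ℝ V)
    have hd : 0 ≤ d := dualNorm_nonneg _
    refine le_of_forall_pos_le_add fun δ hδ => ?_
    have hε : 0 < δ / (1 + c + d) := by positivity
    obtain ⟨Φ, hΦ⟩ := hdense v v.2 _ hε
    have h1 : (l : Module.Dual ℝ V) (S Φ) =
        (l : Module.Dual ℝ V) v + (l : Module.Dual ℝ V) (S Φ - v) := by
      rw [← map_add, add_sub_cancel]
    have h2 : |(l : Module.Dual ℝ V) (S Φ)| ≤ c * N (smoothField U Φ) := by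
      rw [← hT]
      exact hpair _ (T l).2 Φ
    have h3 : |(l : Module.Dual ℝ V) (S Φ - v)| ≤ d * N (smoothField U Φ - v) :=
      hbound l (S Φ - v)
    have h4 : N (smoothField U Φ) ≤ N v + N (smoothField U Φ - v) := by
      have := N_add v v.2 _ (V.sub_mem (hsm Φ) v.2)
      rwa [add_sub_cancel] at this
    have h5 : |(l : Module.Dual ℝ V) v| ≤
        |(l : Module.Dual ℝ V) (S Φ)| + |(l : Module.Dual ℝ V) (S Φ - v)| := by
      rw [← add_sub_cancel_right ((l : Module.Dual ℝ V) v) ((l : Module.Dual ℝ V) (S Φ - v)), ← h1]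
      exact abs_sub _ _
    have h6 := mul_le_mul_of_nonneg_left (h4.trans (add_le_add le_rfl hΦ)) hc
    have h7 := mul_le_mul_of_nonneg_left hΦ hd
    have h8 : δ / (1 + c + d) * (1 + c + d) = δ := by field_simp
    nlinarith
  have hbij : Function.Bijective T' := by
    constructor
    · rw [injective_iff_map_eq_zero]
      intro l hl
      refine Subtype.ext (LinearMap.ext fun v => ?_)
      have := hle l v
      rw [show T l = 0 from hl, Submodule.coe_zero, M_zero, mul_zero, zero_mul] at this
      exact abs_nonpos_iff.1 this
    -- The pairing with `w` on smooth fields is dominated by a multiple of `N` and extends to `V` by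
    -- Hahn–Banach.
    · intro w
      have hc : 0 ≤ K * M w := mul_nonneg hK (M_nonneg _)
      obtain ⟨l, hl, hlN⟩ := exists_extension_of_le_comp (fun v : V => K * M w * N v)
        (fun c h0 v => by
          change K * M w * N (c • (v : 𝓓'(U, X))) = _
          rw [N_hom c h0 v]
          ring)
        (fun u v => by
          rw [← mul_add]
          exact mul_le_mul_of_nonneg_left (N_add u u.2 v v.2) hc)
        (by
          change K * M w * N 0 = 0
          rw [N_zero, mul_zero])
        S (pairL (w : 𝓓'(U', X))) fun Φ => (le_abs_self _).trans (hpair w w.2 Φ)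
      have hlb : l ∈ boundedDual V N := by
        refine ⟨K * M w, fun v => abs_le.2 ⟨?_, hlN v⟩⟩
        have h1 := hlN (-v)
        have h2 := N_smul v v.2 (-1)
        rw [map_neg] at h1
        rw [neg_one_smul, abs_neg, abs_one, one_mul] at h2
        have h3 := mul_le_mul_of_nonneg_left h2 hc
        change -l v ≤ K * M w * N (-(v : 𝓓'(U, X))) at h1
        linarith
      refine ⟨⟨l, hlb⟩, Subtype.ext (pair_ext fun Φ => ?_)⟩
      exact (hT ⟨l, hlb⟩ Φ).trans (hl Φ)
  -- `K` and `K'` may vanish; the `+ 1` makes both constants positive.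
  refine ⟨LinearEquiv.ofBijective T' hbij, fun l φ x => ?_, (K + 1)⁻¹, K' + 1, by positivity,
    by positivity, fun l => ⟨?_, ?_⟩⟩
  · refine ⟨smoothDist_eq_smoothField (U := U) φ x ▸ hsm _, ?_⟩
    rw [LinearEquiv.ofBijective_apply, ← pair_smul_eq]
    refine Eq.trans ?_ (hT l _).symm
    congr 1
    exact Subtype.ext (smoothDist_eq_smoothField φ x)
  · rw [inv_mul_le_iff₀ (by positivity)]
    have h1 := dualNorm_le (mul_nonneg hK (M_nonneg (T l))) (hle l)
    have h2 := M_nonneg (T l)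
    change _ ≤ (K + 1) * M (T l)
    linarith
  · have h1 := hTM l
    have h2 := dualNorm_nonneg (N := N) (l : Module.Dual ℝ V)
    change M (T l) ≤ _
    linarith

end Abstract

/-! ### Duality of the graph spaces for abstract dual scales. -/

section Complex

variable {n α₁ α₂ α₃ : ℕ} {U U' : Opens (Euc n)} {X₁ X₂ X₃ X₄ : Type*}
  [NormedAddCommGroup X₁] [InnerProductSpace ℝ X₁] [FiniteDimensional ℝ X₁]
  [NormedAddCommGroup X₂] [InnerProductSpace ℝ X₂] [FiniteDimensional ℝ X₂]
  [NormedAddCommGroup X₃] [InnerProductSpace ℝ X₃] [FiniteDimensional ℝ X₃]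
  [NormedAddCommGroup X₄] [InnerProductSpace ℝ X₄] [FiniteDimensional ℝ X₄]
  {F₁ : ℝ → Submodule ℝ 𝓓'(U, X₁)} {F₂ : ℝ → Submodule ℝ 𝓓'(U, X₂)}
  {F₃ : ℝ → Submodule ℝ 𝓓'(U, X₃)} {G₁ : ℝ → Submodule ℝ 𝓓'(U', X₁)}
  {G₂ : ℝ → Submodule ℝ 𝓓'(U', X₂)}
  {D₁ : DiffOp n α₁ X₁ X₂} {D₂ : DiffOp n α₂ X₂ X₃} {D₃ : DiffOp n α₃ X₃ X₄}

/-- A bounded functional restricted to the two summands of the decomposition is represented in `G₂`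
and in `G₁`. The two representatives are `w` and `D₁* w`, since they agree on test fields. The
converse estimate is `exists_abs_pair_le`. -/
theorem IsHilbertScale.isDual
    (h : IsHilbertScale α₁ α₂ (D₁.onDist U) (D₂.onDist U) (D₃.onDist U) F₁ F₂ F₃)
    (hF₁ : IsDualScale F₁ G₁) (hF₂ : IsDualScale F₂ G₂) (hF₃ : IsClosedScale F₃)
    (hreg : ∀ q, ∀ u ∈ F₁ q, D₁.onDist U u = 0 → ∀ ε > 0, ∃ Φ : Idx X₁ → 𝓓(U', ℝ),
      sobolevNorm U q (smoothField U Φ - u) ≤ ε ∧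
        sobolevNorm U (q - α₁ + 1) (smoothField U (D₁.act Φ)) ≤ ε)
    {s₁ s₂ : ℝ} (hs : s₁ ≤ s₂ + α₂) :
    IsDual (F₂ s₁ ⊓ (F₃ s₂).comap (D₂.onDist U)) (D₂.graphNorm U s₁ s₂)
      (G₂ (-(s₂ + α₂)) ⊓ (G₁ (-(s₁ + α₁))).comap (D₁.adjoint.onDist U'))
      (D₁.adjoint.graphNorm U' (-(s₂ + α₂)) (-(s₁ + α₁))) := by
  obtain ⟨K, hK, hpair⟩ := exists_abs_pair_le h hF₁ hF₂ hF₃ hreg hs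
  obtain ⟨K', hK', Ha, Hb⟩ := exists_graphNorm_le h hF₁ hF₂ hs
  have hV : F₂ s₁ ⊓ (F₃ s₂).comap (D₂.onDist U) ≤ D₂.space U s₁ s₂ :=
    inf_le_inf (hF₂.le_sobolev _) (Submodule.comap_mono (hF₃.le_sobolev _))
  refine isDual_of_pairing (D₂.graphNorm_nonneg _ _) (D₂.graphNorm_zero _ _)
    (fun u hu v hv => D₂.graphNorm_add_le (hV hu) (hV hv))
    (fun u hu c => D₂.graphNorm_smul_le (hV hu) c) (D₁.adjoint.graphNorm_nonneg _ _)
    (D₁.adjoint.graphNorm_zero _ _)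
    (fun Φ => ?_) (fun u hu ε hε => exists_graphNorm_smoothField_sub_le h hF₁ hF₂ hF₃ hs hu hε)
    hK (fun w hw => hpair w hw.1 hw.2) (K' := 2 * K') (by positivity) fun C hC L hL => ?_
  · rw [h.space_eq hF₂.anti hs]
    exact Submodule.mem_sup_left (hF₂.smooth_mem _ Φ)
  · have hCK : 0 ≤ C * K' := mul_nonneg hC hK'
    obtain ⟨w, hw, hwn, hwL⟩ := hF₂.exists_pair_eq (s₂ + α₂) (C * K') hCK L fun Φ => by
      rw [mul_assoc]
      exact (hL Φ).trans (mul_le_mul_of_nonneg_left (Ha _ (hF₂.smooth_mem _ Φ)) hC)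
    let L₁ : (Idx X₁ → 𝓓(U', ℝ)) →ₗ[ℝ] ℝ := L ∘ₗ D₁.act
    obtain ⟨w₁, hw₁, hwn₁, hwL₁⟩ := hF₁.exists_pair_eq (s₁ + α₁) (C * K') hCK L₁ fun Φ => by
      rw [mul_assoc]
      refine (hL (D₁.act Φ)).trans (mul_le_mul_of_nonneg_left ?_ hC)
      rw [← D₁.onDist_smoothField]
      exact Hb _ (hF₁.smooth_mem _ Φ)
    have he : D₁.adjoint.onDist U' w = w₁ := pair_ext fun Φ => by
      rw [D₁.pair_adjoint, hwL, hwL₁]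
      rfl
    refine ⟨w, ⟨hw, ?_⟩, ?_, hwL⟩
    · change D₁.adjoint.onDist U' w ∈ G₁ (-(s₁ + α₁))
      rw [he]
      exact hw₁
    · rw [DiffOp.graphNorm, he]
      linarith

end Complex

/-! ### The two Sobolev scales of a Lipschitz domain are in duality. -/

section LipschitzScales

variable {n : ℕ} {U U' Ω : Opens (Euc n)} {X : Type*} [NormedAddCommGroup X]
  [InnerProductSpace ℝ X] [FiniteDimensional ℝ X]

theorem pair_smoothField_comm (Φ : Idx X → 𝓓(U, ℝ)) (Ψ : Idx X → 𝓓(U', ℝ)) :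
    pair (smoothField U Ψ) Φ = pair (smoothField U' Φ) Ψ := by
  simp only [smoothField_eq, pair_vec, restr_testTempered_apply, mul_comm]

theorem mul_eq_zero_of_tsupport_subset (φ : 𝓓(Ω, ℝ)) {ψ : 𝓓((⊤ : Opens (Euc n)), ℝ)}
    (hψ : tsupport ψ ⊆ (closure (Ω : Set (Euc n)))ᶜ) (x : Euc n) : φ x * ψ x = 0 := by
  by_contra h
  exact hψ (subset_tsupport _ (right_ne_zero_of_mul h))
    (subset_closure (φ.tsupport_subset (subset_tsupport _ (left_ne_zero_of_mul h))))

theorem smoothField_mem_supportedIn (Φ : Idx X → 𝓓(Ω, ℝ)) :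
    smoothField ⊤ Φ ∈ supportedIn X Ω := by
  intro ψ hψ
  rw [smoothField_eq, vec_apply]
  refine Finset.sum_eq_zero fun i _ => ?_
  rw [restr_testTempered_apply]
  simp only [mul_comm (ψ _), mul_eq_zero_of_tsupport_subset _ hψ, integral_zero, zero_smul]

theorem smoothDist_eq_zero {φ : 𝓓((⊤ : Opens (Euc n)), ℝ)}
    (hφ : tsupport φ ⊆ (closure (Ω : Set (Euc n)))ᶜ) (x : X) : smoothDist Ω φ x = 0 := by
  ext ψ
  rw [smoothDist_apply]
  simp only [smul_smul, mul_eq_zero_of_tsupport_subset ψ hφ, zero_smul,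
    integral_zero]
  rfl

theorem isClosedScale_sobolev : IsClosedScale (sobolev X U) where
  le_sobolev _ := le_rfl
  anti h := sobolev_anti h
  isClosed s := by
    convert isClosed_univ (X := VTwo n X)
    exact Set.eq_univ_of_forall fun g => mem_sobolev_iff_exists_rho.2 ⟨g, rfl⟩

theorem isClosedScale_sobolevZero : IsClosedScale (sobolevZero X Ω) where
  le_sobolev _ := inf_le_left
  anti h := inf_le_inf_right _ (sobolev_anti h)
  isClosed s := by
    have h : {g : VTwo n X | rho ⊤ s g ∈ sobolevZero X Ω s} =
        ⋂ (φ : 𝓓((⊤ : Opens (Euc n)), ℝ)) (_ : tsupport φ ⊆ (closure (Ω : Set (Euc n)))ᶜ),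
          {g | rho ⊤ s g φ = 0} := by
      ext g
      simp only [Set.mem_iInter]
      exact ⟨fun h φ hφ => h.2 φ hφ, fun h => ⟨mem_sobolev_iff_exists_rho.2 ⟨g, rfl⟩, h⟩⟩
    rw [h]
    exact isClosed_iInter fun φ => isClosed_iInter fun _ =>
      isClosed_eq (continuous_rho_apply ⊤ s φ) continuous_const

theorem abs_pair_le_besNorm {s : ℝ} {w : 𝓓'(U, X)} (hw : w ∈ sobolev X U s)
    (Φ : Idx X → 𝓓(U, ℝ)) : |pair w Φ| ≤ sobolevNorm U s w * besNorm (-s) Φ := by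
  obtain ⟨g, rfl, hg⟩ := exists_norm_eq_sobolevNorm hw
  rw [← hg]
  exact abs_pair_rho_le s g Φ

/-- With the zero operator, whose kernel is everything, the approximation theorems for kernels
become plain density theorems. -/
theorem DiffOp.onDist_zeroCoeff (U : Opens (Euc n)) (u : 𝓓'(U, X)) :
    (⟨fun _ _ => 0⟩ : DiffOp n 0 X X).onDist U u = 0 := by
  rw [DiffOp.onDist, LinearMap.sum_apply]
  simp only [LinearMap.sum_apply]
  refine Finset.sum_eq_zero fun k _ => Finset.sum_eq_zero fun I _ => ?_
  ext φ
  rfl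

theorem besNorm_nonneg (s : ℝ) (Φ : Idx X → 𝓓(U, ℝ)) : 0 ≤ besNorm s Φ :=
  norm_nonneg _

/-- The point is the quotient norm of `Φ` on the domain in place of its norm on the whole space.
When `w` is a test field on the domain, the pairing sees only the restriction of `Φ`; density of
such fields gives the general case. -/
theorem abs_pair_le_of_mem_sobolevZero (hΩ : IsLipschitzDomain Ω) {s : ℝ}
    {w : 𝓓'((⊤ : Opens (Euc n)), X)} (hw : w ∈ sobolevZero X Ω (-s))
    (Φ : Idx X → 𝓓((⊤ : Opens (Euc n)), ℝ)) :
    |pair w Φ| ≤ sobolevNorm ⊤ (-s) w * sobolevNorm Ω s (smoothField Ω Φ) := by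
  set P := sobolevNorm Ω s (smoothField Ω Φ)
  have hP : 0 ≤ P := sobolevNorm_nonneg _ _ _
  have hB : 0 ≤ besNorm s Φ := besNorm_nonneg _ _
  refine le_of_forall_pos_le_add fun δ hδ => ?_
  have hε : 0 < δ / (1 + P + besNorm s Φ) := by positivity
  obtain ⟨Ψ, hΨ, -⟩ := exists_smoothField_approx_zero hΩ (⟨fun _ _ => 0⟩ : DiffOp n 0 X X) hw
    (DiffOp.onDist_zeroCoeff _ _) hε
  have hm := Submodule.sub_mem _ (smoothField_mem_sobolev ⊤ (-s) Ψ) hw.1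
  have h1 := abs_pair_le_besNorm hm Φ
  have h2 := abs_pair_le_besNorm (smoothField_mem_sobolev Ω s Φ) Ψ
  have h3 := besNorm_le_sobolevNorm_top (-s) Ψ
  have h4 := sobolevNorm_add_le hw.1 hm
  rw [add_sub_cancel] at h4
  rw [neg_neg] at h1
  have h5 : pair (smoothField Ω Φ) Ψ = pair w Φ + pair (smoothField ⊤ Ψ - w) Φ := by
    rw [← pair_add_left, add_sub_cancel, pair_smoothField_comm]
  have h6 : |pair w Φ| ≤ |pair (smoothField Ω Φ) Ψ| + |pair (smoothField ⊤ Ψ - w) Φ| := by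
    rw [← add_sub_cancel_right (pair w Φ) (pair (smoothField ⊤ Ψ - w) Φ), ← h5]
    exact abs_sub _ _
  have h7 := mul_le_mul_of_nonneg_left (h3.trans (h4.trans (add_le_add le_rfl hΨ))) hP
  have h8 := mul_le_mul_of_nonneg_right hΨ hB
  have h9 : δ / (1 + P + besNorm s Φ) * (1 + P + besNorm s Φ) = δ := by field_simp
  change |pair (smoothField Ω Φ) Ψ| ≤ P * besNorm (-s) Ψ at h2
  linarith

theorem isDualScale_sobolev (hΩ : IsLipschitzDomain Ω) :
    IsDualScale (sobolev X Ω) (sobolevZero X Ω) where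
  toIsClosedScale := isClosedScale_sobolev
  smooth_mem s Φ := smoothField_mem_sobolev Ω s Φ
  dense s u hu ε hε := by
    obtain ⟨Φ, hΦ, -⟩ := exists_smoothField_approx hΩ (⟨fun _ _ => 0⟩ : DiffOp n 0 X X) hu
      (DiffOp.onDist_zeroCoeff _ _) hε
    exact ⟨Φ, hΦ⟩
  pair_le s w hw Φ := abs_pair_le_of_mem_sobolevZero hΩ hw Φ
  exists_pair_eq s C hC L hL := by
    obtain ⟨g, hg, hgL⟩ := exists_rho_eq_of_le (-s) hC L fun Φ => by
      rw [neg_neg]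
      exact (hL Φ).trans (mul_le_mul_of_nonneg_left (sobolevNorm_smoothField_le Ω s Φ) hC)
    refine ⟨rho ⊤ (-s) g, ⟨mem_sobolev_iff_exists_rho.2 ⟨g, rfl⟩, fun φ hφ => ?_⟩,
      (sobolevNorm_rho_le ⊤ (-s) g).trans hg, hgL⟩
    -- A field supported off the closure restricts to zero on the domain, so the bound on `L`
    -- becomes `0`. Taking for `x` the value itself shows that it vanishes, which is the support
    -- condition.
    have h : ∀ x, inner ℝ (rho ⊤ (-s) g φ) x ≤ 0 := by
      intro x
      rw [← pair_smul_eq, hgL]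
      refine (hL _).trans_eq ?_
      rw [← smoothDist_eq_smoothField, smoothDist_eq_zero hφ, sobolevNorm_zero, mul_zero]
    exact real_inner_self_nonpos.1 (h _)

theorem isDualScale_sobolevZero (hΩ : IsLipschitzDomain Ω) :
    IsDualScale (sobolevZero X Ω) (sobolev X Ω) where
  toIsClosedScale := isClosedScale_sobolevZero
  smooth_mem s Φ := ⟨smoothField_mem_sobolev ⊤ s Φ, smoothField_mem_supportedIn Φ⟩
  dense s u hu ε hε := by
    obtain ⟨Φ, hΦ, -⟩ := exists_smoothField_approx_zero hΩ (⟨fun _ _ => 0⟩ : DiffOp n 0 X X) hu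
      (DiffOp.onDist_zeroCoeff _ _) hε
    exact ⟨Φ, hΦ⟩
  pair_le s w hw Φ := by
    have h := abs_pair_le_besNorm hw Φ
    rw [neg_neg] at h
    exact h.trans (mul_le_mul_of_nonneg_left (besNorm_le_sobolevNorm_top s Φ)
      (sobolevNorm_nonneg _ _ _))
  exists_pair_eq s C hC L hL := by
    obtain ⟨g, hg, hgL⟩ := exists_rho_eq_of_le (-s) hC L fun Φ => by
      rw [neg_neg]
      exact (hL Φ).trans (mul_le_mul_of_nonneg_left (sobolevNorm_smoothField_le ⊤ s Φ) hC)
    exact ⟨rho Ω (-s) g, mem_sobolev_iff_exists_rho.2 ⟨g, rfl⟩,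
      (sobolevNorm_rho_le Ω (-s) g).trans hg, hgL⟩

end LipschitzScales
end SobolevComplex
end

/-! ### The theorem for the two scales. -/

theorem mainTheorem10 {n α₁ α₂ α₃ : ℕ} {X₁ X₂ X₃ X₄ : Type*}
    [NormedAddCommGroup X₁] [InnerProductSpace ℝ X₁] [FiniteDimensional ℝ X₁]
    [NormedAddCommGroup X₂] [InnerProductSpace ℝ X₂] [FiniteDimensional ℝ X₂]
    [NormedAddCommGroup X₃] [InnerProductSpace ℝ X₃] [FiniteDimensional ℝ X₃]
    [NormedAddCommGroup X₄] [InnerProductSpace ℝ X₄] [FiniteDimensional ℝ X₄]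
    (Ω : Opens (Euc n)) (hΩ : IsLipschitzDomain Ω)
    (D₁ : DiffOp n α₁ X₁ X₂) (D₂ : DiffOp n α₂ X₂ X₃) (D₃ : DiffOp n α₃ X₃ X₄)
    (s₁ s₂ : ℝ) (hs : s₁ ≤ s₂ + α₂) :
    -- the scale `H^q(Ω)`: regular decomposition and duality
    (IsHilbertScale α₁ α₂ (D₁.onDist Ω) (D₂.onDist Ω) (D₃.onDist Ω)
        (sobolev X₁ Ω) (sobolev X₂ Ω) (sobolev X₃ Ω) →
      D₂.space Ω s₁ s₂ =
        sobolev X₂ Ω (s₂ + α₂) ⊔ (sobolev X₁ Ω (s₁ + α₁)).map (D₁.onDist Ω) ∧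
      IsDual (D₂.space Ω s₁ s₂) (D₂.graphNorm Ω s₁ s₂)
        (D₁.adjoint.spaceZero Ω (-s₂ - α₂) (-s₁ - α₁))
        (D₁.adjoint.graphNorm ⊤ (-s₂ - α₂) (-s₁ - α₁))) ∧
    -- the scale `H^q_{Ω̄}(ℝⁿ)`: regular decomposition and duality
    (IsHilbertScale α₁ α₂ (D₁.onDist ⊤) (D₂.onDist ⊤) (D₃.onDist ⊤)
        (sobolevZero X₁ Ω) (sobolevZero X₂ Ω) (sobolevZero X₃ Ω) →
      D₂.spaceZero Ω s₁ s₂ =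
        sobolevZero X₂ Ω (s₂ + α₂) ⊔ (sobolevZero X₁ Ω (s₁ + α₁)).map (D₁.onDist ⊤) ∧
      IsDual (D₂.spaceZero Ω s₁ s₂) (D₂.graphNorm ⊤ s₁ s₂)
        (D₁.adjoint.space Ω (-s₂ - α₂) (-s₁ - α₁))
        (D₁.adjoint.graphNorm Ω (-s₂ - α₂) (-s₁ - α₁))) := by
  constructor
  · intro h
    refine ⟨h.space_eq (fun h => sobolev_anti h) hs, ?_⟩
    rw [← neg_add', ← neg_add']
    exact h.isDual (isDualScale_sobolev hΩ) (isDualScale_sobolev hΩ) isClosedScale_sobolev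
      (fun q u hu hDu ε hε => exists_smoothField_approx hΩ D₁ hu hDu hε) hs
  · intro h
    refine ⟨h.space_eq (fun h => isClosedScale_sobolevZero.anti h) hs, ?_⟩
    rw [← neg_add', ← neg_add']
    exact h.isDual (isDualScale_sobolevZero hΩ) (isDualScale_sobolevZero hΩ)
      isClosedScale_sobolevZero
      (fun q u hu hDu ε hε => exists_smoothField_approx_zero hΩ D₁ hu hDu hε) hs
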